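/- **Setting.** Let $I_{1,4}=\mathrm{diag}(-1,1,1,1,1)$, $G=SO^+(1,4)$, $K=SO^+(1,3)\times SO(1)$, and $\sigma=\mathrm{Ad}\,\mathrm{diag}(1,1,1,1,-1)$. A loop $g$ on $S^1$ is twisted if $g(-\lambda)=\sigma(g(\lambda))$. $\Lambda G_\sigma$ denotes the continuous twisted loops in $G$, and $\Lambda^+G^{\mathbb C}_\sigma$ the twisted loops in $SO(1,4;\mathbb C)$ that extend continuously to the closed unit disk and holomorphically to its interior. Write $z=u+iv$, and let $\mathbb S=\{a<\mathrm{Im}\,z<b\}$, $-\infty\le a<0<b\le\infty$, be a strip containing the real axis. A smooth conformal immersion $y:\mathbb S\to S^3$ has the canonical lift $Y=|y_u|^{-1}(1,y)$ into the light cone of $\mathbb R^{1,4}$. Its conformal Gauss map is the coset $EK\in G/K$ of the frame $E=\big(\tfrac{Y+N}{\sqrt2},\tfrac{-Y+N}{\sqrt2},Y_u,Y_v,\psi\big)\in G$, where the first four columns span $\mathrm{Span}\{Y,Y_u,Y_v,Y_{z\bar z}\}$. The immersion $y$ is a Willmore surface if its conformal Gauss map is harmonic. It is translationally equivariant (TE)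 if $y(z+t)=R(t)\cdot y(z)$ for all $t\in\mathbb R$, $z\in\mathbb S$, for a one-parameter group $R$ in $G$ acting on $S^3$ by Möbius transformations. It is a TE Willmore cylinder with real period $p>0$ if moreover $y(z+p)=y(z)$ for all $z\in\mathbb S$. A matrix function $D(\lambda)$ *produces* the associated family $(y_\lambda)_{|\lambda|=1}$ of TE Willmore surfaces on $\mathbb S$ if there is an Iwasawa decomposition $\exp(zD(\lambda))=F(z,\lambda)V(z,\lambda)$, $z\in\mathbb S$, with $F(z,\cdot)\in\Lambda G_\sigma$ smooth in $z$, $F(0,\lambda)=I$, $V(z,\cdot)\in\Lambda^+G^{\mathbb C}_\sigma$, such that each $y_\lambda$ is a TE Willmore surface with conformal Gauss map $F(\cdot,\lambda)\bmod K$. The surface produced by $D(\lambda)$ is $y=y_1$. For $k,\beta,s\in\mathbb C$ put $B_1=(\sqrt2\beta,-\sqrt2\beta,-k,-ik)^t$, $B_1(\lambda)=\lambda^{-1}B_1+\lambda\overline{B_1}$, $I_{1,3}=\mathrm{diag}(-1,1,1,1)$ and $$D(\lambda)=\begin{pmatrix}\tilde A_1&B_1(\lambda)\\-B_1(\lambda)^tI_{1,3}&0\end{pmatrix},\qquad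 \tilde A_1=\frac1{\sqrt2}\begin{pmatrix}0&0&1-\mathrm{Re}\,s-2|k|^2&\mathrm{Im}\,s\\0&0&1+\mathrm{Re}\,s+2|k|^2&-\mathrm{Im}\,s\\1-\mathrm{Re}\,s-2|k|^2&-(1+\mathrm{Re}\,s+2|k|^2)&0&0\\\mathrm{Im}\,s&\mathrm{Im}\,s&0&0\end{pmatrix}.$$ **Proposition.** Let $\theta,c\in\mathbb R$ and set $k=e^{i\theta}/\sqrt2$, $\beta=0$, $s=2ci$. Then for $|\lambda|=1$ $$D(\lambda)=\begin{pmatrix}0&0&0&\sqrt2c&0\\0&0&\sqrt2&-\sqrt2c&0\\0&-\sqrt2&0&0&-\frac{\lambda^{-1}e^{i\theta}+\lambda e^{-i\theta}}{\sqrt2}\\\sqrt2c&\sqrt2c&0&0&-\frac{i(\lambda^{-1}e^{i\theta}-\lambda e^{-i\theta})}{\sqrt2}\\0&0&\frac{\lambda^{-1}e^{i\theta}+\lambda e^{-i\theta}}{\sqrt2}&\frac{i(\lambda^{-1}e^{i\theta}-\lambda e^{-i\theta})}{\sqrt2}&0\end{pmatrix}.$$ The eigenvalues of $D(1)$, with algebraic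 multiplicity, are $$0,\ \pm\sqrt{-2\pm2\sqrt{1+2c\sin\theta\cos\theta-\sin^2\theta+c^2}}$$ (all four choices of signs; the inner radicand is nonnegative). On some strip containing the real axis, $D(\lambda)$ produces an associated family of TE Willmore surfaces. Moreover: 1. Let $\sin\theta=1$, and let $y$ be the member $\lambda=1$ of any family produced by $D(\lambda)$ on any strip containing the real axis. Then $y$ is a TE Willmore cylinder with some real period if and only if $c=\frac{m^2-l^2}{m^2+l^2}$ for some positive integers $m,l$. More precisely, $p>0$ is a period of $y$ if and only if there are positive integers $m,l$ with $c=\frac{m^2-l^2}{m^2+l^2}$ and $p=\pi\sqrt{m^2+l^2}$; when $m,l$ are coprime, $\pi\sqrt{m^2+l^2}$ is the least positive period. If $c=\pm1$, then $\exp(pD(1))\ne I$ for every real $p\neq0$. 2. Let $c=0$. The eigenvalues of $D(1)$ become $0,\pm\sqrt{-2\pm2\cos\theta}$. In any associated family $(y_\lambda)$ produced by $D(\lambda)$ on any strip containing the real axis, infinitely many members are TE Willmore cylinders with different real periods: the set of the least positive real periods of the members $y_\lambda$, $|\lambda|=1$, that close up is infinite. -/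

import Mathlib

open Complex Matrix
open scoped ContDiff

noncomputable section

/-! ### Lorentz space, the group `SO⁺(1,4)`, and its twisted loop groups -/

/-- The Lorentz metric `diag(-1,1,1,1,1)` on 5-space over a commutative ring. -/
def lorentzMetric (R : Type*) [CommRing R] : Matrix (Fin 5) (Fin 5) R :=
  Matrix.diagonal ![-1, 1, 1, 1, 1]

/-- The Lorentz inner product on `ℝ^{1,4}`. -/
def lorentzInner (x y : Fin 5 → ℝ) : ℝ :=
  x ⬝ᵥ (lorentzMetric ℝ *ᵥ y)

/-- `G = SO⁺(1,4)`, the identity component of `SO(1,4)`. -/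
def SOPlus : Set (Matrix (Fin 5) (Fin 5) ℝ) :=
  {A | Aᵀ * lorentzMetric ℝ * A = lorentzMetric ℝ ∧ A.det = 1 ∧ 0 < A 0 0}

/-- `G^ℂ = SO(1,4;ℂ)`. -/
def SOComplex : Set (Matrix (Fin 5) (Fin 5) ℂ) :=
  {A | Aᵀ * lorentzMetric ℂ * A = lorentzMetric ℂ ∧ A.det = 1}

/-- `K = SO⁺(1,3) × SO(1)`, the stabilizer in `SO⁺(1,4)` of the last basis vector. -/
def KGroup : Set (Matrix (Fin 5) (Fin 5) ℝ) :=
  {A | A ∈ SOPlus ∧ A *ᵥ (Pi.single 4 1) = Pi.single 4 1}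

/-- The involution `σ = Ad diag(1,1,1,1,-1)` whose fixed point group has the same identity
component as `K`. -/
def twist {R : Type*} [CommRing R] (A : Matrix (Fin 5) (Fin 5) R) : Matrix (Fin 5) (Fin 5) R :=
  Matrix.diagonal ![1, 1, 1, 1, -1] * A * Matrix.diagonal ![1, 1, 1, 1, -1]

/-- `g ∈ ΛG_σ`: a continuous twisted loop `S¹ → SO⁺(1,4)`; only the values of `g` on the unit
circle matter. -/
def IsRealTwistedLoop (g : ℂ → Matrix (Fin 5) (Fin 5) ℝ) : Prop :=
  (∀ i j, ContinuousOn (fun ζ => g ζ i j) (Metric.sphere 0 1)) ∧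
  ∀ ζ : ℂ, ‖ζ‖ = 1 → g ζ ∈ SOPlus ∧ g (-ζ) = twist (g ζ)

/-- `g ∈ Λ⁺G^ℂ_σ`: a twisted loop in `SO(1,4;ℂ)` that extends holomorphically to the unit disk
(and continuously to its closure). -/
def IsPlusTwistedLoop (g : ℂ → Matrix (Fin 5) (Fin 5) ℂ) : Prop :=
  (∀ i j, DiffContOnCl ℂ (fun ζ => g ζ i j) (Metric.ball 0 1)) ∧
  (∀ ζ : ℂ, ‖ζ‖ ≤ 1 → g ζ ∈ SOComplex) ∧
  ∀ ζ : ℂ, ‖ζ‖ = 1 → g (-ζ) = twist (g ζ)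

/-- The open strip `a < Im z < b`, with `a`, `b` possibly infinite. -/
def strip (a b : EReal) : Set ℂ :=
  {z | a < (z.im : EReal) ∧ (z.im : EReal) < b}

/-! ### Conformal immersions into `S³` and their conformal Gauss maps -/

/-- The partial derivative in `u`, where `z = u + i v`. -/
def partialU {E : Type*} [NormedAddCommGroup E] [NormedSpace ℝ E] (f : ℂ → E) (z : ℂ) : E :=
  lineDeriv ℝ f z 1

/-- The partial derivative in `v`, where `z = u + i v`. -/
def partialV {E : Type*} [NormedAddCommGroup E] [NormedSpace ℝ E] (f : ℂ → E) (z : ℂ) : E :=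
  lineDeriv ℝ f z Complex.I

/-- The Laplacian `∂²/∂u² + ∂²/∂v² = 4 ∂²/∂z∂z̄`. -/
def planeLaplacian {E : Type*} [NormedAddCommGroup E] [NormedSpace ℝ E] (f : ℂ → E) (z : ℂ) : E :=
  partialU (partialU f) z + partialV (partialV f) z

/-- A smooth conformal immersion of `S` into `S³ ⊆ ℝ⁴`. -/
structure IsConformalImmersion (S : Set ℂ) (y : ℂ → EuclideanSpace ℝ (Fin 4)) : Prop where
  smooth : ContDiffOn ℝ ∞ y S
  mem_sphere : ∀ z ∈ S, ‖y z‖ = 1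
  immersed : ∀ z ∈ S, partialU y z ≠ 0
  norm_eq : ∀ z ∈ S, ‖partialU y z‖ = ‖partialV y z‖
  orthogonal : ∀ z ∈ S, inner ℝ (partialU y z) (partialV y z) = 0

/-- The vector `(1, x)`, which spans the light-like line of `x ∈ S³`. -/
def lightVector (x : EuclideanSpace ℝ (Fin 4)) : Fin 5 → ℝ :=
  ![1, x 0, x 1, x 2, x 3]

/-- The canonical lift `Y` of `y` with respect to `z`: the future light-like lift with
`⟨Y_z, Y_z̄⟩ = 1/2`. -/
def canonicalLift (y : ℂ → EuclideanSpace ℝ (Fin 4)) (z : ℂ) : Fin 5 → ℝ :=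
  ‖partialU y z‖⁻¹ • lightVector (y z)

/-- `E` is the frame `((Y+N)/√2, (-Y+N)/√2, Y_u, Y_v, ψ)` of the conformal Gauss map of `y` at `z`.
The last condition says that the unit vector `ψ` is normal to `Span {Y, Y_u, Y_v, Y_{z z̄}}`, so that
this span is the span of the first four columns; the null vector `N` is determined by
`E ∈ SO⁺(1,4)`. The conformal Gauss map of `y` at `z` is the coset `E K`, which is identified with
the point `ψ` of de Sitter space `SO⁺(1,4)/SO⁺(1,3)`. -/
def IsGaussFrame (y : ℂ → EuclideanSpace ℝ (Fin 4)) (z : ℂ)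
    (E : Matrix (Fin 5) (Fin 5) ℝ) : Prop :=
  E ∈ SOPlus ∧
  E.col 0 - E.col 1 = √2 • canonicalLift y z ∧
  E.col 2 = partialU (canonicalLift y) z ∧
  E.col 3 = partialV (canonicalLift y) z ∧
  lorentzInner (E.col 4) (planeLaplacian (canonicalLift y) z) = 0

/-- A map `ψ` into de Sitter space `{x ∈ ℝ^{1,4} : ⟨x,x⟩ = 1}` is harmonic. -/
def IsHarmonicToDeSitter (S : Set ℂ) (ψ : ℂ → Fin 5 → ℝ) : Prop :=
  ContDiffOn ℝ ∞ ψ S ∧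
  ∀ z ∈ S, lorentzInner (ψ z) (ψ z) = 1 ∧
    planeLaplacian ψ z
      + (lorentzInner (partialU ψ z) (partialU ψ z)
          + lorentzInner (partialV ψ z) (partialV ψ z)) • ψ z = 0

/-- `y` is a Willmore surface in `S³`: a conformal immersion whose conformal Gauss map is
harmonic. -/
def IsWillmoreSurface (S : Set ℂ) (y : ℂ → EuclideanSpace ℝ (Fin 4)) : Prop :=
  IsConformalImmersion S y ∧
  ∃ E : ℂ → Matrix (Fin 5) (Fin 5) ℝ,
    (∀ z ∈ S, IsGaussFrame y z (E z)) ∧ IsHarmonicToDeSitter S (fun z => (E z).col 4)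

/-- `y` is translationally equivariant (TE): `y (z + t) = R(t) . y z` for a one-parameter group `R`
in `SO⁺(1,4)`, which acts on `S³` through the light-like lines. -/
def IsTranslationallyEquivariant (S : Set ℂ) (y : ℂ → EuclideanSpace ℝ (Fin 4)) : Prop :=
  ∃ R : ℝ → Matrix (Fin 5) (Fin 5) ℝ,
    Continuous R ∧ R 0 = 1 ∧ (∀ s t, R (s + t) = R s * R t) ∧ (∀ t, R t ∈ SOPlus) ∧
    ∀ z ∈ S, ∀ t : ℝ, ∃ ρ : ℝ, 0 < ρ ∧
      R t *ᵥ lightVector (y z) = ρ • lightVector (y (z + t))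

/-- `y` closes up with real period `p`, i.e. it descends to the cylinder `S / pℤ`. -/
def HasRealPeriod (S : Set ℂ) (y : ℂ → EuclideanSpace ℝ (Fin 4)) (p : ℝ) : Prop :=
  ∀ z ∈ S, y (z + p) = y z

/-! ### Surfaces produced by a potential -/

/-- `F` is the extended frame on `S` obtained from the holomorphic potential `D(λ) dz` by the
Iwasawa decomposition `exp (z D(λ)) = F(z, z̄, λ) V(z, z̄, λ)` with `F ∈ ΛG_σ`, `V ∈ Λ⁺G^ℂ_σ` and
`F(0, 0, λ) = I`. -/
def IsExtendedFrame (D : ℂ → Matrix (Fin 5) (Fin 5) ℂ) (S : Set ℂ)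
    (F : ℂ → ℂ → Matrix (Fin 5) (Fin 5) ℝ) : Prop :=
  (∀ ζ : ℂ, ‖ζ‖ = 1 → F 0 ζ = 1 ∧ ∀ i j, ContDiffOn ℝ ∞ (fun z => F z ζ i j) S) ∧
  (∀ z ∈ S, IsRealTwistedLoop (F z)) ∧
  ∃ V : ℂ → ℂ → Matrix (Fin 5) (Fin 5) ℂ,
    (∀ z ∈ S, IsPlusTwistedLoop (V z)) ∧
    ∀ z ∈ S, ∀ ζ : ℂ, ‖ζ‖ = 1 →
      NormedSpace.exp (z • D ζ) = (F z ζ).map (fun x : ℝ => (x : ℂ)) * V z ζ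

/-- `(y ζ)`, `|ζ| = 1`, is the associated family of TE Willmore surfaces in `S³` that the potential
`D(λ) dz` produces on `S`: the conformal Gauss map of `y ζ` is `F(·, ζ) mod K`, where `F` is the
extended frame obtained from `D(λ) dz`. The surface produced by `D` itself is `y 1`. -/
def ProducesFamily (D : ℂ → Matrix (Fin 5) (Fin 5) ℂ) (S : Set ℂ)
    (y : ℂ → ℂ → EuclideanSpace ℝ (Fin 4)) : Prop :=
  ∃ F : ℂ → ℂ → Matrix (Fin 5) (Fin 5) ℝ, IsExtendedFrame D S F ∧
    ∀ ζ : ℂ, ‖ζ‖ = 1 →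
      IsWillmoreSurface S (y ζ) ∧ IsTranslationallyEquivariant S (y ζ) ∧
      ∀ z ∈ S, ∃ E, IsGaussFrame (y ζ) z E ∧ ∃ k ∈ KGroup, F z ζ = E * k

/-! ### The Delaunay potential -/

/-- `B₁(λ) = λ⁻¹ B₁ + λ B̄₁` with `B₁ = (√2 β, -√2 β, -k, -i k)ᵗ`. -/
def potentialB (k β ζ : ℂ) : Fin 4 → ℂ :=
  ζ⁻¹ • ![√2 * β, -(√2 * β), -k, -(Complex.I * k)]
    + ζ • (star ![√2 * β, -(√2 * β), -k, -(Complex.I * k)])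

/-- The Delaunay potential `D(λ)` of a TE Willmore surface in `S³` with Hopf differential `k`,
its derivative `β`, and Schwarzian `s` at `z = 0`; the last row is `-B₁(λ)ᵗ I_{1,3}`. -/
def willmorePotential (k β s ζ : ℂ) : Matrix (Fin 5) (Fin 5) ℂ :=
  let a : ℂ := ((1 - s.re - 2 * ‖k‖ ^ 2) / √2 : ℝ)
  let b : ℂ := ((1 + s.re + 2 * ‖k‖ ^ 2) / √2 : ℝ)
  let d : ℂ := (s.im / √2 : ℝ)
  let B := potentialB k β ζ
  !![0, 0, a, d, B 0;
     0, 0, b, -d, B 1;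
     a, -b, 0, 0, B 2;
     d, d, 0, 0, B 3;
     B 0, -B 1, -B 2, -B 3, 0]

/-- The potential with `k = e^{iθ}/√2`, `β = 0`, `s = 2ci`. -/
def cylinderPotential (θ c : ℝ) (ζ : ℂ) : Matrix (Fin 5) (Fin 5) ℂ :=
  willmorePotential (Complex.exp (Complex.I * θ) / √2) 0 (2 * c * Complex.I) ζ

end

noncomputable section

/-! ### The matrix exponential -/

section
open scoped Matrix.Norms.Operator

/-! On the unit circle `D(ζ)` is real, and it is the `du`-part at `v = 0` of the Maurer–Cartan form
of a TE Willmore surface. For such a surface `k`, `β`, `s` depend on `v` only, so the structure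
equations are an ODE in `v`.

Existence. Solve this ODE together with `V' = 2i · antiForm · V`, `V(0) = 1`. Taking the entries of
`V` in the disk algebra makes `V` holomorphic in `λ` automatically. Put `F = exp(zD) V⁻¹`. Flatness
is the Lax equation `U' = [U, W]` (`hasDerivAt_uForm`). Uniqueness for linear ODEs then gives `D F =
F U` on the imaginary axis, `F_v = F W` and the reality of `F` (`real_frame`). The light-like
combination of the first two columns of `F` is the canonical lift of a surface with Gauss frame `F`,
and the equations for `k` and `β` make the last column harmonic (`willmore_of_frame`).

Periods. Let `R` be the one-parameter group of any member of any produced family. Gauss frames are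
unique and move by `R`, so `p` is a period iff `R(p) = 1` (`hasRealPeriod_iff`). By uniqueness of
the Iwasawa decomposition the normal `ψ` is that of the constructed frame, which moves by
`exp(pD(ζ))`. The normals and their derivatives determine a Lorentz transformation, so `R(p) =
exp(pD(ζ))` (`hasRealPeriod_iff_exp_eq_one`).

Arithmetic. In the two cases of the proposition the characteristic polynomial of `D` is `t⁵ + 4t³ +
(4 - 4g²)t`, with `g = c` when `sin θ = 1` and `g = Re(ζ⁻¹e^{iθ})` when `c = 0`. The squares of the
nonzero eigenvalues are `-2 ± 2g`, so `exp(pD) = 1` forces `p√(2 - 2g) = 2πl` and `p√(2 + 2g) =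
2πm`. The sum of the squares gives `p = π√(m² + l²)`, the difference gives `g`. Multiple eigenvalues
need separate care: `g = 0` is semisimple in the relevant case, `g = ±1` is not. For `c = 0` the
parameter `g` varies along the associated family and takes the values `(m² - 1)/(m² + 1)`, whose
least periods `π√(m² + 1)` are pairwise distinct. -/

theorem continuous_matrix_exp :
    Continuous (NormedSpace.exp : Matrix (Fin 5) (Fin 5) ℂ → Matrix (Fin 5) (Fin 5) ℂ) :=
  NormedSpace.exp_continuous

theorem hasDerivAt_matrix_exp_entry (D : Matrix (Fin 5) (Fin 5) ℂ) (t : ℂ) (i j : Fin 5) :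
    HasDerivAt (fun u : ℂ => NormedSpace.exp (u • D) i j) ((D * NormedSpace.exp (t • D)) i j) t :=
  hasDerivAt_pi.1 (hasDerivAt_pi.1 (hasDerivAt_exp_smul_const' D t) i) j

theorem hasSum_matrix_exp (D : Matrix (Fin 5) (Fin 5) ℂ) :
    HasSum (fun n : ℕ => ((n.factorial : ℂ)⁻¹) • D ^ n) (NormedSpace.exp D) :=
  NormedSpace.exp_series_hasSum_exp' D

theorem matrix_exp_algebraMap (μ : ℂ) :
    NormedSpace.exp (μ • (1 : Matrix (Fin 5) (Fin 5) ℂ)) = Complex.exp μ • 1 := by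
  have h := NormedSpace.algebraMap_exp_comm (𝕂 := ℂ) (𝔸 := Matrix (Fin 5) (Fin 5) ℂ) μ
  rw [Algebra.algebraMap_eq_smul_one, Algebra.algebraMap_eq_smul_one, ← Complex.exp_eq_exp_ℂ] at h
  exact h.symm
end

/-- Termwise in the exponential series. `X` need not be invertible: it will be a matrix of
eigenvectors, a polynomial in `D`, the metric or the twisting matrix. -/
theorem matrix_exp_mul_of_mul_eq {D X D' : Matrix (Fin 5) (Fin 5) ℂ} (h : D * X = X * D') :
    NormedSpace.exp D * X = X * NormedSpace.exp D' := by
  have h1 := (hasSum_matrix_exp D).mul_right X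
  have h2 := (hasSum_matrix_exp D').mul_left X
  have hn : ∀ n : ℕ, D ^ n * X = X * D' ^ n := fun n => by
    induction n with
    | zero => simp
    | succ n ih => rw [pow_succ, mul_assoc, h, ← mul_assoc, ih, mul_assoc, ← pow_succ]
  have he : (fun n : ℕ => ((n.factorial : ℂ)⁻¹) • D ^ n * X)
      = fun n : ℕ => X * ((n.factorial : ℂ)⁻¹) • D' ^ n := by
    funext n; rw [smul_mul_assoc, hn, mul_smul_comm]
  rw [he] at h1
  exact h1.unique h2

theorem matrix_exp_mul_of_mul_eq_smul {D X : Matrix (Fin 5) (Fin 5) ℂ} {μ : ℂ}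
    (h : D * X = μ • X) : NormedSpace.exp D * X = Complex.exp μ • X := by
  rw [matrix_exp_mul_of_mul_eq (D' := μ • 1) (by simpa using h), matrix_exp_algebraMap]
  simp

/-- `DQ + wQ` and `DQ - wQ` consist of eigenvectors for `w` and `-w`, both fixed by `exp D`; since
`w ≠ 0`, their difference recovers `Q`. -/
theorem matrix_exp_mul_of_sq_mul_eq {D Q : Matrix (Fin 5) (Fin 5) ℂ} {w : ℂ} (hw : w ≠ 0)
    (he : Complex.exp w = 1) (h : D * (D * Q) = w ^ 2 • Q) : NormedSpace.exp D * Q = Q := by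
  have he' : Complex.exp (-w) = 1 := by rw [Complex.exp_neg, he, inv_one]
  have h1 : NormedSpace.exp D * (D * Q + w • Q) = D * Q + w • Q := by
    rw [matrix_exp_mul_of_mul_eq_smul (μ := w), he, one_smul]
    rw [mul_add, h, mul_smul_comm, smul_add, smul_smul, ← sq, add_comm]
  have h2 : NormedSpace.exp D * (D * Q - w • Q) = D * Q - w • Q := by
    rw [matrix_exp_mul_of_mul_eq_smul (μ := -w), he', one_smul]
    rw [mul_sub, h, mul_smul_comm, smul_sub, smul_smul, neg_smul, neg_mul, ← sq, neg_smul]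
    abel
  have h3 : Q = (2 * w)⁻¹ • ((D * Q + w • Q) - (D * Q - w • Q)) := by
    have : (D * Q + w • Q) - (D * Q - w • Q) = (2 * w) • Q := by
      rw [two_mul, add_smul]; abel
    rw [this, smul_smul, inv_mul_cancel₀ (mul_ne_zero two_ne_zero hw), one_smul]
  calc NormedSpace.exp D * Q
      = (2 * w)⁻¹ • (NormedSpace.exp D * (D * Q + w • Q)
          - NormedSpace.exp D * (D * Q - w • Q)) := by
        rw [← mul_sub, ← mul_smul_comm, ← h3]
    _ = Q := by rw [h1, h2, ← h3]

/-! ### Matrices with characteristic polynomial `X⁵ + 4X³ + (4 - 4g²)X` -/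

theorem exp_eq_one_of_matrix_exp_eq_one {D : Matrix (Fin 5) (Fin 5) ℂ} {p w : ℂ}
    (hD : NormedSpace.exp (p • D) = 1) (hw : (Matrix.scalar (Fin 5) w - D).det = 0) :
    Complex.exp (p * w) = 1 := by
  obtain ⟨v, hv, hv'⟩ := Matrix.exists_mulVec_eq_zero_iff.2 hw
  rw [sub_mulVec, sub_eq_zero] at hv'
  have hDv : D *ᵥ v = w • v := by rw [← hv']; simp [Matrix.scalar_apply]
  -- The eigenvector is repeated in every column, so that the intertwining lemma for square matrices
  -- applies.
  set X : Matrix (Fin 5) (Fin 5) ℂ := Matrix.of fun i _ => v i with hX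
  have hDX : (p • D) * X = (p * w) • X := by
    ext i j
    have := congrFun hDv i
    simp only [mulVec, dotProduct, Pi.smul_apply, smul_eq_mul] at this
    simp only [Matrix.smul_apply, Matrix.mul_apply, hX, Matrix.of_apply, smul_eq_mul, mul_assoc,
      ← Finset.mul_sum, this]
  have h := matrix_exp_mul_of_mul_eq_smul hDX
  rw [hD, one_mul] at h
  obtain ⟨i, hi⟩ := Function.ne_iff.1 hv
  have h2 : v i = Complex.exp (p * w) * v i := congrFun (congrFun h i) 0
  have h3 : (Complex.exp (p * w) - 1) * v i = 0 := by linear_combination -h2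
  rcases mul_eq_zero.1 h3 with h4 | h4
  · linear_combination h4
  · exact absurd h4 hi

/-- The polynomial `t(t² - a)(t² - b)` kills `D`. As `0`, `a`, `b` are distinct, the identity is a
sum of three polynomials in `D` on whose ranges `D` (first piece) or `D² - a`, `D² - b` vanishes,
and `exp(pD)` fixes each piece. -/
theorem matrix_exp_eq_one_of_annihilated {D : Matrix (Fin 5) (Fin 5) ℂ} {a b p : ℂ}
    (ha : a ≠ 0) (hb : b ≠ 0) (hab : a ≠ b) {w₁ w₂ : ℂ} (hw₁ : w₁ ≠ 0) (hw₂ : w₂ ≠ 0)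
    (he₁ : Complex.exp w₁ = 1) (he₂ : Complex.exp w₂ = 1)
    (h₁ : p ^ 2 * a = w₁ ^ 2) (h₂ : p ^ 2 * b = w₂ ^ 2)
    (h : D ^ 5 = (a + b) • D ^ 3 - (a * b) • D) : NormedSpace.exp (p • D) = 1 := by
  have h6 : D ^ 6 = (a + b) • D ^ 4 - (a * b) • D ^ 2 := by
    rw [pow_succ', h, mul_sub, mul_smul_comm, mul_smul_comm, ← pow_succ', ← sq]
  have e1 : NormedSpace.exp (p • D) * (D ^ 4 - (a + b) • D ^ 2 + (a * b) • 1)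
      = D ^ 4 - (a + b) • D ^ 2 + (a * b) • 1 := by
    rw [matrix_exp_mul_of_mul_eq_smul (μ := 0)]
    · simp
    · rw [smul_mul_assoc, mul_add, mul_sub, mul_smul_comm, mul_smul_comm, ← pow_succ', ← pow_succ',
        h, mul_one]
      simp
  have e2 : NormedSpace.exp (p • D) * (D ^ 4 - b • D ^ 2) = D ^ 4 - b • D ^ 2 := by
    refine matrix_exp_mul_of_sq_mul_eq hw₁ he₁ ?_
    rw [← h₁, smul_mul_assoc, smul_mul_assoc, mul_smul_comm, smul_smul, ← sq, ← mul_assoc, ← sq,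
      mul_sub, mul_smul_comm, ← pow_add, ← pow_add, h6]
    norm_num
    module
  have e3 : NormedSpace.exp (p • D) * (D ^ 4 - a • D ^ 2) = D ^ 4 - a • D ^ 2 := by
    refine matrix_exp_mul_of_sq_mul_eq hw₂ he₂ ?_
    rw [← h₂, smul_mul_assoc, smul_mul_assoc, mul_smul_comm, smul_smul, ← sq, ← mul_assoc, ← sq,
      mul_sub, mul_smul_comm, ← pow_add, ← pow_add, h6]
    norm_num
    module
  have hab' : a - b ≠ 0 := sub_ne_zero.2 hab
  -- Lagrange interpolation of the constant `1` in the variable `D²` at the nodes `0`, `a`, `b`.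
  have e : (1 : Matrix (Fin 5) (Fin 5) ℂ)
      = (a * b)⁻¹ • (D ^ 4 - (a + b) • D ^ 2 + (a * b) • 1)
        + (a * (a - b))⁻¹ • (D ^ 4 - b • D ^ 2) - (b * (a - b))⁻¹ • (D ^ 4 - a • D ^ 2) := by
    match_scalars <;> field_simp <;> ring
  calc NormedSpace.exp (p • D) = NormedSpace.exp (p • D) * 1 := (mul_one _).symm
    _ = 1 := by
      conv_lhs => rw [e]
      rw [mul_sub, mul_add, mul_smul_comm, mul_smul_comm, mul_smul_comm, e1, e2, e3, ← e]

theorem pow_five_eq_of_det {D : Matrix (Fin 5) (Fin 5) ℂ} {q : ℂ}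
    (hdet : ∀ t : ℂ, (Matrix.scalar (Fin 5) t - D).det = t ^ 5 + 4 * t ^ 3 + q * t) :
    D ^ 5 = (-4 : ℂ) • D ^ 3 - q • D := by
  have hc : D.charpoly = Polynomial.X ^ 5 + 4 * Polynomial.X ^ 3 + Polynomial.C q * Polynomial.X := by
    refine Polynomial.funext fun t => ?_
    rw [Matrix.eval_charpoly, hdet]
    simp
  have h := Matrix.aeval_self_charpoly D
  rw [hc] at h
  simp only [map_add, map_mul, map_pow, Polynomial.aeval_X, Polynomial.aeval_C,
    Algebra.algebraMap_eq_smul_one, smul_mul_assoc, one_mul, map_ofNat] at h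
  have h4 : (4 : Matrix (Fin 5) (Fin 5) ℂ) * D ^ 3 = (4 : ℂ) • D ^ 3 := by
    rw [show (4 : Matrix (Fin 5) (Fin 5) ℂ) = (4 : ℂ) • 1 by
      rw [← Algebra.algebraMap_eq_smul_one, map_ofNat], smul_mul_assoc, one_mul]
  rw [h4] at h
  rw [neg_smul, eq_sub_iff_add_eq, eq_neg_iff_add_eq_zero, ← h]
  abel

/-! ### When the one-parameter group `exp(pD)` closes up. -/

theorem exists_nat_of_exp_eq_one {r : ℝ} (hr : 0 < r) (h : Complex.exp (r * Complex.I) = 1) :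
    ∃ n : ℕ, 0 < n ∧ r = 2 * Real.pi * n := by
  obtain ⟨n, hn⟩ := Complex.exp_eq_one_iff.1 h
  have h1 : r = n * (2 * Real.pi) := by
    have := congrArg Complex.im hn
    simpa using this
  have hn0 : 0 < n := by
    by_contra hcon
    have : (n : ℝ) ≤ 0 := by exact_mod_cast not_lt.1 hcon
    nlinarith [Real.pi_pos]
  refine ⟨n.toNat, by omega, ?_⟩
  have : ((n.toNat : ℤ) : ℝ) = (n : ℝ) := by rw [Int.toNat_of_nonneg hn0.le]
  rw [h1, ← this]; push_cast; ring

theorem exp_two_pi_nat (n : ℕ) : Complex.exp (2 * Real.pi * n * Complex.I) = 1 :=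
  Complex.exp_eq_one_iff.2 ⟨n, by push_cast; ring⟩

/-- The polynomial factors as `t(t² + 2 - 2g)(t² + 2 + 2g)`, so each nonzero eigenvalue imposes an
integrality condition on `p`. It does not determine the Jordan form when factors collide: `hzero`
and `hone` supply that information at `g = 0` and `g = ±1`. -/
theorem matrix_exp_eq_one_iff {D : Matrix (Fin 5) (Fin 5) ℂ} {g : ℝ}
    (hdet : ∀ t : ℂ, (Matrix.scalar (Fin 5) t - D).det = t ^ 5 + 4 * t ^ 3 + (4 - 4 * g ^ 2) * t)
    (hzero : g = 0 → D ^ 3 = (-2 : ℂ) • D)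
    (hone : g = 1 ∨ g = -1 → ∀ p : ℝ, p ≠ 0 → NormedSpace.exp ((p : ℂ) • D) ≠ 1)
    {p : ℝ} (hp : 0 < p) :
    NormedSpace.exp ((p : ℂ) • D) = 1 ↔
      ∃ m l : ℕ, 0 < m ∧ 0 < l ∧ g = ((m : ℝ) ^ 2 - l ^ 2) / (m ^ 2 + l ^ 2) ∧
        p = Real.pi * √((m : ℝ) ^ 2 + l ^ 2) := by
  have hpi := Real.pi_pos
  constructor
  · intro h
    have hroot : ∀ w : ℂ, w ^ 4 + 4 * w ^ 2 + (4 - 4 * g ^ 2) = 0 → Complex.exp (p * w) = 1 :=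
      fun w hw => exp_eq_one_of_matrix_exp_eq_one h
        (by rw [hdet]; linear_combination w * hw)
    -- If `|g| > 1`, then `√(2|g| - 2)` is a positive real eigenvalue, and its exponential grows.
    -- The dummy `d` stands for `g` and for `-g`.
    have hlarge : ∀ d : ℝ, d ^ 2 = g ^ 2 → d ≤ 1 := by
      intro d hd
      by_contra hcon
      rw [not_le] at hcon
      have hs : 0 < √(2 * d - 2) := Real.sqrt_pos.2 (by linarith)
      have hs2 : ((√(2 * d - 2) : ℝ) : ℂ) ^ 2 = 2 * d - 2 := by
        rw [← Complex.ofReal_pow, Real.sq_sqrt (by linarith)]; push_cast; ring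
      have hd' : (d : ℂ) ^ 2 = (g : ℂ) ^ 2 := by exact_mod_cast hd
      have h1 := hroot (√(2 * d - 2) : ℝ)
        (by linear_combination (((√(2 * d - 2) : ℝ) : ℂ) ^ 2 + 2 * d + 2) * hs2 + 4 * hd')
      rw [← Complex.ofReal_mul, ← Complex.ofReal_exp] at h1
      have h2 : Real.exp (p * √(2 * d - 2)) = 1 := by exact_mod_cast h1
      rw [Real.exp_eq_one_iff] at h2
      exact absurd h2 (mul_pos hp hs).ne'
    have hne1 : g ≠ 1 := fun hg => hone (Or.inl hg) p hp.ne' h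
    have hne2 : g ≠ -1 := fun hg => hone (Or.inr hg) p hp.ne' h
    have hg1 : g < 1 := lt_of_le_of_ne (hlarge g rfl) hne1
    have hg2 : -1 < g := by
      have := hlarge (-g) (by ring)
      exact lt_of_le_of_ne (by linarith) (Ne.symm hne2)
    have hfreq : ∀ d : ℝ, d ^ 2 = g ^ 2 → d < 1 →
        ∃ n : ℕ, 0 < n ∧ p ^ 2 * (2 - 2 * d) = (2 * Real.pi * n) ^ 2 := by
      intro d hd hd1
      have hs : 0 < √(2 - 2 * d) := Real.sqrt_pos.2 (by linarith)
      have hs2 : ((√(2 - 2 * d) : ℝ) : ℂ) ^ 2 = 2 - 2 * d := by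
        rw [← Complex.ofReal_pow, Real.sq_sqrt (by linarith)]; push_cast; ring
      have hd' : (d : ℂ) ^ 2 = (g : ℂ) ^ 2 := by exact_mod_cast hd
      have h1 := hroot ((√(2 - 2 * d) : ℝ) * Complex.I) (by
        rw [mul_pow, mul_pow, hs2, Complex.I_sq, Complex.I_pow_four,
          show ((√(2 - 2 * d) : ℝ) : ℂ) ^ 4 = (2 - 2 * d) ^ 2 by rw [← hs2]; ring]
        linear_combination 4 * hd')
      rw [← mul_assoc, ← Complex.ofReal_mul] at h1
      obtain ⟨n, hn, hn'⟩ := exists_nat_of_exp_eq_one (mul_pos hp hs) h1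
      exact ⟨n, hn, by rw [← hn', mul_pow, Real.sq_sqrt (by linarith)]⟩
    obtain ⟨l, hl, hl'⟩ := hfreq g rfl hg1
    obtain ⟨m, hm, hm'⟩ := hfreq (-g) (by ring) (by linarith)
    have hm0 : (0 : ℝ) < m := by exact_mod_cast hm
    -- The sum of `p²(2 - 2g) = (2πl)²` and `p²(2 + 2g) = (2πm)²`; their difference yields `g`
    -- below.
    have hsum : p ^ 2 = Real.pi ^ 2 * ((m : ℝ) ^ 2 + l ^ 2) := by linarith
    have hpos : (0 : ℝ) < (m : ℝ) ^ 2 + l ^ 2 := by positivity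
    refine ⟨m, l, hm, hl, ?_, ?_⟩
    · rw [eq_div_iff hpos.ne']
      have : Real.pi ^ 2 * (g * ((m : ℝ) ^ 2 + l ^ 2)) = Real.pi ^ 2 * ((m : ℝ) ^ 2 - l ^ 2) := by
        have : p ^ 2 * g = Real.pi ^ 2 * ((m : ℝ) ^ 2 - l ^ 2) := by linarith
        rw [← this, hsum]; ring
      exact mul_left_cancel₀ (by positivity) this
    · rw [← Real.sqrt_sq hp.le, hsum, Real.sqrt_mul (by positivity), Real.sqrt_sq hpi.le]
  · rintro ⟨m, l, hm, hl, hg, hpp⟩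
    have hm0 : (0 : ℝ) < m := by exact_mod_cast hm
    have hl0 : (0 : ℝ) < l := by exact_mod_cast hl
    have hpos : (0 : ℝ) < (m : ℝ) ^ 2 + l ^ 2 := by positivity
    have hp2 : p ^ 2 = Real.pi ^ 2 * ((m : ℝ) ^ 2 + l ^ 2) := by
      rw [hpp, mul_pow, Real.sq_sqrt hpos.le]
    have h1 : p ^ 2 * (2 - 2 * g) = (2 * Real.pi * l) ^ 2 := by
      rw [hp2, hg]; field_simp; ring
    have h2 : p ^ 2 * (2 + 2 * g) = (2 * Real.pi * m) ^ 2 := by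
      rw [hp2, hg]; field_simp; ring
    have hg1 : 2 - 2 * g ≠ 0 := fun h0 => by
      rw [h0, mul_zero] at h1; exact absurd h1.symm (by positivity)
    have hg2 : 2 + 2 * g ≠ 0 := fun h0 => by
      rw [h0, mul_zero] at h2; exact absurd h2.symm (by positivity)
    have h1' : (p : ℂ) ^ 2 * (-2 + 2 * g) = (2 * Real.pi * l * Complex.I) ^ 2 := by
      have : (p : ℂ) ^ 2 * (2 - 2 * g) = (2 * Real.pi * l) ^ 2 := by exact_mod_cast h1
      rw [mul_pow, Complex.I_sq]; linear_combination -this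
    have h2' : (p : ℂ) ^ 2 * (-2 - 2 * g) = (2 * Real.pi * m * Complex.I) ^ 2 := by
      have : (p : ℂ) ^ 2 * (2 + 2 * g) = (2 * Real.pi * m) ^ 2 := by exact_mod_cast h2
      rw [mul_pow, Complex.I_sq]; linear_combination -this
    have hw : ∀ n : ℕ, 0 < n → (2 * Real.pi * n * Complex.I : ℂ) ≠ 0 := fun n hn => by
      have : (n : ℂ) ≠ 0 := by exact_mod_cast hn.ne'
      have : (Real.pi : ℂ) ≠ 0 := by exact_mod_cast hpi.ne'
      simp [*]
    by_cases hg0 : g = 0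
    -- Here both nonzero nodes equal `-2`, so the three-term interpolation breaks down. By `D³ =
    -- -2D` the two nodes `0` and `-2` suffice.
    · have h3 := hzero hg0
      have e1 : NormedSpace.exp ((p : ℂ) • D) * (D ^ 2 + (2 : ℂ) • 1) = D ^ 2 + (2 : ℂ) • 1 := by
        rw [matrix_exp_mul_of_mul_eq_smul (μ := 0)]
        · simp
        · rw [smul_mul_assoc, mul_add, ← pow_succ', h3]
          simp
      have e2 : NormedSpace.exp ((p : ℂ) • D) * D ^ 2 = D ^ 2 := by
        refine matrix_exp_mul_of_sq_mul_eq (hw l hl) (exp_two_pi_nat l) ?_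
        rw [← h1', smul_mul_assoc, smul_mul_assoc, ← pow_succ', h3, hg0]
        simp only [mul_smul_comm, ← sq, smul_smul]
        congr 1
        push_cast; ring
      have e3 : (1 : Matrix (Fin 5) (Fin 5) ℂ)
          = (2 : ℂ)⁻¹ • (D ^ 2 + (2 : ℂ) • 1) - (2 : ℂ)⁻¹ • D ^ 2 := by
        module
      calc NormedSpace.exp ((p : ℂ) • D) = NormedSpace.exp ((p : ℂ) • D) * 1 := (mul_one _).symm
        _ = 1 := by
          conv_lhs => rw [e3]
          rw [mul_sub, mul_smul_comm, mul_smul_comm, e1, e2, ← e3]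
    · refine matrix_exp_eq_one_of_annihilated (a := -2 + 2 * g) (b := -2 - 2 * g) ?_ ?_ ?_
        (hw l hl) (hw m hm) (exp_two_pi_nat l) (exp_two_pi_nat m) h1' h2' ?_
      · intro h0; apply hg1
        have : ((2 - 2 * g : ℝ) : ℂ) = 0 := by push_cast; linear_combination -h0
        exact_mod_cast this
      · intro h0; apply hg2
        have : ((2 + 2 * g : ℝ) : ℂ) = 0 := by push_cast; linear_combination -h0
        exact_mod_cast this
      · intro h0; apply hg0
        have : (g : ℂ) = 0 := by linear_combination h0 / 4
        exact_mod_cast this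
      · rw [pow_five_eq_of_det hdet]
        congr 2 <;> ring

/-- `g` determines the ratio `m : l`, since `m²/l² = (1 + g)/(1 - g)`. Every other admissible pair
is therefore a multiple of the coprime one and has a period at least as long. -/
theorem isLeast_period_of_coprime {g : ℝ} {m l : ℕ} (hm : 0 < m) (hl : 0 < l)
    (hml : Nat.Coprime m l) (hg : g = ((m : ℝ) ^ 2 - l ^ 2) / (m ^ 2 + l ^ 2)) :
    IsLeast {p : ℝ | 0 < p ∧
      ∃ m l : ℕ, 0 < m ∧ 0 < l ∧ g = ((m : ℝ) ^ 2 - l ^ 2) / (m ^ 2 + l ^ 2) ∧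
        p = Real.pi * √((m : ℝ) ^ 2 + l ^ 2)} (Real.pi * √((m : ℝ) ^ 2 + l ^ 2)) := by
  have hm0 : (0 : ℝ) < m := by exact_mod_cast hm
  have hl0 : (0 : ℝ) < l := by exact_mod_cast hl
  have hpi := Real.pi_pos
  refine ⟨⟨by positivity, m, l, hm, hl, hg, rfl⟩, ?_⟩
  rintro p ⟨-, m', l', hm', hl', hg', rfl⟩
  have hm0' : (0 : ℝ) < m' := by exact_mod_cast hm'
  have hl0' : (0 : ℝ) < l' := by exact_mod_cast hl'
  have h1 : ((m : ℝ) * l') ^ 2 = (m' * l) ^ 2 := by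
    rw [hg, div_eq_div_iff (by positivity) (by positivity)] at hg'
    nlinarith
  have h2 : (m : ℝ) * l' = m' * l := by
    rwa [sq_eq_sq₀ (by positivity) (by positivity)] at h1
  have h3 : m * l' = m' * l := by exact_mod_cast h2
  have h4 : m ∣ m' := hml.dvd_of_dvd_mul_right (Dvd.intro _ h3)
  have h5 : l ∣ l' := hml.symm.dvd_of_dvd_mul_left (h3 ▸ Dvd.intro_left _ rfl)
  have h6 : (m : ℝ) ≤ m' := by exact_mod_cast Nat.le_of_dvd hm' h4
  have h7 : (l : ℝ) ≤ l' := by exact_mod_cast Nat.le_of_dvd hl' h5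
  gcongr

/-! ### The spectrum of the potential -/

/-- The value of the potential at a point `ζ` of the unit circle, where `x + i y = ζ⁻¹ e^{iθ}`. -/
def realPotential (x y c : ℝ) : Matrix (Fin 5) (Fin 5) ℝ :=
  √2 • !![0, 0, 0, c, 0;
          0, 0, 1, -c, 0;
          0, -1, 0, 0, -x;
          c, c, 0, 0, y;
          0, 0, x, -y, 0]

theorem complex_sqrt_two_sq : ((√2 : ℝ) : ℂ) * ((√2 : ℝ) : ℂ) = 2 := by
  rw [← Complex.ofReal_mul, Real.mul_self_sqrt (by norm_num)]; norm_num

theorem complex_sqrt_two_ne_zero : ((√2 : ℝ) : ℂ) ≠ 0 := by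
  rw [Ne, Complex.ofReal_eq_zero]; positivity

theorem cylinderPotential_eq (θ c : ℝ) (ζ : ℂ) :
    cylinderPotential θ c ζ =
      !![0, 0, 0, ((√2 : ℝ) : ℂ) * c, 0;
         0, 0, ((√2 : ℝ) : ℂ), -(((√2 : ℝ) : ℂ) * c), 0;
         0, -((√2 : ℝ) : ℂ), 0, 0,
           -((ζ⁻¹ * Complex.exp (Complex.I * θ) + ζ * Complex.exp (-(Complex.I * θ))) / ((√2 : ℝ) : ℂ));
         ((√2 : ℝ) : ℂ) * c, ((√2 : ℝ) : ℂ) * c, 0, 0,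
           -(Complex.I * (ζ⁻¹ * Complex.exp (Complex.I * θ)
              - ζ * Complex.exp (-(Complex.I * θ))) / ((√2 : ℝ) : ℂ));
         0, 0, (ζ⁻¹ * Complex.exp (Complex.I * θ) + ζ * Complex.exp (-(Complex.I * θ))) / ((√2 : ℝ) : ℂ),
           Complex.I * (ζ⁻¹ * Complex.exp (Complex.I * θ)
              - ζ * Complex.exp (-(Complex.I * θ))) / ((√2 : ℝ) : ℂ), 0] := by
  have hc : (starRingEnd ℂ) (Complex.exp (Complex.I * θ)) = Complex.exp (-(Complex.I * θ)) := by
    rw [← Complex.exp_conj]; simp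
  have h2 : (2 : ℂ) / ((√2 : ℝ) : ℂ) = ((√2 : ℝ) : ℂ) := by
    rw [div_eq_iff complex_sqrt_two_ne_zero, complex_sqrt_two_sq]
  have h2c : (2 : ℂ) * c / ((√2 : ℝ) : ℂ) = ((√2 : ℝ) : ℂ) * c := by
    rw [mul_div_right_comm, h2]
  ext i j
  fin_cases i <;> fin_cases j <;>
    simp [cylinderPotential, willmorePotential, potentialB, hc, h2c, ← two_mul] <;>
    ring

theorem cylinderPotential_eq_map (θ c : ℝ) {ζ : ℂ} (hζ : ‖ζ‖ = 1) :
    cylinderPotential θ c ζ =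
      (realPotential (ζ⁻¹ * Complex.exp (Complex.I * θ)).re
        (ζ⁻¹ * Complex.exp (Complex.I * θ)).im c).map (fun x : ℝ => (x : ℂ)) := by
  have hc : ζ * Complex.exp (-(Complex.I * θ))
      = (starRingEnd ℂ) (ζ⁻¹ * Complex.exp (Complex.I * θ)) := by
    rw [map_mul, ← Complex.exp_conj, Complex.inv_eq_conj hζ]; simp
  rw [cylinderPotential_eq θ c ζ, hc, Complex.add_conj, Complex.sub_conj]
  have h2 : (2 : ℂ) / ((√2 : ℝ) : ℂ) = ((√2 : ℝ) : ℂ) := by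
    rw [div_eq_iff complex_sqrt_two_ne_zero, complex_sqrt_two_sq]
  have h3 : ∀ r : ℝ, ((2 * r : ℝ) : ℂ) / ((√2 : ℝ) : ℂ) = ((√2 : ℝ) : ℂ) * r := fun r => by
    push_cast; rw [mul_div_right_comm, h2]
  have h4 : ∀ r : ℝ, Complex.I * ((2 * r : ℝ) * Complex.I) / ((√2 : ℝ) : ℂ)
      = -(((√2 : ℝ) : ℂ) * r) := fun r => by
    rw [← h3]; linear_combination ((2 * r : ℝ) : ℂ) / ((√2 : ℝ) : ℂ) * Complex.I_sq
  generalize (ζ⁻¹ * Complex.exp (Complex.I * θ)).re = x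
  generalize (ζ⁻¹ * Complex.exp (Complex.I * θ)).im = y
  rw [h3, h4]
  ext i j
  fin_cases i <;> fin_cases j <;> simp [realPotential]

theorem normSq_phase (θ : ℝ) {ζ : ℂ} (hζ : ‖ζ‖ = 1) :
    (ζ⁻¹ * Complex.exp (Complex.I * θ)).re ^ 2 + (ζ⁻¹ * Complex.exp (Complex.I * θ)).im ^ 2 = 1 := by
  have h : ‖ζ⁻¹ * Complex.exp (Complex.I * θ)‖ = 1 := by
    rw [norm_mul, norm_inv, hζ, mul_comm Complex.I, Complex.norm_exp_ofReal_mul_I]; norm_num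
  have h2 := Complex.sq_norm (ζ⁻¹ * Complex.exp (Complex.I * θ))
  rw [h, Complex.normSq_apply] at h2
  nlinarith

/-- The linear coefficient is `4 - 4c²` at `(x, y) = (0, 1)` and `4 - 4x²` at `c = 0`: this is how
the parameter `g` of `matrix_exp_eq_one_iff` arises in the two cases. -/
theorem det_scalar_sub_realPotential {x y c : ℝ} (hxy : x ^ 2 + y ^ 2 = 1) (t : ℂ) :
    (Matrix.scalar (Fin 5) t - (realPotential x y c).map (fun x : ℝ => (x : ℂ))).det
      = t ^ 5 + 4 * t ^ 3 + (4 * y ^ 2 - 8 * c * x * y - 4 * c ^ 2) * t := by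
  have hs := complex_sqrt_two_sq
  have hxy' : (x : ℂ) ^ 2 + (y : ℂ) ^ 2 = 1 := by exact_mod_cast hxy
  have hM : Matrix.scalar (Fin 5) t - (realPotential x y c).map (fun x : ℝ => (x : ℂ))
      = !![t, 0, 0, -(((√2 : ℝ) : ℂ) * c), 0;
          0, t, -((√2 : ℝ) : ℂ), ((√2 : ℝ) : ℂ) * c, 0;
          0, ((√2 : ℝ) : ℂ), t, 0, ((√2 : ℝ) : ℂ) * x;
          -(((√2 : ℝ) : ℂ) * c), -(((√2 : ℝ) : ℂ) * c), 0, t, -(((√2 : ℝ) : ℂ) * y);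
          0, 0, -(((√2 : ℝ) : ℂ) * x), ((√2 : ℝ) : ℂ) * y, t] := by
    ext i j
    fin_cases i <;> fin_cases j <;> simp [realPotential, Matrix.scalar_apply]
  rw [hM]
  generalize ((√2 : ℝ) : ℂ) = s at hs
  simp [Matrix.det_succ_row_zero, Fin.sum_univ_succ, Fin.succAbove]
  have hs2 : s ^ 2 = 2 := by rw [sq, hs]
  have hs4 : s ^ 4 = 4 := by rw [show s ^ 4 = (s ^ 2) ^ 2 by ring, hs2]; norm_num
  ring_nf
  rw [hs2, hs4]
  linear_combination (2 * t ^ 3) * hxy'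

theorem charpoly_roots_of_det {D : Matrix (Fin 5) (Fin 5) ℂ} {q w₁ w₂ : ℂ}
    (hdet : ∀ t : ℂ, (Matrix.scalar (Fin 5) t - D).det = t ^ 5 + 4 * t ^ 3 + q * t)
    (hadd : w₁ ^ 2 + w₂ ^ 2 = -4) (hmul : w₁ ^ 2 * w₂ ^ 2 = q) :
    D.charpoly.roots = {0, w₁, -w₁, w₂, -w₂} := by
  have hc : D.charpoly
      = (Multiset.map (fun a => Polynomial.X - Polynomial.C a)
          ({0, w₁, -w₁, w₂, -w₂} : Multiset ℂ)).prod := by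
    refine Polynomial.funext fun t => ?_
    rw [Matrix.eval_charpoly, hdet]
    simp
    linear_combination (-t) * hmul + t ^ 3 * hadd
  rw [hc, Polynomial.roots_multiset_prod_X_sub_C]

/-! ### Jordan structure at the degenerate parameters. -/

theorem matrix_exp_mul_of_nilpotent {D X Y : Matrix (Fin 5) (Fin 5) ℂ} (hX : D * X = Y)
    (hY : D * Y = 0) : NormedSpace.exp D * X = X + Y := by
  have h1 := (hasSum_matrix_exp D).mul_right X
  have hn : ∀ n ∉ Finset.range 2, ((n.factorial : ℂ)⁻¹) • D ^ n * X = 0 := by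
    intro n hn
    obtain ⟨k, rfl⟩ := Nat.exists_eq_add_of_le (not_lt.1 (mt Finset.mem_range.2 hn))
    rw [smul_mul_assoc, add_comm, pow_add, mul_assoc, sq, mul_assoc D, hX, hY, mul_zero, smul_zero]
  rw [h1.unique (hasSum_sum_of_ne_finset_zero hn)]
  simp [Finset.sum_range_succ, hX]

/-- At `c = ±1` the eigenvalue `0` is triple and not semisimple: `w' = (0,0,1,c,0)` is sent to `√2
w` with `w = (1,0,0,0,-c)` in the kernel. Thus `exp(pD) w' = w' + p√2 w`, which never returns to
`w'`. -/
theorem matrix_exp_realPotential_ne_one {c : ℝ} (hc : c = 1 ∨ c = -1) {p : ℝ} (hp : p ≠ 0) :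
    NormedSpace.exp ((p : ℂ) • (realPotential 0 1 c).map (fun x : ℝ => (x : ℂ))) ≠ 1 := by
  intro h
  have hc2 : (c : ℂ) * c = 1 := by rcases hc with rfl | rfl <;> norm_num
  set w : Matrix (Fin 5) (Fin 5) ℂ := Matrix.of fun i _ => ![1, 0, 0, 0, -(c : ℂ)] i with hw
  set w' : Matrix (Fin 5) (Fin 5) ℂ := Matrix.of fun i _ => ![0, 0, 1, (c : ℂ), 0] i with hw'
  have h1 : ((p : ℂ) • (realPotential 0 1 c).map (fun x : ℝ => (x : ℂ))) * w'
      = ((p : ℂ) * ((√2 : ℝ) : ℂ)) • w := by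
    ext i j
    fin_cases i <;>
      simp [realPotential, Matrix.mul_apply, Fin.sum_univ_succ, hw, hw', mul_assoc, hc2]
  have h2 : ((p : ℂ) • (realPotential 0 1 c).map (fun x : ℝ => (x : ℂ)))
      * (((p : ℂ) * ((√2 : ℝ) : ℂ)) • w) = 0 := by
    ext i j
    fin_cases i <;> simp [realPotential, Matrix.mul_apply, Fin.sum_univ_succ, hw]
    ring
  have h3 := matrix_exp_mul_of_nilpotent h1 h2
  rw [h, one_mul, left_eq_add] at h3
  have h4 := congrFun (congrFun h3 0) 0
  simp [hw, hp] at h4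

/-- At `c = 0` the eigenvalues `±i√2` are double but semisimple, so their coincidence does not
obstruct closing. -/
theorem realPotential_cube :
    (realPotential 0 1 0).map (fun x : ℝ => (x : ℂ)) ^ 3
      = (-2 : ℂ) • (realPotential 0 1 0).map (fun x : ℝ => (x : ℂ)) := by
  have hs := complex_sqrt_two_sq
  ext i j
  fin_cases i <;> fin_cases j <;>
    simp [realPotential, Matrix.mul_apply, Fin.sum_univ_succ, pow_succ, hs]

/-! ### Lorentz geometry -/

theorem lorentzInner_eq (x y : Fin 5 → ℝ) :
    lorentzInner x y = -(x 0 * y 0) + x 1 * y 1 + x 2 * y 2 + x 3 * y 3 + x 4 * y 4 := by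
  simp [lorentzInner, lorentzMetric, Matrix.mulVec_diagonal, dotProduct, Fin.sum_univ_succ]
  ring

theorem lorentzMetric_mul_self (R : Type*) [CommRing R] :
    lorentzMetric R * lorentzMetric R = 1 := by
  rw [lorentzMetric, Matrix.diagonal_mul_diagonal, ← Matrix.diagonal_one]
  congr 1
  funext i
  fin_cases i <;> simp

theorem lorentzMetric_transpose (R : Type*) [CommRing R] :
    (lorentzMetric R)ᵀ = lorentzMetric R := Matrix.diagonal_transpose _

theorem lorentzMetric_map : (lorentzMetric ℝ).map (fun x : ℝ => (x : ℂ)) = lorentzMetric ℂ := by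
  ext i j
  fin_cases i <;> fin_cases j <;> simp [lorentzMetric]

/-- The inverse of an element of `O(1,4)`. -/
def lorentzAdjoint {R : Type*} [CommRing R] (A : Matrix (Fin 5) (Fin 5) R) :
    Matrix (Fin 5) (Fin 5) R :=
  lorentzMetric R * Aᵀ * lorentzMetric R

theorem lorentzAdjoint_mul_self {R : Type*} [CommRing R] {A : Matrix (Fin 5) (Fin 5) R}
    (h : Aᵀ * lorentzMetric R * A = lorentzMetric R) : lorentzAdjoint A * A = 1 := by
  rw [lorentzAdjoint, mul_assoc, mul_assoc, ← mul_assoc Aᵀ, h, lorentzMetric_mul_self]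

theorem self_mul_lorentzAdjoint {R : Type*} [CommRing R] {A : Matrix (Fin 5) (Fin 5) R}
    (h : Aᵀ * lorentzMetric R * A = lorentzMetric R) : A * lorentzAdjoint A = 1 :=
  mul_eq_one_comm.1 (lorentzAdjoint_mul_self h)

theorem self_mul_metric_mul_transpose {R : Type*} [CommRing R] {A : Matrix (Fin 5) (Fin 5) R}
    (h : Aᵀ * lorentzMetric R * A = lorentzMetric R) :
    A * lorentzMetric R * Aᵀ = lorentzMetric R := by
  have h1 := self_mul_lorentzAdjoint h
  rw [lorentzAdjoint] at h1
  have h2 := congrArg (· * lorentzMetric R) h1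
  simpa only [mul_assoc, lorentzMetric_mul_self, mul_one, one_mul] using h2

theorem lorentzAdjoint_orthogonal {R : Type*} [CommRing R] {A : Matrix (Fin 5) (Fin 5) R}
    (h : Aᵀ * lorentzMetric R * A = lorentzMetric R) :
    (lorentzAdjoint A)ᵀ * lorentzMetric R * lorentzAdjoint A = lorentzMetric R := by
  have hI := lorentzMetric_mul_self R
  have h2 := self_mul_metric_mul_transpose h
  simp only [lorentzAdjoint, transpose_mul, transpose_transpose, lorentzMetric_transpose]
  calc _ = lorentzMetric R * (A * (lorentzMetric R * lorentzMetric R) * lorentzMetric R * Aᵀ)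
        * lorentzMetric R := by simp only [mul_assoc]
    _ = _ := by rw [hI, mul_one, h2, mul_assoc, hI, mul_one]

theorem orthogonal_mul {R : Type*} [CommRing R] {A B : Matrix (Fin 5) (Fin 5) R}
    (hA : Aᵀ * lorentzMetric R * A = lorentzMetric R)
    (hB : Bᵀ * lorentzMetric R * B = lorentzMetric R) :
    (A * B)ᵀ * lorentzMetric R * (A * B) = lorentzMetric R := by
  rw [transpose_mul]
  calc _ = Bᵀ * (Aᵀ * lorentzMetric R * A) * B := by simp only [mul_assoc]
    _ = _ := by rw [hA, hB]

theorem det_lorentzAdjoint {R : Type*} [CommRing R] (A : Matrix (Fin 5) (Fin 5) R) :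
    (lorentzAdjoint A).det = A.det := by
  have : (lorentzMetric R).det * (lorentzMetric R).det = 1 := by
    rw [← det_mul, lorentzMetric_mul_self, det_one]
  rw [lorentzAdjoint, det_mul, det_mul, det_transpose]
  linear_combination A.det * this

/-! ### Time orientation and the group law of `SO⁺(1,4)`. -/

theorem sum_sq_first_col {A : Matrix (Fin 5) (Fin 5) ℝ}
    (h : Aᵀ * lorentzMetric ℝ * A = lorentzMetric ℝ) :
    A 0 0 ^ 2 = 1 + (A 1 0 ^ 2 + A 2 0 ^ 2 + A 3 0 ^ 2 + A 4 0 ^ 2) := by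
  have h1 := congrFun (congrFun h 0) 0
  simp [lorentzMetric, Matrix.mul_apply, Fin.sum_univ_succ, Matrix.diagonal_apply] at h1
  linarith

theorem sum_sq_first_row {A : Matrix (Fin 5) (Fin 5) ℝ}
    (h : Aᵀ * lorentzMetric ℝ * A = lorentzMetric ℝ) :
    A 0 0 ^ 2 = 1 + (A 0 1 ^ 2 + A 0 2 ^ 2 + A 0 3 ^ 2 + A 0 4 ^ 2) := by
  have h1 := congrFun (congrFun (self_mul_metric_mul_transpose h) 0) 0
  simp [lorentzMetric, Matrix.mul_apply, Fin.sum_univ_succ, Matrix.diagonal_apply] at h1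
  linarith

theorem one_mem_SOPlus : (1 : Matrix (Fin 5) (Fin 5) ℝ) ∈ SOPlus := by
  simp [SOPlus]

theorem mul_mem_SOPlus {A B : Matrix (Fin 5) (Fin 5) ℝ} (hA : A ∈ SOPlus) (hB : B ∈ SOPlus) :
    A * B ∈ SOPlus := by
  obtain ⟨hA1, hA2, hA3⟩ := hA
  obtain ⟨hB1, hB2, hB3⟩ := hB
  refine ⟨orthogonal_mul hA1 hB1, by rw [det_mul, hA2, hB2, one_mul], ?_⟩
  have ha := sum_sq_first_row hA1
  have hb := sum_sq_first_col hB1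
  have hab : 0 < A 0 0 * B 0 0 := mul_pos hA3 hB3
  set S := A 0 1 * B 1 0 + A 0 2 * B 2 0 + A 0 3 * B 3 0 + A 0 4 * B 4 0 with hS
  have hAB : (A * B) 0 0 = A 0 0 * B 0 0 + S := by
    simp [Matrix.mul_apply, Fin.sum_univ_succ, hS]; ring
  -- Cauchy–Schwarz for the spatial parts of the first row of `A` and the first column of `B`. Both
  -- are shorter than the time components, so the product of the time components dominates.
  have hCS : S ^ 2 ≤ (A 0 1 ^ 2 + A 0 2 ^ 2 + A 0 3 ^ 2 + A 0 4 ^ 2)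
      * (B 1 0 ^ 2 + B 2 0 ^ 2 + B 3 0 ^ 2 + B 4 0 ^ 2) := by
    rw [hS]
    nlinarith [sq_nonneg (A 0 1 * B 2 0 - A 0 2 * B 1 0), sq_nonneg (A 0 1 * B 3 0 - A 0 3 * B 1 0),
      sq_nonneg (A 0 1 * B 4 0 - A 0 4 * B 1 0), sq_nonneg (A 0 2 * B 3 0 - A 0 3 * B 2 0),
      sq_nonneg (A 0 2 * B 4 0 - A 0 4 * B 2 0), sq_nonneg (A 0 3 * B 4 0 - A 0 4 * B 3 0)]
  have hlt : S ^ 2 < (A 0 0 * B 0 0) ^ 2 := by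
    rw [mul_pow, ha, hb]
    nlinarith [sq_nonneg (A 0 1), sq_nonneg (A 0 2), sq_nonneg (A 0 3), sq_nonneg (A 0 4),
      sq_nonneg (B 1 0), sq_nonneg (B 2 0), sq_nonneg (B 3 0), sq_nonneg (B 4 0)]
  have := abs_lt_of_sq_lt_sq hlt hab.le
  rw [hAB]
  linarith [(abs_lt.1 this).1]

theorem lorentzAdjoint_mem_SOPlus {A : Matrix (Fin 5) (Fin 5) ℝ} (hA : A ∈ SOPlus) :
    lorentzAdjoint A ∈ SOPlus := by
  refine ⟨lorentzAdjoint_orthogonal hA.1, by rw [det_lorentzAdjoint, hA.2.1], ?_⟩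
  simpa [lorentzAdjoint, lorentzMetric] using hA.2.2

theorem lorentzInner_mulVec {A : Matrix (Fin 5) (Fin 5) ℝ}
    (h : Aᵀ * lorentzMetric ℝ * A = lorentzMetric ℝ) (x y : Fin 5 → ℝ) :
    lorentzInner (A *ᵥ x) (A *ᵥ y) = lorentzInner x y := by
  rw [lorentzInner, lorentzInner, mulVec_mulVec, ← vecMul_transpose A x, ← dotProduct_mulVec,
    mulVec_mulVec, ← mul_assoc, h]

theorem lorentzInner_col {A : Matrix (Fin 5) (Fin 5) ℝ}
    (h : Aᵀ * lorentzMetric ℝ * A = lorentzMetric ℝ) (i j : Fin 5) :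
    lorentzInner (A.col i) (A.col j) = lorentzMetric ℝ i j := by
  rw [← Matrix.mulVec_single_one, ← Matrix.mulVec_single_one, lorentzInner_mulVec h]
  simp [lorentzInner]

/-- The isometries fixing the null vector `e₀ - e₁` and `e₂`, `e₃` are null rotations depending on
one parameter, up to the sign of the last direction. `h04` kills the parameter and `det = 1` fixes
the sign. -/
theorem eq_one_of_fixes {X : Matrix (Fin 5) (Fin 5) ℝ} (hX : X ∈ SOPlus)
    (h01 : X.col 0 - X.col 1 = ![1, -1, 0, 0, 0]) (h2 : X.col 2 = ![0, 0, 1, 0, 0])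
    (h3 : X.col 3 = ![0, 0, 0, 1, 0]) (h04 : X 0 4 = 0) : X = 1 := by
  have e := fun i j => lorentzInner_col hX.1 i j
  simp only [lorentzInner_eq, Matrix.col_apply] at e
  have c2 : ∀ i, X i 2 = (![0, 0, 1, 0, 0] : Fin 5 → ℝ) i := fun i => congrFun h2 i
  have c3 : ∀ i, X i 3 = (![0, 0, 0, 1, 0] : Fin 5 → ℝ) i := fun i => congrFun h3 i
  have c0 : ∀ i, X i 0 = X i 1 + (![1, -1, 0, 0, 0] : Fin 5 → ℝ) i := fun i => by
    have := congrFun h01 i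
    simp only [Pi.sub_apply, Matrix.col_apply] at this
    linarith
  have e21 := e 1 2
  have e24 := e 4 2
  have e31 := e 1 3
  have e34 := e 4 3
  have e01 := e 0 1
  have e11 := e 1 1
  have e04 := e 0 4
  have e14 := e 1 4
  have e44 := e 4 4
  simp [c0, c2, c3, lorentzMetric] at e21 e24 e31 e34 e01 e11 e04 e14 e44
  have h14 : X 1 4 = 0 := by rw [h04] at e04 e14; linarith
  simp only [e21, e31, e24, e34, h04, h14] at e01 e11 e14 e44
  have h44 : X 4 4 ≠ 0 := fun h => by simp [h] at e44
  have h41 : X 4 1 = 0 := by simpa [h44] using e14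
  simp only [h41] at e01 e11
  have h01' : X 0 1 = 0 := by nlinarith
  have h11 : X 1 1 = 1 := by nlinarith
  have hXm : X = !![1, 0, 0, 0, 0; 0, 1, 0, 0, 0; 0, 0, 1, 0, 0; 0, 0, 0, 1, 0; 0, 0, 0, 0, X 4 4] := by
    ext i j
    fin_cases i <;> fin_cases j <;> simp [c0, c2, c3, h01', h11, h41, e21, e31, e24, e34, h04, h14]
  have hdet := hX.2.1
  rw [hXm] at hdet
  simp [Matrix.det_succ_row_zero, Fin.sum_univ_succ, Fin.succAbove] at hdet
  rw [hXm, hdet]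
  ext i j
  fin_cases i <;> fin_cases j <;> simp

/-- Two frames with the same null vector and tangent columns differ by a null rotation, which adds
to the normal (up to sign) a multiple of the null vector. Pairing with `d`, which is orthogonal to
both normals but not to the null vector, shows that the multiple is zero. In the application `d` is
the Laplacian of the canonical lift. -/
theorem frame_unique {E₁ E₂ : Matrix (Fin 5) (Fin 5) ℝ} (h₁ : E₁ ∈ SOPlus) (h₂ : E₂ ∈ SOPlus)
    (h01 : E₁.col 0 - E₁.col 1 = E₂.col 0 - E₂.col 1) (hc2 : E₁.col 2 = E₂.col 2)
    (hc3 : E₁.col 3 = E₂.col 3) {d : Fin 5 → ℝ} (hd : lorentzInner (E₁.col 0 - E₁.col 1) d ≠ 0)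
    (hd₁ : lorentzInner (E₁.col 4) d = 0) (hd₂ : lorentzInner (E₂.col 4) d = 0) : E₁ = E₂ := by
  set X := lorentzAdjoint E₁ * E₂ with hX
  have hE : E₂ = E₁ * X := by rw [hX, ← mul_assoc, self_mul_lorentzAdjoint h₁.1, one_mul]
  have hXS : X ∈ SOPlus := mul_mem_SOPlus (lorentzAdjoint_mem_SOPlus h₁) h₂
  have hcol : ∀ j, X.col j = lorentzAdjoint E₁ *ᵥ E₂.col j := fun j => by
    rw [← Matrix.mulVec_single_one, ← Matrix.mulVec_single_one, mulVec_mulVec]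
  have hcol1 : ∀ j, lorentzAdjoint E₁ *ᵥ E₁.col j = Pi.single j 1 := fun j => by
    rw [← Matrix.mulVec_single_one, mulVec_mulVec, lorentzAdjoint_mul_self h₁.1, one_mulVec]
  have x01 : X.col 0 - X.col 1 = ![1, -1, 0, 0, 0] := by
    rw [hcol, hcol, ← mulVec_sub, ← h01, mulVec_sub, hcol1, hcol1]
    ext i; fin_cases i <;> simp
  have x2 : X.col 2 = ![0, 0, 1, 0, 0] := by
    rw [hcol, ← hc2, hcol1]; ext i; fin_cases i <;> simp
  have x3 : X.col 3 = ![0, 0, 0, 1, 0] := by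
    rw [hcol, ← hc3, hcol1]; ext i; fin_cases i <;> simp
  have e42 := lorentzInner_col hXS.1 4 2
  have e43 := lorentzInner_col hXS.1 4 3
  have e40 := lorentzInner_col hXS.1 4 0
  have e41 := lorentzInner_col hXS.1 4 1
  have c0 : ∀ i, X i 0 = X i 1 + (![1, -1, 0, 0, 0] : Fin 5 → ℝ) i := fun i => by
    have := congrFun x01 i
    simp only [Pi.sub_apply, Matrix.col_apply] at this
    linarith
  rw [x2] at e42
  rw [x3] at e43
  simp [lorentzInner_eq, lorentzMetric, c0] at e42 e43 e40 e41
  have h14 : X 1 4 = -X 0 4 := by linarith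
  have hE4 : E₂.col 4 = X 0 4 • (E₁.col 0 - E₁.col 1) + X 4 4 • E₁.col 4 := by
    ext i
    have := congrFun (congrFun hE i) 4
    simp [Matrix.mul_apply, Fin.sum_univ_succ, h14, e42, e43] at this
    simp [this]; ring
  have hx : X 0 4 * lorentzInner (E₁.col 0 - E₁.col 1) d = 0 := by
    rw [hE4] at hd₂
    have : lorentzInner (X 0 4 • (E₁.col 0 - E₁.col 1) + X 4 4 • E₁.col 4) d
        = X 0 4 * lorentzInner (E₁.col 0 - E₁.col 1) d + X 4 4 * lorentzInner (E₁.col 4) d := by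
      simp only [lorentzInner_eq, Pi.add_apply, Pi.smul_apply, Pi.sub_apply, smul_eq_mul]; ring
    rw [this, hd₁] at hd₂
    linarith
  have h04 : X 0 4 = 0 := (mul_eq_zero.1 hx).resolve_right hd
  rw [hE, eq_one_of_fixes hXS x01 x2 x3 h04, mul_one]

/-! ### Differentiation along the coordinate directions -/

theorem isOpen_strip (a b : EReal) : IsOpen (strip a b) := by
  have hc : Continuous fun z : ℂ => (z.im : EReal) :=
    continuous_coe_real_ereal.comp Complex.continuous_im
  exact (isOpen_lt continuous_const hc).inter (isOpen_lt hc continuous_const)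

theorem add_ofReal_mem_strip {a b : EReal} {z : ℂ} (hz : z ∈ strip a b) (t : ℝ) :
    z + t ∈ strip a b := by
  simpa [strip] using hz

section LineDeriv

variable {E : Type*} [NormedAddCommGroup E] [NormedSpace ℝ E] {S : Set ℂ}

theorem hasLineDerivAt_of_contDiffOn (hS : IsOpen S) {f : ℂ → E} (hf : ContDiffOn ℝ ∞ f S) {z : ℂ}
    (hz : z ∈ S) (e : ℂ) : HasLineDerivAt ℝ f (lineDeriv ℝ f z e) z e := by
  have h : DifferentiableAt ℝ f z :=
    (hf.contDiffAt (hS.mem_nhds hz)).differentiableAt (by simp)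
  exact h.lineDifferentiableAt.hasLineDerivAt

theorem contDiffOn_lineDeriv (hS : IsOpen S) {f : ℂ → E} (hf : ContDiffOn ℝ ∞ f S) (e : ℂ) :
    ContDiffOn ℝ ∞ (fun z => lineDeriv ℝ f z e) S := by
  have h1 : ContDiffOn ℝ ∞ (fun z => fderiv ℝ f z e) S :=
    (hf.fderiv_of_isOpen hS (by simp)).clm_apply contDiffOn_const
  refine h1.congr fun z hz => ?_
  exact ((hf.contDiffAt (hS.mem_nhds hz)).differentiableAt (by simp)).lineDeriv_eq_fderiv

theorem lineDeriv_congr_on (hS : IsOpen S) {f g : ℂ → E} (h : ∀ z ∈ S, f z = g z) {z : ℂ}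
    (hz : z ∈ S) (e : ℂ) : lineDeriv ℝ f z e = lineDeriv ℝ g z e :=
  Filter.EventuallyEq.lineDeriv_eq (Filter.eventually_of_mem (hS.mem_nhds hz) h)

theorem lineDeriv_comp_add_right (f : ℂ → E) (a z e : ℂ) :
    lineDeriv ℝ (fun w => f (w + a)) z e = lineDeriv ℝ f (z + a) e := by
  unfold lineDeriv
  congr 1
  funext t
  rw [add_right_comm]

end LineDeriv

theorem HasLineDerivAt.lorentzInner {f g : ℂ → Fin 5 → ℝ} {f' g' : Fin 5 → ℝ} {z e : ℂ}
    (hf : HasLineDerivAt ℝ f f' z e) (hg : HasLineDerivAt ℝ g g' z e) :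
    HasLineDerivAt ℝ (fun w => _root_.lorentzInner (f w) (g w))
      (_root_.lorentzInner f' (g z) + _root_.lorentzInner (f z) g') z e := by
  unfold HasLineDerivAt at *
  have hf' := fun i => hasDerivAt_pi.1 hf i
  have hg' := fun i => hasDerivAt_pi.1 hg i
  have h := fun i => (hf' i).fun_mul (hg' i)
  simp only [zero_smul, add_zero] at h
  simp only [lorentzInner_eq]
  convert ((((h 0).fun_neg.fun_add (h 1)).fun_add (h 2)).fun_add (h 3)).fun_add (h 4) using 1
  ring

theorem HasLineDerivAt.const_mulVec {f : ℂ → Fin 5 → ℝ} {f' : Fin 5 → ℝ} {z e : ℂ}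
    (hf : HasLineDerivAt ℝ f f' z e) (R : Matrix (Fin 5) (Fin 5) ℝ) :
    HasLineDerivAt ℝ (fun w => R *ᵥ f w) (R *ᵥ f') z e := by
  unfold HasLineDerivAt at *
  exact (LinearMap.toContinuousLinearMap (Matrix.mulVecLin R)).hasFDerivAt.comp_hasDerivAt _ hf

/-! ### Light-like lifts -/

theorem lorentzInner_lightVector (x : EuclideanSpace ℝ (Fin 4)) :
    lorentzInner (lightVector x) (lightVector x) = ‖x‖ ^ 2 - 1 := by
  rw [EuclideanSpace.norm_sq_eq]
  simp [lorentzInner_eq, lightVector, Fin.sum_univ_succ]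
  ring

theorem inner_eq_sum_four (x y : EuclideanSpace ℝ (Fin 4)) :
    inner ℝ x y = x 0 * y 0 + x 1 * y 1 + x 2 * y 2 + x 3 * y 3 := by
  simp [PiLp.inner_apply, Fin.sum_univ_succ]
  ring

section

variable {S : Set ℂ} {y : ℂ → EuclideanSpace ℝ (Fin 4)}

theorem HasLineDerivAt.euclidean_apply {y' : EuclideanSpace ℝ (Fin 4)} {z e : ℂ}
    (h : HasLineDerivAt ℝ y y' z e) (i : Fin 4) :
    HasLineDerivAt ℝ (fun w => y w i) (y' i) z e := by
  unfold HasLineDerivAt at *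
  exact (EuclideanSpace.proj (𝕜 := ℝ) i).hasFDerivAt.comp_hasDerivAt _ h

theorem inner_eq_zero_of_norm_eq_one (hS : IsOpen S) (hy : ∀ z ∈ S, ‖y z‖ = 1) {z e : ℂ}
    (hz : z ∈ S) {y' : EuclideanSpace ℝ (Fin 4)} (h : HasLineDerivAt ℝ y y' z e) :
    inner ℝ (y z) y' = 0 := by
  have h1 : HasLineDerivAt ℝ (fun w => inner ℝ (y w) (y w)) (inner ℝ (y z) y' + inner ℝ y' (y z))
      z e := by
    unfold HasLineDerivAt at *
    simpa using h.inner ℝ h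
  have h2 : lineDeriv ℝ (fun w => inner ℝ (y w) (y w)) z e = lineDeriv ℝ (fun _ : ℂ => (1 : ℝ)) z e :=
    lineDeriv_congr_on hS (fun w hw => by rw [real_inner_self_eq_norm_sq, hy w hw]; norm_num) hz e
  rw [h1.lineDeriv, real_inner_comm] at h2
  simp [lineDeriv] at h2
  rw [real_inner_comm]
  linarith

/-- Differentiating the factor `μ` only adds multiples of the null vector `(1, y)`, which is
orthogonal to itself and to all `(0, dy)`. Hence every lift induces the metric of `y` scaled by
`μ²`. -/
theorem lorentzInner_deriv_lift (hS : IsOpen S) (hy : ∀ z ∈ S, ‖y z‖ = 1) {μ : ℂ → ℝ} {z e₁ e₂ : ℂ}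
    (hz : z ∈ S) {μ₁ μ₂ : ℝ} {y₁ y₂ : EuclideanSpace ℝ (Fin 4)}
    (hy₁ : HasLineDerivAt ℝ y y₁ z e₁) (hy₂ : HasLineDerivAt ℝ y y₂ z e₂)
    (hμ₁ : HasLineDerivAt ℝ μ μ₁ z e₁) (hμ₂ : HasLineDerivAt ℝ μ μ₂ z e₂)
    {Y : ℂ → Fin 5 → ℝ} (hY : ∀ w ∈ S, Y w = μ w • lightVector (y w)) :
    lorentzInner (lineDeriv ℝ Y z e₁) (lineDeriv ℝ Y z e₂) = μ z ^ 2 * inner ℝ y₁ y₂ := by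
  have key : ∀ {e : ℂ} {m : ℝ} {x : EuclideanSpace ℝ (Fin 4)}, HasLineDerivAt ℝ y x z e →
      HasLineDerivAt ℝ μ m z e → lineDeriv ℝ Y z e =
        ![m, m * y z 0 + μ z * x 0, m * y z 1 + μ z * x 1, m * y z 2 + μ z * x 2,
          m * y z 3 + μ z * x 3] := by
    intro e m x hx hm
    have hLD : HasLineDerivAt ℝ (fun w => μ w • lightVector (y w))
        ![m, m * y z 0 + μ z * x 0, m * y z 1 + μ z * x 1, m * y z 2 + μ z * x 2,
          m * y z 3 + μ z * x 3] z e := by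
      have hx' := fun i => hx.euclidean_apply i
      unfold HasLineDerivAt at *
      refine hasDerivAt_pi.2 fun i => ?_
      have hp := fun j => hm.fun_mul (hx' j)
      fin_cases i
      · simpa [lightVector] using hm
      · simpa [lightVector] using hp 0
      · simpa [lightVector] using hp 1
      · simpa [lightVector] using hp 2
      · simpa [lightVector] using hp 3
    rw [lineDeriv_congr_on hS hY hz e]
    exact hLD.lineDeriv
  rw [key hy₁ hμ₁, key hy₂ hμ₂]
  have h1 := inner_eq_zero_of_norm_eq_one hS hy hz hy₁
  have h2 := inner_eq_zero_of_norm_eq_one hS hy hz hy₂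
  have h3 : inner ℝ (y z) (y z) = (1 : ℝ) := by rw [real_inner_self_eq_norm_sq, hy z hz]; norm_num
  rw [inner_eq_sum_four] at *
  simp [lorentzInner_eq]
  linear_combination μ₁ * μ₂ * h3 + μ₁ * μ z * h2 + μ₂ * μ z * h1

theorem contDiffOn_lightVector (h : ContDiffOn ℝ ∞ y S) :
    ContDiffOn ℝ ∞ (fun z => lightVector (y z)) S := by
  have hi : ∀ i, ContDiffOn ℝ ∞ (fun z => y z i) S := fun i =>
    (EuclideanSpace.proj (𝕜 := ℝ) i).contDiff.comp_contDiffOn h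
  refine contDiffOn_pi.2 fun i => ?_
  fin_cases i
  · exact contDiffOn_const
  · exact hi 0
  · exact hi 1
  · exact hi 2
  · exact hi 3

/-! ### The canonical lift of a conformal immersion. -/

variable (hS : IsOpen S) (hy : IsConformalImmersion S y)
include hS hy

theorem contDiffOn_canonicalLift : ContDiffOn ℝ ∞ (canonicalLift y) S := by
  have h1 : ContDiffOn ℝ ∞ (fun z => ‖partialU y z‖⁻¹) S :=
    ((contDiffOn_lineDeriv hS hy.smooth 1).norm ℝ hy.immersed).inv
      fun z hz => norm_ne_zero_iff.2 (hy.immersed z hz)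
  exact h1.smul (contDiffOn_lightVector hy.smooth)

theorem hasLineDerivAt_norm_inv {z : ℂ} (hz : z ∈ S) (e : ℂ) :
    HasLineDerivAt ℝ (fun z => ‖partialU y z‖⁻¹)
      (lineDeriv ℝ (fun z => ‖partialU y z‖⁻¹) z e) z e :=
  hasLineDerivAt_of_contDiffOn hS (((contDiffOn_lineDeriv hS hy.smooth 1).norm ℝ hy.immersed).inv
      fun z hz => norm_ne_zero_iff.2 (hy.immersed z hz)) hz e

theorem lorentzInner_partialU_canonicalLift {z : ℂ} (hz : z ∈ S) :
    lorentzInner (partialU (canonicalLift y) z) (partialU (canonicalLift y) z) = 1 := by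
  have hd := hasLineDerivAt_of_contDiffOn hS hy.smooth hz 1
  have hm := hasLineDerivAt_norm_inv hS hy hz 1
  rw [partialU, lorentzInner_deriv_lift hS hy.mem_sphere hz hd hd hm hm
      (Y := canonicalLift y) (fun w _ => rfl),
    real_inner_self_eq_norm_sq, ← mul_pow]
  change (‖partialU y z‖⁻¹ * ‖partialU y z‖) ^ 2 = 1
  rw [inv_mul_cancel₀ (norm_ne_zero_iff.2 (hy.immersed z hz)), one_pow]

theorem lorentzInner_partialV_canonicalLift {z : ℂ} (hz : z ∈ S) :
    lorentzInner (partialV (canonicalLift y) z) (partialV (canonicalLift y) z) = 1 := by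
  have hd := hasLineDerivAt_of_contDiffOn hS hy.smooth hz Complex.I
  have hm := hasLineDerivAt_norm_inv hS hy hz Complex.I
  rw [partialV, lorentzInner_deriv_lift hS hy.mem_sphere hz hd hd hm hm
      (Y := canonicalLift y) (fun w _ => rfl),
    real_inner_self_eq_norm_sq, ← mul_pow]
  have := hy.norm_eq z hz
  rw [partialV] at this
  rw [← this, inv_mul_cancel₀ (norm_ne_zero_iff.2 (hy.immersed z hz)), one_pow]

theorem lorentzInner_canonicalLift_deriv {z : ℂ} (hz : z ∈ S) (e : ℂ) :
    lorentzInner (canonicalLift y z) (lineDeriv ℝ (canonicalLift y) z e) = 0 := by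
  have hd := hasLineDerivAt_of_contDiffOn hS (contDiffOn_canonicalLift hS hy) hz e
  have h1 := (hd.lorentzInner hd).lineDeriv
  have h2 : ∀ w ∈ S, lorentzInner (canonicalLift y w) (canonicalLift y w) = 0 := fun w hw => by
    have : lorentzInner (canonicalLift y w) (canonicalLift y w) = ‖partialU y w‖⁻¹ ^ 2 *
        lorentzInner (lightVector (y w)) (lightVector (y w)) := by
      simp only [canonicalLift, lorentzInner_eq, Pi.smul_apply, smul_eq_mul]; ring
    rw [this, lorentzInner_lightVector, hy.mem_sphere w hw]; norm_num
  rw [lineDeriv_congr_on hS h2 hz e] at h1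
  simp [lineDeriv] at h1
  have h3 : lorentzInner (deriv (fun t : ℝ => canonicalLift y (z + ↑t * e)) 0) (canonicalLift y z)
      = lorentzInner (canonicalLift y z) (deriv (fun t : ℝ => canonicalLift y (z + ↑t * e)) 0) := by
    simp only [lorentzInner_eq]; ring
  simp only [lineDeriv, Complex.real_smul]
  linarith

theorem lorentzInner_canonicalLift_deriv_deriv {z : ℂ} (hz : z ∈ S) (e : ℂ) :
    lorentzInner (canonicalLift y z)
        (lineDeriv ℝ (fun w => lineDeriv ℝ (canonicalLift y) w e) z e)
      = -lorentzInner (lineDeriv ℝ (canonicalLift y) z e) (lineDeriv ℝ (canonicalLift y) z e) := by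
  have hY := contDiffOn_canonicalLift hS hy
  have hd := hasLineDerivAt_of_contDiffOn hS hY hz e
  have hd2 := hasLineDerivAt_of_contDiffOn hS (contDiffOn_lineDeriv hS hY e) hz e
  have h1 := (hd.lorentzInner hd2).lineDeriv
  rw [lineDeriv_congr_on hS (fun w hw => lorentzInner_canonicalLift_deriv hS hy hw e) hz e] at h1
  have h0 : lineDeriv ℝ (fun _ : ℂ => (0 : ℝ)) z e = 0 := by simp [lineDeriv]
  rw [h0] at h1
  linarith

/-- Differentiating `⟨Y, Y_e⟩ = 0` in both coordinate directions gives `-1` twice. Being nonzero,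
this pairing lets the Laplacian serve as the vector `d` of `frame_unique`. -/
theorem lorentzInner_canonicalLift_laplacian {z : ℂ} (hz : z ∈ S) :
    lorentzInner (canonicalLift y z) (planeLaplacian (canonicalLift y) z) = -2 := by
  have h1 := lorentzInner_canonicalLift_deriv_deriv hS hy hz 1
  have h2 := lorentzInner_canonicalLift_deriv_deriv hS hy hz Complex.I
  have h3 := lorentzInner_partialU_canonicalLift hS hy hz
  have h4 := lorentzInner_partialV_canonicalLift hS hy hz
  have hadd : ∀ x a b : Fin 5 → ℝ, lorentzInner x (a + b) = lorentzInner x a + lorentzInner x b := by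
    intro x a b; simp only [lorentzInner_eq, Pi.add_apply]; ring
  rw [planeLaplacian, hadd]
  unfold partialU partialV at *
  rw [h1, h2, h3, h4]; norm_num

/-! ### Uniqueness and equivariance of Gauss frames -/

theorem IsGaussFrame.unique {z : ℂ} (hz : z ∈ S) {E₁ E₂ : Matrix (Fin 5) (Fin 5) ℝ}
    (h₁ : IsGaussFrame y z E₁) (h₂ : IsGaussFrame y z E₂) : E₁ = E₂ := by
  obtain ⟨a1, a2, a3, a4, a5⟩ := h₁
  obtain ⟨b1, b2, b3, b4, b5⟩ := h₂
  refine frame_unique a1 b1 (a2.trans b2.symm) (a3.trans b3.symm) (a4.trans b4.symm) ?_ a5 b5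
  rw [a2]
  have : lorentzInner (√2 • canonicalLift y z) (planeLaplacian (canonicalLift y) z)
      = √2 * lorentzInner (canonicalLift y z) (planeLaplacian (canonicalLift y) z) := by
    simp only [lorentzInner_eq, Pi.smul_apply, smul_eq_mul]; ring
  rw [this, lorentzInner_canonicalLift_laplacian hS hy hz]
  simp

/-- `R Y` is a positive light-like lift of the translated surface, and it still has `⟨Y_u, Y_u⟩ = 1`
because `R` is an isometry. These two properties characterise the canonical lift. -/
theorem canonicalLift_moebius {a : ℂ} (ha : ∀ z ∈ S, z + a ∈ S) {R : Matrix (Fin 5) (Fin 5) ℝ}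
    (hR : R ∈ SOPlus)
    (h : ∀ z ∈ S, ∃ ρ : ℝ, 0 < ρ ∧ R *ᵥ lightVector (y z) = ρ • lightVector (y (z + a))) {z : ℂ}
    (hz : z ∈ S) : canonicalLift y (z + a) = R *ᵥ canonicalLift y z := by
  set Y := fun w => R *ᵥ canonicalLift y w with hYdef
  set μ := fun w => Y w 0 with hμ
  have hYS : ContDiffOn ℝ ∞ Y S :=
    (LinearMap.toContinuousLinearMap (Matrix.mulVecLin R)).contDiff.comp_contDiffOn
      (contDiffOn_canonicalLift hS hy)
  have hYρ : ∀ w ∈ S, ∃ r : ℝ, 0 < r ∧ Y w = r • lightVector (y (w + a)) := fun w hw => by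
    obtain ⟨ρ, hρ, hρ'⟩ := h w hw
    refine ⟨‖partialU y w‖⁻¹ * ρ,
      mul_pos (inv_pos.2 (norm_pos_iff.2 (hy.immersed w hw))) hρ, ?_⟩
    simp only [hYdef, canonicalLift, mulVec_smul, hρ', smul_smul]
  have hμY : ∀ w ∈ S, 0 < μ w ∧ Y w = μ w • lightVector (y (w + a)) := fun w hw => by
    obtain ⟨r, hr, hr'⟩ := hYρ w hw
    have : μ w = r := by simp [hμ, hr', lightVector]
    rw [this]; exact ⟨hr, hr'⟩
  have hmd : HasLineDerivAt ℝ μ (lineDeriv ℝ μ z 1) z 1 :=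
    hasLineDerivAt_of_contDiffOn hS (contDiffOn_pi.1 hYS 0) hz 1
  have hyd : HasLineDerivAt ℝ (fun w => y (w + a)) (partialU y (z + a)) z 1 := by
    have := hasLineDerivAt_of_contDiffOn hS hy.smooth (ha z hz) 1
    unfold HasLineDerivAt at *
    simpa [add_right_comm, partialU] using this
  have h1 := lorentzInner_deriv_lift hS (fun w hw => hy.mem_sphere _ (ha w hw)) hz hyd hyd hmd hmd
    (fun w hw => (hμY w hw).2)
  have h2 : lineDeriv ℝ Y z 1 = R *ᵥ partialU (canonicalLift y) z :=
    ((hasLineDerivAt_of_contDiffOn hS (contDiffOn_canonicalLift hS hy) hz 1).const_mulVec R).lineDeriv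
  rw [h2, lorentzInner_mulVec hR.1, lorentzInner_partialU_canonicalLift hS hy hz,
    real_inner_self_eq_norm_sq, ← mul_pow] at h1
  have h3 : 0 < ‖partialU y (z + a)‖ := norm_pos_iff.2 (hy.immersed _ (ha z hz))
  have h4 : μ z * ‖partialU y (z + a)‖ = 1 := by
    have := mul_pos (hμY z hz).1 h3
    nlinarith
  change canonicalLift y (z + a) = Y z
  rw [(hμY z hz).2, canonicalLift, eq_inv_of_mul_eq_one_left h4]

theorem IsGaussFrame.moebius {a : ℂ} (ha : ∀ z ∈ S, z + a ∈ S) {R : Matrix (Fin 5) (Fin 5) ℝ}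
    (hR : R ∈ SOPlus)
    (h : ∀ z ∈ S, ∃ ρ : ℝ, 0 < ρ ∧ R *ᵥ lightVector (y z) = ρ • lightVector (y (z + a))) {z : ℂ}
    (hz : z ∈ S) {E : Matrix (Fin 5) (Fin 5) ℝ} (hE : IsGaussFrame y z E) :
    IsGaussFrame y (z + a) (R * E) := by
  obtain ⟨a1, a2, a3, a4, a5⟩ := hE
  have hY := contDiffOn_canonicalLift hS hy
  have h0 : ∀ w ∈ S, canonicalLift y (w + a) = R *ᵥ canonicalLift y w :=
    fun w hw => canonicalLift_moebius hS hy ha hR h hw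
  have h1 : ∀ e, ∀ w ∈ S,
      lineDeriv ℝ (canonicalLift y) (w + a) e = R *ᵥ lineDeriv ℝ (canonicalLift y) w e :=
    fun e w hw => by
      rw [← lineDeriv_comp_add_right, lineDeriv_congr_on hS h0 hw e]
      exact ((hasLineDerivAt_of_contDiffOn hS hY hw e).const_mulVec R).lineDeriv
  have h2 : ∀ e, lineDeriv ℝ (fun w => lineDeriv ℝ (canonicalLift y) w e) (z + a) e
      = R *ᵥ lineDeriv ℝ (fun w => lineDeriv ℝ (canonicalLift y) w e) z e :=
    fun e => by
      rw [← lineDeriv_comp_add_right (fun w => lineDeriv ℝ (canonicalLift y) w e),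
        lineDeriv_congr_on hS (h1 e) hz e]
      exact ((hasLineDerivAt_of_contDiffOn hS (contDiffOn_lineDeriv hS hY e) hz e).const_mulVec
        R).lineDeriv
  have h3 : planeLaplacian (canonicalLift y) (z + a) = R *ᵥ planeLaplacian (canonicalLift y) z := by
    have e1 := h2 1
    have e2 := h2 Complex.I
    unfold planeLaplacian
    rw [mulVec_add]
    exact congrArg₂ (· + ·) e1 e2
  have hcol : ∀ j, (R * E).col j = R *ᵥ E.col j := fun j => by
    rw [← Matrix.mulVec_single_one, ← Matrix.mulVec_single_one, mulVec_mulVec]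
  refine ⟨mul_mem_SOPlus hR a1, ?_, ?_, ?_, ?_⟩
  · rw [hcol, hcol, ← mulVec_sub, a2, h0 z hz, mulVec_smul]
  · rw [hcol, a3]; exact (h1 1 z hz).symm
  · rw [hcol, a4]; exact (h1 Complex.I z hz).symm
  · rw [hcol, h3, lorentzInner_mulVec hR.1, a5]

/-- If `y` has period `p`, then `R` and the identity both realise the translation, so `R E` and `E`
are Gauss frames at the same point, and uniqueness gives `R = 1`. One Gauss frame at one point is
enough. -/
theorem hasRealPeriod_iff {p : ℝ} (hp : ∀ z ∈ S, z + p ∈ S) {R : Matrix (Fin 5) (Fin 5) ℝ}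
    (hR : R ∈ SOPlus)
    (h : ∀ z ∈ S, ∃ ρ : ℝ, 0 < ρ ∧ R *ᵥ lightVector (y z) = ρ • lightVector (y (z + p))) {z₀ : ℂ}
    (hz₀ : z₀ ∈ S) {E : Matrix (Fin 5) (Fin 5) ℝ} (hE : IsGaussFrame y z₀ E) :
    HasRealPeriod S y p ↔ R = 1 := by
  constructor
  · intro hper
    have h1 := hE.moebius hS hy hp hR h hz₀
    have h2 := hE.moebius hS hy hp one_mem_SOPlus
      (fun z hz => ⟨1, one_pos, by rw [hper z hz, one_mulVec, one_smul]⟩) hz₀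
    have h3 := IsGaussFrame.unique hS hy (hp z₀ hz₀) h1 h2
    rw [one_mul] at h3
    have h4 := congrArg (· * lorentzAdjoint E) h3
    simpa only [mul_assoc, self_mul_lorentzAdjoint hE.1.1, mul_one] using h4
  · rintro rfl z hz
    obtain ⟨ρ, -, hρ⟩ := h z hz
    rw [one_mulVec] at hρ
    have h0 : ρ = 1 := by simpa [lightVector] using (congrFun hρ 0).symm
    rw [h0, one_smul] at hρ
    ext i
    have hi := fun j => congrFun hρ j
    fin_cases i
    · simpa [lightVector] using (hi 1).symm
    · simpa [lightVector] using (hi 2).symm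
    · simpa [lightVector] using (hi 3).symm
    · simpa [lightVector] using (hi 4).symm

end

/-! ### Uniqueness of the Iwasawa decomposition -/

/-- Maximum modulus principle for `exp(-if)`, whose modulus is `exp(Im f)` and equals `1` on the
circle. -/
theorem im_le_zero_of_diffContOnCl {f : ℂ → ℂ} (hf : DiffContOnCl ℂ f (Metric.ball 0 1))
    (hr : ∀ ζ : ℂ, ‖ζ‖ = 1 → (f ζ).im = 0) {ζ : ℂ} (hζ : ‖ζ‖ ≤ 1) : (f ζ).im ≤ 0 := by
  have hg : DiffContOnCl ℂ (fun ζ => Complex.exp (-Complex.I * f ζ)) (Metric.ball 0 1) :=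
    Complex.differentiable_exp.comp_diffContOnCl (hf.const_smul (-Complex.I))
  have hn : ∀ ζ, ‖Complex.exp (-Complex.I * f ζ)‖ = Real.exp (f ζ).im := fun ζ => by
    rw [Complex.norm_exp]; simp
  have h := Complex.norm_le_of_forall_mem_frontier_norm_le (C := 1) Metric.isBounded_ball hg
    (fun w hw => by
      rw [frontier_ball _ one_ne_zero, mem_sphere_zero_iff_norm] at hw
      rw [hn, hr w hw, Real.exp_zero])
    (z := ζ) (by rw [closure_ball _ one_ne_zero]; simpa using hζ)
  rw [hn] at h
  exact Real.exp_le_one_iff.1 h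

theorem exists_real_const_of_diffContOnCl {f : ℂ → ℂ} (hf : DiffContOnCl ℂ f (Metric.ball 0 1))
    (hr : ∀ ζ : ℂ, ‖ζ‖ = 1 → (f ζ).im = 0) : ∃ c : ℝ, ∀ ζ : ℂ, ‖ζ‖ = 1 → f ζ = c := by
  have him : ∀ ζ : ℂ, ‖ζ‖ ≤ 1 → (f ζ).im = 0 := fun ζ hζ => by
    refine le_antisymm (im_le_zero_of_diffContOnCl hf hr hζ) ?_
    have := im_le_zero_of_diffContOnCl hf.neg (fun w hw => by simp [hr w hw]) hζ
    simpa using this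
  obtain ⟨c, hc⟩ := AnalyticOnNhd.eq_const_of_im_eq_const
    (hf.differentiableOn.analyticOnNhd Metric.isOpen_ball)
    (fun x hx => him x (mem_ball_zero_iff.1 hx).le) Metric.isOpen_ball
    ⟨⟨0, by simp⟩, (convex_ball (0 : ℂ) 1).isPreconnected⟩
  have hcl : Set.EqOn f (fun _ => c) (closure (Metric.ball 0 1)) :=
    Set.EqOn.of_subset_closure (fun x hx => hc x hx) hf.continuousOn continuousOn_const
      subset_closure subset_rfl
  rw [closure_ball _ one_ne_zero] at hcl
  refine ⟨c.re, fun ζ hζ => ?_⟩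
  have h1 : f ζ = c := hcl (by simp [hζ])
  rw [h1]
  apply Complex.ext <;> simp [← h1, him ζ hζ.le]

/-! ### Complexification, the twist and the comparison of two factorizations. -/

theorem map_ofReal_mul (A B : Matrix (Fin 5) (Fin 5) ℝ) :
    (A * B).map (fun x : ℝ => (x : ℂ))
      = A.map (fun x : ℝ => (x : ℂ)) * B.map (fun x : ℝ => (x : ℂ)) :=
  Matrix.map_mul (f := Complex.ofRealHom)

theorem map_ofReal_injective {A B : Matrix (Fin 5) (Fin 5) ℝ}
    (h : A.map (fun x : ℝ => (x : ℂ)) = B.map (fun x : ℝ => (x : ℂ))) : A = B :=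
  Matrix.map_injective Complex.ofReal_injective h

theorem map_ofReal_one :
    (1 : Matrix (Fin 5) (Fin 5) ℝ).map (fun x : ℝ => (x : ℂ)) = 1 :=
  Matrix.map_one _ Complex.ofReal_zero Complex.ofReal_one

theorem map_ofReal_lorentzAdjoint (A : Matrix (Fin 5) (Fin 5) ℝ) :
    (lorentzAdjoint A).map (fun x : ℝ => (x : ℂ))
      = lorentzAdjoint (A.map (fun x : ℝ => (x : ℂ))) := by
  rw [lorentzAdjoint, map_ofReal_mul, map_ofReal_mul, lorentzMetric_map, lorentzAdjoint,
    Matrix.transpose_map]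

theorem lorentzAdjoint_apply {R : Type*} [CommRing R] (A : Matrix (Fin 5) (Fin 5) R)
    (i j : Fin 5) :
    lorentzAdjoint A i j
      = (![-1, 1, 1, 1, 1] : Fin 5 → R) i * (![-1, 1, 1, 1, 1] : Fin 5 → R) j * A j i := by
  simp only [lorentzAdjoint, lorentzMetric, Matrix.mul_diagonal, Matrix.diagonal_mul,
    Matrix.transpose_apply]
  ring

theorem twist_mul {R : Type*} [CommRing R] (A B : Matrix (Fin 5) (Fin 5) R) :
    twist (A * B) = twist A * twist B := by
  have h : (Matrix.diagonal ![1, 1, 1, 1, -1] : Matrix (Fin 5) (Fin 5) R)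
      * Matrix.diagonal ![1, 1, 1, 1, -1] = 1 := by
    rw [Matrix.diagonal_mul_diagonal, ← Matrix.diagonal_one]
    congr 1; funext i; fin_cases i <;> simp
  simp only [twist]
  calc _ = Matrix.diagonal ![1, 1, 1, 1, -1] * A * 1 * B * Matrix.diagonal ![1, 1, 1, 1, -1] := by
        simp only [mul_assoc, mul_one]
    _ = _ := by rw [← h]; simp only [mul_assoc]

theorem twist_apply {R : Type*} [CommRing R] (A : Matrix (Fin 5) (Fin 5) R) (i j : Fin 5) :
    twist A i j
      = (![1, 1, 1, 1, -1] : Fin 5 → R) i * (![1, 1, 1, 1, -1] : Fin 5 → R) j * A i j := by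
  simp only [twist, Matrix.mul_diagonal, Matrix.diagonal_mul]
  ring

theorem twist_twist {R : Type*} [CommRing R] (A : Matrix (Fin 5) (Fin 5) R) :
    twist (twist A) = A := by
  ext i j
  rw [twist_apply, twist_apply]
  fin_cases i <;> fin_cases j <;> simp

/-- The loop `g₂⁻¹ g₁ = V₂ V₁⁻¹` is real on the circle and extends holomorphically to the disk,
hence is constant. A constant twisted loop commutes with the involution, so it is block diagonal and
acts on the last vector by a sign. -/
theorem iwasawa_col_unique {g₁ g₂ : ℂ → Matrix (Fin 5) (Fin 5) ℝ}
    {V₁ V₂ : ℂ → Matrix (Fin 5) (Fin 5) ℂ} (hg₁ : IsRealTwistedLoop g₁)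
    (hg₂ : IsRealTwistedLoop g₂) (hV₁ : IsPlusTwistedLoop V₁) (hV₂ : IsPlusTwistedLoop V₂)
    (h : ∀ ζ : ℂ, ‖ζ‖ = 1 → (g₁ ζ).map (fun x : ℝ => (x : ℂ)) * V₁ ζ
      = (g₂ ζ).map (fun x : ℝ => (x : ℂ)) * V₂ ζ) :
    ∃ ε : ℝ, (ε = 1 ∨ ε = -1) ∧ ∀ ζ : ℂ, ‖ζ‖ = 1 → (g₁ ζ).col 4 = ε • (g₂ ζ).col 4 := by
  have hH : ∀ ζ : ℂ, ‖ζ‖ = 1 → V₂ ζ * lorentzAdjoint (V₁ ζ)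
      = (lorentzAdjoint (g₂ ζ) * g₁ ζ).map (fun x : ℝ => (x : ℂ)) := fun ζ hζ => by
    have h1 := self_mul_lorentzAdjoint (hV₁.2.1 ζ hζ.le).1
    have h2 : lorentzAdjoint ((g₂ ζ).map (fun x : ℝ => (x : ℂ)))
        * (g₂ ζ).map (fun x : ℝ => (x : ℂ)) = 1 := by
      rw [← map_ofReal_lorentzAdjoint, ← map_ofReal_mul,
        lorentzAdjoint_mul_self (hg₂.2 ζ hζ).1.1, map_ofReal_one]
    rw [map_ofReal_mul, map_ofReal_lorentzAdjoint]
    calc V₂ ζ * lorentzAdjoint (V₁ ζ)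
        = lorentzAdjoint ((g₂ ζ).map (fun x : ℝ => (x : ℂ)))
            * ((g₂ ζ).map (fun x : ℝ => (x : ℂ)) * V₂ ζ) * lorentzAdjoint (V₁ ζ) := by
          rw [← mul_assoc, h2, one_mul]
      _ = _ := by rw [← h ζ hζ, mul_assoc, mul_assoc, h1, mul_one]
  have hD : ∀ i j, DiffContOnCl ℂ (fun ζ => (V₂ ζ * lorentzAdjoint (V₁ ζ)) i j)
      (Metric.ball 0 1) := fun i j => by
    simp only [Matrix.mul_apply, lorentzAdjoint_apply, Fin.sum_univ_five]
    have hm := fun k => (hV₂.1 i k).smul ((hV₁.1 j k).const_smul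
      ((![-1, 1, 1, 1, 1] : Fin 5 → ℂ) k * (![-1, 1, 1, 1, 1] : Fin 5 → ℂ) j))
    exact ((((hm 0).add (hm 1)).add (hm 2)).add (hm 3)).add (hm 4)
  have hc : ∀ i j, ∃ c : ℝ, ∀ ζ : ℂ, ‖ζ‖ = 1 → (V₂ ζ * lorentzAdjoint (V₁ ζ)) i j = c :=
    fun i j => exists_real_const_of_diffContOnCl (hD i j) fun ζ hζ => by
      rw [hH ζ hζ]; simp
  choose k hk using hc
  have hk' : ∀ ζ : ℂ, ‖ζ‖ = 1 → lorentzAdjoint (g₂ ζ) * g₁ ζ = Matrix.of k := fun ζ hζ => by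
    apply map_ofReal_injective
    rw [← hH ζ hζ]
    ext i j
    simp [hk i j ζ hζ]
  have hg : ∀ ζ : ℂ, ‖ζ‖ = 1 → g₁ ζ = g₂ ζ * Matrix.of k := fun ζ hζ => by
    rw [← hk' ζ hζ, ← mul_assoc, self_mul_lorentzAdjoint (hg₂.2 ζ hζ).1.1, one_mul]
  have h1 : ‖(1 : ℂ)‖ = 1 := norm_one
  -- The same constant serves at `1` and at `-1`, where both loops are twisted.
  have htw : Matrix.of k = twist (Matrix.of k) := by
    have e1 := hg (-1) (by simp)
    rw [(hg₁.2 1 h1).2, (hg₂.2 1 h1).2] at e1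
    have e2 := congrArg twist e1
    rw [twist_mul, twist_twist, twist_twist, hg 1 h1] at e2
    have e3 := congrArg (lorentzAdjoint (g₂ 1) * ·) e2
    simpa only [← mul_assoc, lorentzAdjoint_mul_self (hg₂.2 1 h1).1.1, one_mul] using e3
  have h0 : ∀ i, i ≠ 4 → k i 4 = 0 := fun i hi => by
    have := congrFun (congrFun htw i) 4
    rw [twist_apply] at this
    fin_cases i <;> simp at this hi <;> simpa using (by linarith : k _ 4 = 0)
  have hO : (Matrix.of k)ᵀ * lorentzMetric ℝ * Matrix.of k = lorentzMetric ℝ := by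
    rw [← hk' 1 h1]
    exact orthogonal_mul (lorentzAdjoint_orthogonal (hg₂.2 1 h1).1.1) (hg₁.2 1 h1).1.1
  have h44 : k 4 4 * k 4 4 = 1 := by
    have := lorentzInner_col hO 4 4
    simpa [lorentzInner_eq, lorentzMetric, h0] using this
  refine ⟨k 4 4, mul_self_eq_one_iff.1 h44, fun ζ hζ => ?_⟩
  ext i
  rw [hg ζ hζ]
  simp [Matrix.mul_apply, Fin.sum_univ_five, h0]
  ring

/-! ### The disk algebra -/

/-- The coordinate function on the closed unit disk. -/
def diskCoordinate : C(Metric.closedBall (0 : ℂ) 1, ℂ) := ⟨Subtype.val, continuous_subtype_val⟩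

/-- The disk algebra: uniform limits of polynomials on the closed unit disk. -/
abbrev DiskAlgebra := Algebra.elemental ℂ diskCoordinate

open Classical in
/-- The extension by zero of a function on the closed unit disk. -/
def diskExtend (f : C(Metric.closedBall (0 : ℂ) 1, ℂ)) (ζ : ℂ) : ℂ :=
  if h : ζ ∈ Metric.closedBall (0 : ℂ) 1 then f ⟨ζ, h⟩ else 0

theorem diskExtend_of_mem (f : C(Metric.closedBall (0 : ℂ) 1, ℂ)) {ζ : ℂ}
    (h : ζ ∈ Metric.closedBall (0 : ℂ) 1) : diskExtend f ζ = f ⟨ζ, h⟩ := dif_pos h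

/-- Evaluation at a point of the closed unit disk, as a ring homomorphism. -/
def diskEvalHom (x : Metric.closedBall (0 : ℂ) 1) : DiskAlgebra →+* ℂ where
  toFun f := f.1 x
  map_one' := rfl
  map_mul' _ _ := rfl
  map_zero' := rfl
  map_add' _ _ := rfl

/-- Evaluation at a point of the closed unit disk, as a continuous real linear map. -/
def diskEvalCLM (x : Metric.closedBall (0 : ℂ) 1) : DiskAlgebra →L[ℝ] ℂ where
  toFun f := f.1 x
  map_add' _ _ := rfl
  map_smul' _ _ := rfl
  cont := (continuous_eval_const x).comp continuous_subtype_val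

/-- Polynomials are holomorphic and uniform limits preserve this. The disk algebra is a Banach
algebra, so an ODE solved inside it keeps its solution holomorphic in `λ` without any argument on
parameter dependence. -/
theorem diffContOnCl_of_mem_closure {f : C(Metric.closedBall (0 : ℂ) 1, ℂ)}
    (hf : f ∈ Algebra.elemental ℂ diskCoordinate) :
    DiffContOnCl ℂ (diskExtend f) (Metric.ball 0 1) := by
  have hball : ∀ ζ ∈ Metric.ball (0 : ℂ) 1, ζ ∈ Metric.closedBall (0 : ℂ) 1 :=
    fun ζ hζ => Metric.ball_subset_closedBall hζ
  constructor
  · have hpoly : ∀ g ∈ Algebra.adjoin ℂ {diskCoordinate}, DifferentiableOn ℂ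
        (diskExtend g) (Metric.ball 0 1) := by
      intro g hg
      induction hg using Algebra.adjoin_induction with
      | mem x hx =>
        rw [Set.mem_singleton_iff.1 hx]
        exact differentiableOn_id.congr fun ζ hζ => by simp [diskExtend_of_mem _ (hball ζ hζ), diskCoordinate]
      | algebraMap r =>
        exact (differentiableOn_const r).congr fun ζ hζ => by simp [diskExtend_of_mem _ (hball ζ hζ)]
      | add x y _ _ hx hy =>
        exact (hx.add hy).congr fun ζ hζ => by simp [diskExtend_of_mem _ (hball ζ hζ)]
      | mul x y _ _ hx hy =>
        exact (hx.mul hy).congr fun ζ hζ => by simp [diskExtend_of_mem _ (hball ζ hζ)]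
    have hf' : f ∈ closure (Algebra.adjoin ℂ {diskCoordinate} : Set C(Metric.closedBall (0 : ℂ) 1, ℂ)) :=
      hf
    obtain ⟨u, hu, hlim⟩ := mem_closure_iff_seq_limit.1 hf'
    rw [ContinuousMap.tendsto_iff_tendstoUniformly] at hlim
    refine TendstoLocallyUniformlyOn.differentiableOn (φ := Filter.atTop)
      (F := fun n => diskExtend (u n))
      (TendstoUniformlyOn.tendstoLocallyUniformlyOn ?_)
      (Filter.Eventually.of_forall fun n => hpoly _ (hu n)) Metric.isOpen_ball
    rw [Metric.tendstoUniformlyOn_iff]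
    rw [Metric.tendstoUniformly_iff] at hlim
    intro ε hε
    filter_upwards [hlim ε hε] with n hn ζ hζ
    simpa [diskExtend_of_mem _ (hball ζ hζ)] using hn ⟨ζ, hball ζ hζ⟩
  · rw [closure_ball _ one_ne_zero, continuousOn_iff_continuous_domRestrict]
    convert f.continuous using 1
    funext ζ
    exact diskExtend_of_mem f ζ.2

/-! ### The Maurer–Cartan form -/

/-- The Maurer–Cartan form as a linear expression in the constant `o = 1` and the invariants
`κ = |k|²`, `k`, `β`, `s`; here `i` stands for the imaginary unit and `q` for `√2 / 4`. The
`dz`-part at `λ` is `frameForm q i 1 κ (λ⁻¹ k) (λ⁻¹ β) s`, and the `dz̄`-part is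
`frameForm q (-i) 1 κ (λ k̄) (λ β̄) s̄`. -/
def frameForm {R : Type*} [CommRing R] (q i o κ k β s : R) : Matrix (Fin 5) (Fin 5) R :=
  !![0, 0, q * (o - s - 2 * κ), -(i * q * (o + s - 2 * κ)), 4 * q * β;
     0, 0, q * (o + s + 2 * κ), -(i * q * (o - s + 2 * κ)), -(4 * q * β);
     q * (o - s - 2 * κ), -(q * (o + s + 2 * κ)), 0, 0, -k;
     -(i * q * (o + s - 2 * κ)), i * q * (o - s + 2 * κ), 0, 0, -(i * k);
     4 * q * β, 4 * q * β, k, i * k, 0]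

theorem frameForm_map {R R' : Type*} [CommRing R] [CommRing R'] (f : R →+* R')
    (q i o κ k β s : R) :
    (frameForm q i o κ k β s).map f
      = frameForm (f q) (f i) (f o) (f κ) (f k) (f β) (f s) := by
  ext a b
  fin_cases a <;> fin_cases b <;> simp [frameForm, map_ofNat]

theorem lorentzAdjoint_frameForm {R : Type*} [CommRing R] (q i o κ k β s : R) :
    lorentzAdjoint (frameForm q i o κ k β s) = -frameForm q i o κ k β s := by
  ext a b
  rw [lorentzAdjoint_apply]
  fin_cases a <;> fin_cases b <;> simp [frameForm]

theorem twist_frameForm {R : Type*} [CommRing R] (q i o κ k β s : R) :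
    twist (frameForm q i o κ k β s) = frameForm q i o κ (-k) (-β) s := by
  ext a b
  rw [twist_apply]
  fin_cases a <;> fin_cases b <;> simp [frameForm]

set_option maxHeartbeats 1000000 in
/-- The commutator identity behind the flatness of the Maurer–Cartan form. -/
theorem frameForm_bracket {q i k K β b s σ : ℂ} (hq : q ^ 2 = 1 / 8) (hi : i ^ 2 = -1) :
    (-2 * i) • (frameForm q i 1 (k * K) k β s * frameForm q (-i) 1 (k * K) K b σ
      - frameForm q (-i) 1 (k * K) K b σ * frameForm q i 1 (k * K) k β s)
    = frameForm q i 0 (-2 * i * β * K + k * (2 * i * b)) (-2 * i * β) (i * k * σ)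
        (4 * i * K * β - 12 * i * b * k)
      + frameForm q (-i) 0 (-2 * i * β * K + k * (2 * i * b)) (2 * i * b) (-i * K * s)
        (12 * i * K * β - 4 * i * b * k) := by
  have hi3 : i ^ 3 = -i := by rw [pow_succ, hi]; ring
  ext a c
  simp only [Matrix.smul_apply, Matrix.sub_apply, Matrix.add_apply, Matrix.mul_apply,
    Fin.sum_univ_five, smul_eq_mul]
  fin_cases a <;> fin_cases c <;> simp [frameForm, -mul_eq_zero, -neg_eq_zero] <;> (try ring_nf) <;>
    (try simp only [hq, hi, hi3]) <;> (try ring)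

/-! ### Solving the structure equations -/

/-- `k`, `β`, `s` and the plus part of the frame. -/
abbrev FrameState := ℂ × ℂ × ℂ × (Fin 5 → Fin 5 → DiskAlgebra)

/-- Complex constants in the disk algebra. -/
def diskConst : ℂ →L[ℝ] DiskAlgebra :=
  ContinuousLinearMap.restrictScalars ℝ (algebraMapCLM ℂ DiskAlgebra)

/-- The coordinate function as an element of the disk algebra. -/
def diskVariable : DiskAlgebra := ⟨diskCoordinate, Algebra.elemental.self_mem ℂ diskCoordinate⟩

/-- `√2 / 4`. -/
def quarterSqrtTwo : ℂ := ((√2 / 4 : ℝ) : ℂ)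

theorem quarterSqrtTwo_sq : quarterSqrtTwo ^ 2 = 1 / 8 := by
  rw [quarterSqrtTwo, ← Complex.ofReal_pow, div_pow, Real.sq_sqrt (by norm_num)]
  norm_num

theorem conj_quarterSqrtTwo : (starRingEnd ℂ) quarterSqrtTwo = quarterSqrtTwo :=
  Complex.conj_ofReal _

/-- The `dz̄`-part of the Maurer–Cartan form as a matrix over the disk algebra. -/
def diskForm (p : FrameState) : Matrix (Fin 5) (Fin 5) DiskAlgebra :=
  frameForm (diskConst quarterSqrtTwo) (diskConst (-Complex.I)) (diskConst 1)
    (diskConst (p.1 * (starRingEnd ℂ) p.1)) (diskVariable * diskConst ((starRingEnd ℂ) p.1))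
    (diskVariable * diskConst ((starRingEnd ℂ) p.2.1)) (diskConst ((starRingEnd ℂ) p.2.2.1))

/-- The vector field of the structure equations of a translationally equivariant Willmore surface
in the direction of `v`. -/
def structureField (p : FrameState) : FrameState :=
  (-2 * Complex.I * p.2.1, Complex.I * p.1 * (starRingEnd ℂ) p.2.2.1,
    4 * Complex.I * (starRingEnd ℂ) p.1 * p.2.1 - 12 * Complex.I * (starRingEnd ℂ) p.2.1 * p.1,
    fun i j => ∑ l, diskConst (2 * Complex.I) * diskForm p i l * p.2.2.2 l j)

theorem contDiff_conj {f : FrameState → ℂ} (hf : ContDiff ℝ ∞ f) :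
    ContDiff ℝ ∞ (fun p => (starRingEnd ℂ) (f p)) :=
  Complex.conjCLE.contDiff.comp hf

theorem contDiff_diskConst {f : FrameState → ℂ} (hf : ContDiff ℝ ∞ f) :
    ContDiff ℝ ∞ (fun p => diskConst (f p)) :=
  diskConst.contDiff.comp hf

theorem contDiff_structureField : ContDiff ℝ ∞ structureField := by
  have hk : ContDiff ℝ ∞ fun p : FrameState => p.1 := contDiff_fst
  have hβ : ContDiff ℝ ∞ fun p : FrameState => p.2.1 := contDiff_snd.fst
  have hs : ContDiff ℝ ∞ fun p : FrameState => p.2.2.1 := contDiff_snd.snd.fst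
  have hV : ∀ i j, ContDiff ℝ ∞ fun p : FrameState => p.2.2.2 i j := fun i j =>
    contDiff_pi.1 (contDiff_pi.1 (contDiff_snd.snd.snd) i) j
  have hK := contDiff_conj hk
  have hb := contDiff_conj hβ
  have hσ := contDiff_conj hs
  have a1 := contDiff_diskConst (hk.mul hK)
  have a2 := contDiff_diskConst hK
  have a3 := contDiff_diskConst hb
  have a4 := contDiff_diskConst hσ
  have hform : ∀ i j, ContDiff ℝ ∞ fun p : FrameState => diskForm p i j := by
    intro i j
    fin_cases i <;> fin_cases j <;> simp only [diskForm, frameForm] <;> simp <;> fun_prop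
  refine ContDiff.prodMk ?_ (ContDiff.prodMk ?_ (ContDiff.prodMk ?_ ?_))
  · fun_prop
  · fun_prop
  · fun_prop
  · exact contDiff_pi.2 fun i => contDiff_pi.2 fun j => ContDiff.sum fun l _ =>
      (contDiff_const.mul (hform i l)).mul (hV l j)

/-- Picard–Lindelöf in the Banach space `FrameState`, followed by bootstrapping of regularity; `ε`
is halved so that the latter runs on a closed interval. -/
theorem exists_structure_solution (x₀ : FrameState) :
    ∃ ε : ℝ, 0 < ε ∧ ∃ x : ℝ → FrameState, x 0 = x₀ ∧
      (∀ v ∈ Set.Ioo (-ε) ε, HasDerivAt x (structureField (x v)) v) ∧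
      ContDiffOn ℝ ∞ x (Set.Ioo (-ε) ε) := by
  obtain ⟨x, hx0, ε, hε, hx⟩ :=
    (contDiff_structureField.contDiffAt (x := x₀)).of_le (by simp : (1 : WithTop ℕ∞) ≤ ∞)
      |>.exists_forall_mem_closedBall_exists_eq_forall_mem_Ioo_hasDerivAt₀ 0
  have hsub : ∀ v ∈ Set.Icc (-(ε / 2)) (ε / 2), v ∈ Set.Ioo (0 - ε) (0 + ε) := fun v hv =>
    ⟨by linarith [hv.1], by linarith [hv.2]⟩
  refine ⟨ε / 2, by positivity, x, hx0, fun v hv => hx v (hsub v (Set.Ioo_subset_Icc_self hv)), ?_⟩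
  have h := ODE.contDiffOn_enat_Icc_of_hasDerivWithinAt (n := ⊤) (u := Set.univ)
    (f := fun _ => structureField) (tmin := -(ε / 2)) (tmax := ε / 2) (α := x)
    (contDiff_structureField.comp contDiff_snd).contDiffOn
    (fun v hv => (hx v (hsub v hv)).hasDerivWithinAt) (fun _ _ => trivial)
  exact h.mono Set.Ioo_subset_Icc_self

/-- Evaluation at `ζ` is a continuous algebra homomorphism, so the single ODE over the disk algebra
specialises to a matrix ODE for every `ζ` in the closed disk, on an interval independent of `ζ`. -/
theorem exists_plus_frame (k₀ β₀ s₀ : ℂ) :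
    ∃ ε : ℝ, 0 < ε ∧ ∃ (k β s : ℝ → ℂ) (V : ℝ → ℂ → Matrix (Fin 5) (Fin 5) ℂ),
      k 0 = k₀ ∧ β 0 = β₀ ∧ s 0 = s₀ ∧
      (∀ v ∈ Set.Ioo (-ε) ε, HasDerivAt k (-2 * Complex.I * β v) v ∧
        HasDerivAt β (Complex.I * k v * (starRingEnd ℂ) (s v)) v ∧
        HasDerivAt s (4 * Complex.I * (starRingEnd ℂ) (k v) * β v
          - 12 * Complex.I * (starRingEnd ℂ) (β v) * k v) v) ∧
      (∀ v i j, DiffContOnCl ℂ (fun ζ => V v ζ i j) (Metric.ball 0 1)) ∧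
      ∀ ζ : ℂ, ‖ζ‖ ≤ 1 → V 0 ζ = 1 ∧
        (∀ i j, ContDiffOn ℝ ∞ (fun v => V v ζ i j) (Set.Ioo (-ε) ε)) ∧
        ∀ v ∈ Set.Ioo (-ε) ε, ∀ i j, HasDerivAt (fun v => V v ζ i j)
          (((2 * Complex.I) • frameForm quarterSqrtTwo (-Complex.I) 1 (k v * (starRingEnd ℂ) (k v))
            (ζ * (starRingEnd ℂ) (k v)) (ζ * (starRingEnd ℂ) (β v)) ((starRingEnd ℂ) (s v))
            * V v ζ) i j) v := by
  obtain ⟨ε, hε, x, hx0, hx, hxs⟩ :=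
    exists_structure_solution (k₀, β₀, s₀, fun i j => if i = j then 1 else 0)
  have h1 := fun v hv => (hx v hv).fst
  have h2 := fun v hv => (hx v hv).snd
  have h3 := fun v hv => (h2 v hv).snd
  have h4 := fun v hv => (h3 v hv).snd
  refine ⟨ε, hε, fun v => (x v).1, fun v => (x v).2.1, fun v => (x v).2.2.1,
    fun v ζ => Matrix.of fun i j => diskExtend ((x v).2.2.2 i j).1 ζ, by simp [hx0], by simp [hx0],
    by simp [hx0], fun v hv => ⟨h1 v hv, (h2 v hv).fst, (h3 v hv).fst⟩,
    fun v i j => diffContOnCl_of_mem_closure ((x v).2.2.2 i j).2, fun ζ hζ => ?_⟩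
  have hζ' : ζ ∈ Metric.closedBall (0 : ℂ) 1 := by simpa using hζ
  have hev : ∀ f : DiskAlgebra, diskExtend f.1 ζ = diskEvalCLM ⟨ζ, hζ'⟩ f := fun f =>
    diskExtend_of_mem _ hζ'
  have hev' : ∀ f : DiskAlgebra, diskEvalCLM ⟨ζ, hζ'⟩ f = diskEvalHom ⟨ζ, hζ'⟩ f := fun f => rfl
  have hc : ∀ a : ℂ, diskEvalHom ⟨ζ, hζ'⟩ (diskConst a) = a := fun a => rfl
  have hvar : diskEvalHom ⟨ζ, hζ'⟩ diskVariable = ζ := rfl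
  refine ⟨?_, fun i j => ?_, fun v hv i j => ?_⟩
  · ext i j
    simp only [Matrix.of_apply, hev, hev', hx0, Matrix.one_apply]
    split <;> simp
  · simp only [Matrix.of_apply, hev]
    have : ContDiffOn ℝ ∞ (fun v => (x v).2.2.2 i j) (Set.Ioo (-ε) ε) :=
      contDiffOn_pi.1 (contDiffOn_pi.1 hxs.snd.snd.snd i) j
    exact (diskEvalCLM ⟨ζ, hζ'⟩).contDiff.comp_contDiffOn this
  · simp only [Matrix.of_apply, hev]
    have h5 := hasDerivAt_pi.1 (hasDerivAt_pi.1 (h4 v hv) i) j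
    have h6 := (diskEvalCLM ⟨ζ, hζ'⟩).hasFDerivAt.comp_hasDerivAt v h5
    have hmap : (diskForm (x v)).map (diskEvalHom ⟨ζ, hζ'⟩)
        = frameForm quarterSqrtTwo (-Complex.I) 1 ((x v).1 * (starRingEnd ℂ) (x v).1)
          (ζ * (starRingEnd ℂ) (x v).1) (ζ * (starRingEnd ℂ) (x v).2.1)
          ((starRingEnd ℂ) (x v).2.2.1) := by
      rw [diskForm, frameForm_map]; rfl
    refine HasDerivAt.congr_deriv h6 ?_
    rw [hev', ← hmap, structureField, map_sum, Matrix.mul_apply]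
    refine Finset.sum_congr rfl fun l _ => ?_
    rw [map_mul, map_mul, hc]
    rfl

/-! ### Matrix-valued linear differential equations -/

section
open scoped Matrix.Norms.Operator

theorem hasDerivAt_matrix_iff {f : ℝ → Matrix (Fin 5) (Fin 5) ℂ} {f' : Matrix (Fin 5) (Fin 5) ℂ}
    {t : ℝ} : HasDerivAt f f' t ↔ ∀ i j, HasDerivAt (fun t => f t i j) (f' i j) t :=
  ⟨fun h i j => hasDerivAt_pi.1 (hasDerivAt_pi.1 h i) j,
    fun h => hasDerivAt_pi.2 fun i => hasDerivAt_pi.2 fun j => h i j⟩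

/-- The coefficients are bounded on a compact interval reaching past `v`, which gives the Lipschitz
constant for uniqueness. The algebraic identities for `V` and `F` are proved by letting `P` be the
difference of their two sides. -/
theorem linear_ode_eq_zero {ε : ℝ} {P M₁ M₂ : ℝ → Matrix (Fin 5) (Fin 5) ℂ}
    (hM₁ : ContinuousOn M₁ (Set.Ioo (-ε) ε)) (hM₂ : ContinuousOn M₂ (Set.Ioo (-ε) ε))
    (hP : ∀ v ∈ Set.Ioo (-ε) ε, HasDerivAt P (M₁ v * P v + P v * M₂ v) v) (h0 : P 0 = 0)
    {v : ℝ} (hv : v ∈ Set.Ioo (-ε) ε) : P v = 0 := by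
  obtain ⟨r, hr1, hr2⟩ := exists_between (abs_lt.2 hv)
  have hsub : Set.Icc (-r) r ⊆ Set.Ioo (-ε) ε := fun w hw =>
    ⟨by linarith [hw.1], by linarith [hw.2]⟩
  obtain ⟨C₁, hC₁⟩ := isCompact_Icc.exists_bound_of_continuousOn (hM₁.mono hsub)
  obtain ⟨C₂, hC₂⟩ := isCompact_Icc.exists_bound_of_continuousOn (hM₂.mono hsub)
  have hr0 : 0 < r := lt_of_le_of_lt (abs_nonneg v) hr1
  have hmem0 : (0 : ℝ) ∈ Set.Icc (-r) r := ⟨by linarith, hr0.le⟩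
  have hC₁0 : 0 ≤ C₁ := (norm_nonneg _).trans (hC₁ 0 hmem0)
  have hC₂0 : 0 ≤ C₂ := (norm_nonneg _).trans (hC₂ 0 hmem0)
  have hIoo : Set.Ioo (-r) r ⊆ Set.Icc (-r) r := Set.Ioo_subset_Icc_self
  refine ODE_solution_unique_of_mem_Ioo (K := ⟨C₁ + C₂, by positivity⟩) (s := fun _ => Set.univ)
    (v := fun t x => M₁ t * x + x * M₂ t) (g := fun _ => 0) (t₀ := 0) (a := -r) (b := r) ?_
    ⟨by linarith, hr0⟩ (fun t ht => ⟨hP t (hsub (hIoo ht)), trivial⟩)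
    (fun t ht => ⟨by simpa using hasDerivAt_const t (0 : Matrix (Fin 5) (Fin 5) ℂ), trivial⟩)
    h0 (abs_lt.1 hr1)
  intro t ht
  refine LipschitzOnWith.of_dist_le_mul fun x _ y _ => ?_
  rw [dist_eq_norm, dist_eq_norm]
  calc ‖M₁ t * x + x * M₂ t - (M₁ t * y + y * M₂ t)‖ = ‖M₁ t * (x - y) + (x - y) * M₂ t‖ := by
        congr 1; noncomm_ring
    _ ≤ ‖M₁ t‖ * ‖x - y‖ + ‖x - y‖ * ‖M₂ t‖ :=
        (norm_add_le _ _).trans (add_le_add (norm_mul_le _ _) (norm_mul_le _ _))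
    _ ≤ C₁ * ‖x - y‖ + ‖x - y‖ * C₂ := by
        gcongr
        · exact hC₁ t (hIoo ht)
        · exact hC₂ t (hIoo ht)
    _ = (C₁ + C₂) * ‖x - y‖ := by ring

theorem hasDerivAt_matrix_exp_ofReal (D : Matrix (Fin 5) (Fin 5) ℂ) (t : ℝ) :
    HasDerivAt (fun u : ℝ => NormedSpace.exp ((u : ℂ) • D)) (D * NormedSpace.exp ((t : ℂ) • D)) t := by
  simp only [Complex.coe_smul]
  exact hasDerivAt_exp_smul_const' (𝕂 := ℝ) D t

theorem HasDerivAt.matrix_map_conj {f : ℝ → Matrix (Fin 5) (Fin 5) ℂ}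
    {f' : Matrix (Fin 5) (Fin 5) ℂ} {t : ℝ} (h : HasDerivAt f f' t) :
    HasDerivAt (fun t => (f t).map (starRingEnd ℂ)) (f'.map (starRingEnd ℂ)) t := by
  rw [hasDerivAt_matrix_iff] at *
  exact fun i j => (Complex.conjCLE.toContinuousLinearMap.hasFDerivAt.comp_hasDerivAt t (h i j))

theorem HasDerivAt.lorentzAdjoint {f : ℝ → Matrix (Fin 5) (Fin 5) ℂ}
    {f' : Matrix (Fin 5) (Fin 5) ℂ} {t : ℝ} (h : HasDerivAt f f' t) :
    HasDerivAt (fun t => _root_.lorentzAdjoint (f t)) (_root_.lorentzAdjoint f') t := by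
  rw [hasDerivAt_matrix_iff] at *
  intro i j
  simp only [lorentzAdjoint_apply]
  exact (h j i).const_mul _

end

/-! ### Elementary properties of the matrix exponential -/

theorem lorentzAdjoint_mul {R : Type*} [CommRing R] (A B : Matrix (Fin 5) (Fin 5) R) :
    lorentzAdjoint (A * B) = lorentzAdjoint B * lorentzAdjoint A := by
  simp only [lorentzAdjoint, transpose_mul]
  calc _ = lorentzMetric R * Bᵀ * 1 * Aᵀ * lorentzMetric R := by
        simp only [mul_assoc, mul_one]
    _ = _ := by rw [← lorentzMetric_mul_self]; simp only [mul_assoc]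

theorem lorentzAdjoint_one {R : Type*} [CommRing R] :
    lorentzAdjoint (1 : Matrix (Fin 5) (Fin 5) R) = 1 := by
  rw [lorentzAdjoint, transpose_one, mul_one, lorentzMetric_mul_self]

theorem lorentzAdjoint_smul {R : Type*} [CommRing R] (a : R) (A : Matrix (Fin 5) (Fin 5) R) :
    lorentzAdjoint (a • A) = a • lorentzAdjoint A := by
  rw [lorentzAdjoint, lorentzAdjoint, transpose_smul, mul_smul_comm, smul_mul_assoc]

theorem orthogonal_of_lorentzAdjoint_mul_self {R : Type*} [CommRing R]
    {A : Matrix (Fin 5) (Fin 5) R} (h : lorentzAdjoint A * A = 1) :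
    Aᵀ * lorentzMetric R * A = lorentzMetric R := by
  have h1 := congrArg (lorentzMetric R * ·) h
  simp only [lorentzAdjoint, ← mul_assoc, lorentzMetric_mul_self, one_mul, mul_one] at h1
  exact h1

theorem lorentzAdjoint_exp (M : Matrix (Fin 5) (Fin 5) ℂ) :
    lorentzAdjoint (NormedSpace.exp M) = NormedSpace.exp (lorentzAdjoint M) := by
  have h : lorentzAdjoint M * lorentzMetric ℂ = lorentzMetric ℂ * Mᵀ := by
    rw [lorentzAdjoint, mul_assoc, lorentzMetric_mul_self, mul_one]
  have h1 := matrix_exp_mul_of_mul_eq h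
  rw [lorentzAdjoint, ← Matrix.exp_transpose, ← h1, mul_assoc, lorentzMetric_mul_self, mul_one]

theorem matrix_exp_neg_mul_self (M : Matrix (Fin 5) (Fin 5) ℂ) :
    NormedSpace.exp (-M) * NormedSpace.exp M = 1 := by
  rw [← Matrix.exp_add_of_commute _ _ (Commute.neg_left (Commute.refl M)), neg_add_cancel,
    NormedSpace.exp_zero]

theorem matrix_exp_add_smul (a b : ℂ) (D : Matrix (Fin 5) (Fin 5) ℂ) :
    NormedSpace.exp ((a + b) • D) = NormedSpace.exp (a • D) * NormedSpace.exp (b • D) := by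
  rw [add_smul]
  exact Matrix.exp_add_of_commute _ _ (((Commute.refl D).smul_left a).smul_right b)

theorem matrix_exp_commute (a : ℂ) (D : Matrix (Fin 5) (Fin 5) ℂ) :
    D * NormedSpace.exp (a • D) = NormedSpace.exp (a • D) * D :=
  (matrix_exp_mul_of_mul_eq (by rw [smul_mul_assoc, mul_smul_comm])).symm

theorem matrix_exp_map_conj (M : Matrix (Fin 5) (Fin 5) ℂ) :
    (NormedSpace.exp M).map (starRingEnd ℂ) = NormedSpace.exp (M.map (starRingEnd ℂ)) := by
  have h : ∀ A : Matrix (Fin 5) (Fin 5) ℂ, A.map (starRingEnd ℂ) = (Aᵀ)ᴴ := fun A => rfl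
  rw [h, h, Matrix.exp_conjTranspose, Matrix.exp_transpose]

theorem twist_exp (M : Matrix (Fin 5) (Fin 5) ℂ) :
    twist (NormedSpace.exp M) = NormedSpace.exp (twist M) := by
  have hS : (Matrix.diagonal ![1, 1, 1, 1, -1] : Matrix (Fin 5) (Fin 5) ℂ)
      * Matrix.diagonal ![1, 1, 1, 1, -1] = 1 := by
    rw [Matrix.diagonal_mul_diagonal, ← Matrix.diagonal_one]
    congr 1; funext i; fin_cases i <;> simp
  have h : twist M * Matrix.diagonal ![1, 1, 1, 1, -1]
      = Matrix.diagonal ![1, 1, 1, 1, -1] * M := by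
    rw [twist, mul_assoc, hS, mul_one]
  have h1 := matrix_exp_mul_of_mul_eq h
  rw [twist, ← h1, mul_assoc, hS, mul_one]

theorem orthogonal_exp {M : Matrix (Fin 5) (Fin 5) ℂ} (hM : lorentzAdjoint M = -M) :
    lorentzAdjoint (NormedSpace.exp M) * NormedSpace.exp M = 1 := by
  rw [lorentzAdjoint_exp, hM, matrix_exp_neg_mul_self]

/-! ### Connectedness arguments -/

theorem mem_SOPlus_of_isPreconnected {X : Type*} [TopologicalSpace X] {S : Set X}
    (hS : IsPreconnected S) {F : X → Matrix (Fin 5) (Fin 5) ℝ} (hF : ContinuousOn F S)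
    (hO : ∀ x ∈ S, (F x)ᵀ * lorentzMetric ℝ * F x = lorentzMetric ℝ) {x₀ : X} (hx₀ : x₀ ∈ S)
    (h0 : F x₀ = 1) {x : X} (hx : x ∈ S) : F x ∈ SOPlus := by
  refine ⟨hO x hx, ?_, ?_⟩
  · have hdet : Continuous fun A : Matrix (Fin 5) (Fin 5) ℝ => A.det := continuous_id.matrix_det
    have hd : ContinuousOn (fun x => (F x).det) S := hdet.comp_continuousOn hF
    refine hS.eq_of_sq_eq (f := fun x => (F x).det) (g := fun _ => 1) hd continuousOn_const
      (fun w hw => ?_) (fun _ => one_ne_zero) hx₀ (by simp [h0]) hx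
    have h1 := congrArg Matrix.det (hO w hw)
    rw [det_mul, det_mul, det_transpose] at h1
    have h2 : (lorentzMetric ℝ).det * (lorentzMetric ℝ).det = 1 := by
      rw [← det_mul, lorentzMetric_mul_self, det_one]
    simp only [Pi.pow_apply, one_pow]
    linear_combination (lorentzMetric ℝ).det * h1 + (1 - (F w).det ^ 2) * h2
  · have hc : ContinuousOn (fun x => F x 0 0) S :=
      (continuous_apply_apply 0 0).comp_continuousOn hF
    by_contra hneg
    have h1 := hS.intermediate_value hx hx₀ hc
    -- A sign change would make the time component vanish somewhere, although its square is at least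
    -- `1`.
    obtain ⟨w, hw, hw0⟩ := h1 (show (0 : ℝ) ∈ Set.Icc (F x 0 0) (F x₀ 0 0) from
      ⟨not_lt.1 hneg, by simp [h0]⟩)
    have h2 := sum_sq_first_row (hO w hw)
    simp only at hw0
    rw [hw0] at h2
    nlinarith [sq_nonneg (F w 0 1), sq_nonneg (F w 0 2), sq_nonneg (F w 0 3), sq_nonneg (F w 0 4)]

theorem det_eq_one_of_isPreconnected {S : Set ℝ} (hS : IsPreconnected S)
    {F : ℝ → Matrix (Fin 5) (Fin 5) ℂ} (hF : ContinuousOn F S)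
    (hO : ∀ x ∈ S, (F x)ᵀ * lorentzMetric ℂ * F x = lorentzMetric ℂ) {x₀ : ℝ} (hx₀ : x₀ ∈ S)
    (h0 : F x₀ = 1) {x : ℝ} (hx : x ∈ S) : (F x).det = 1 := by
  have hdet : Continuous fun A : Matrix (Fin 5) (Fin 5) ℂ => A.det := continuous_id.matrix_det
  have hd : ContinuousOn (fun x => (F x).det) S := hdet.comp_continuousOn hF
  refine hS.eq_of_sq_eq (f := fun x => (F x).det) (g := fun _ => 1) hd continuousOn_const
    (fun w hw => ?_) (fun _ => one_ne_zero) hx₀ (by simp [h0]) hx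
  have h1 := congrArg Matrix.det (hO w hw)
  rw [det_mul, det_mul, det_transpose] at h1
  have h2 : (lorentzMetric ℂ).det * (lorentzMetric ℂ).det = 1 := by
    rw [← det_mul, lorentzMetric_mul_self, det_one]
  simp only [Pi.pow_apply, one_pow]
  linear_combination (lorentzMetric ℂ).det * h1 + (1 - (F w).det ^ 2) * h2

/-! ### The Maurer–Cartan form of a translationally equivariant Willmore surface -/

/-- The `dz`-part of the Maurer–Cartan form. -/
def holForm (k β s ζ : ℂ) : Matrix (Fin 5) (Fin 5) ℂ :=
  frameForm quarterSqrtTwo Complex.I 1 (k * (starRingEnd ℂ) k) (ζ⁻¹ * k) (ζ⁻¹ * β) s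

/-- The `dz̄`-part of the Maurer–Cartan form. -/
def antiForm (k β s ζ : ℂ) : Matrix (Fin 5) (Fin 5) ℂ :=
  frameForm quarterSqrtTwo (-Complex.I) 1 (k * (starRingEnd ℂ) k) (ζ * (starRingEnd ℂ) k)
    (ζ * (starRingEnd ℂ) β) ((starRingEnd ℂ) s)

/-- The `du`-part of the Maurer–Cartan form. -/
def uForm (k β s ζ : ℂ) : Matrix (Fin 5) (Fin 5) ℂ := holForm k β s ζ + antiForm k β s ζ

/-- The `dv`-part of the Maurer–Cartan form. -/
def wForm (k β s ζ : ℂ) : Matrix (Fin 5) (Fin 5) ℂ :=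
  Complex.I • (holForm k β s ζ - antiForm k β s ζ)

theorem holForm_map_conj (k β s : ℂ) {ζ : ℂ} (hζ : ‖ζ‖ = 1) :
    (holForm k β s ζ).map (starRingEnd ℂ) = antiForm k β s ζ := by
  have h : (starRingEnd ℂ) ζ⁻¹ = ζ := by rw [Complex.inv_eq_conj hζ, Complex.conj_conj]
  rw [holForm, frameForm_map, antiForm]
  simp only [conj_quarterSqrtTwo, Complex.conj_I, map_mul, map_one, h, Complex.conj_conj]
  rw [mul_comm ((starRingEnd ℂ) k) k]

theorem antiForm_map_conj (k β s : ℂ) {ζ : ℂ} (hζ : ‖ζ‖ = 1) :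
    (antiForm k β s ζ).map (starRingEnd ℂ) = holForm k β s ζ := by
  rw [← holForm_map_conj k β s hζ]
  ext i j
  simp

theorem uForm_map_conj (k β s : ℂ) {ζ : ℂ} (hζ : ‖ζ‖ = 1) :
    (uForm k β s ζ).map (starRingEnd ℂ) = uForm k β s ζ := by
  rw [uForm, Matrix.map_add _ (map_add _), holForm_map_conj k β s hζ, antiForm_map_conj k β s hζ,
    add_comm]

theorem wForm_map_conj (k β s : ℂ) {ζ : ℂ} (hζ : ‖ζ‖ = 1) :
    (wForm k β s ζ).map (starRingEnd ℂ) = wForm k β s ζ := by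
  have h1 := holForm_map_conj k β s hζ
  have h2 := antiForm_map_conj k β s hζ
  ext i j
  have h1' := congrFun (congrFun h1 i) j
  have h2' := congrFun (congrFun h2 i) j
  simp only [Matrix.map_apply] at h1' h2'
  simp only [wForm, Matrix.map_apply, Matrix.smul_apply, Matrix.sub_apply, smul_eq_mul, map_mul,
    map_sub, Complex.conj_I, h1', h2']
  ring

theorem lorentzAdjoint_holForm (k β s ζ : ℂ) :
    lorentzAdjoint (holForm k β s ζ) = -holForm k β s ζ := lorentzAdjoint_frameForm ..

theorem lorentzAdjoint_antiForm (k β s ζ : ℂ) :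
    lorentzAdjoint (antiForm k β s ζ) = -antiForm k β s ζ := lorentzAdjoint_frameForm ..

theorem lorentzAdjoint_uForm (k β s ζ : ℂ) :
    lorentzAdjoint (uForm k β s ζ) = -uForm k β s ζ := by
  have h1 := lorentzAdjoint_holForm k β s ζ
  have h2 := lorentzAdjoint_antiForm k β s ζ
  simp only [lorentzAdjoint] at *
  rw [uForm, transpose_add, mul_add, add_mul, h1, h2]
  abel

theorem twist_antiForm (k β s ζ : ℂ) : twist (antiForm k β s ζ) = antiForm k β s (-ζ) := by
  rw [antiForm, twist_frameForm, antiForm, neg_mul, neg_mul]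

theorem twist_uForm (k β s ζ : ℂ) : twist (uForm k β s ζ) = uForm k β s (-ζ) := by
  have h1 : twist (holForm k β s ζ) = holForm k β s (-ζ) := by
    rw [holForm, twist_frameForm, holForm, inv_neg, neg_mul, neg_mul]
  have h2 := twist_antiForm k β s ζ
  simp only [twist] at *
  rw [uForm, mul_add, add_mul, h1, h2, uForm]

/-- `k`, `β`, `s` satisfy the structure equations on `(-ε, ε)`. -/
structure IsStructureSolution (ε : ℝ) (k β s : ℝ → ℂ) : Prop where
  hk : ∀ v ∈ Set.Ioo (-ε) ε, HasDerivAt k (-2 * Complex.I * β v) v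
  hβ : ∀ v ∈ Set.Ioo (-ε) ε, HasDerivAt β (Complex.I * k v * (starRingEnd ℂ) (s v)) v
  hs : ∀ v ∈ Set.Ioo (-ε) ε, HasDerivAt s (4 * Complex.I * (starRingEnd ℂ) (k v) * β v
    - 12 * Complex.I * (starRingEnd ℂ) (β v) * k v) v

theorem HasDerivAt.complex_conj {f : ℝ → ℂ} {f' : ℂ} {t : ℝ} (h : HasDerivAt f f' t) :
    HasDerivAt (fun t => (starRingEnd ℂ) (f t)) ((starRingEnd ℂ) f') t :=
  Complex.conjCLE.toContinuousLinearMap.hasFDerivAt.comp_hasDerivAt t h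

theorem frameForm_eq_sum (q i o κ k β s : ℂ) : frameForm q i o κ k β s
    = o • frameForm q i 1 0 0 0 0 + κ • frameForm q i 0 1 0 0 0 + k • frameForm q i 0 0 1 0 0
      + β • frameForm q i 0 0 0 1 0 + s • frameForm q i 0 0 0 0 1 := by
  ext a b
  fin_cases a <;> fin_cases b <;> simp [frameForm] <;> ring

section
open scoped Matrix.Norms.Operator

theorem HasDerivAt.frameForm {q i : ℂ} {κ k β s : ℝ → ℂ} {κ' k' β' s' : ℂ} {t : ℝ}
    (hκ : HasDerivAt κ κ' t) (hk : HasDerivAt k k' t) (hβ : HasDerivAt β β' t)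
    (hs : HasDerivAt s s' t) :
    HasDerivAt (fun t => _root_.frameForm q i 1 (κ t) (k t) (β t) (s t))
      (_root_.frameForm q i 0 κ' k' β' s') t := by
  simp only [fun t => frameForm_eq_sum q i 1 (κ t) (k t) (β t) (s t),
    frameForm_eq_sum q i 0 κ' k' β' s']
  refine (((HasDerivAt.fun_add ?_ ?_).fun_add ?_).fun_add ?_).fun_add ?_
  · rw [zero_smul]; exact hasDerivAt_const _ _
  · exact hκ.smul_const _
  · exact hk.smul_const _
  · exact hβ.smul_const _
  · exact hs.smul_const _

theorem plus_orthogonal {ε : ℝ} {k β s : ℝ → ℂ} {ζ : ℂ} {V : ℝ → Matrix (Fin 5) (Fin 5) ℂ} (hV0 : V 0 = 1)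
    (hV : ∀ v ∈ Set.Ioo (-ε) ε,
      HasDerivAt V ((2 * Complex.I) • antiForm (k v) (β v) (s v) ζ * V v) v)
    {v : ℝ} (hv : v ∈ Set.Ioo (-ε) ε) : lorentzAdjoint (V v) * V v = 1 := by
  have key : (fun v => lorentzAdjoint (V v) * V v - 1) v = 0 := by
    refine linear_ode_eq_zero (ε := ε) (M₁ := fun _ => 0) (M₂ := fun _ => 0)
      (P := fun v => lorentzAdjoint (V v) * V v - 1) continuousOn_const continuousOn_const
      (fun w hw => ?_) (by simp [hV0, lorentzAdjoint_one]) hv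
    refine (((hV w hw).lorentzAdjoint.fun_mul (hV w hw)).sub_const 1).congr_deriv ?_
    rw [lorentzAdjoint_mul, lorentzAdjoint_smul, lorentzAdjoint_antiForm]
    simp only [smul_neg, mul_neg, neg_mul, mul_assoc, zero_mul, mul_zero, add_zero]
    abel
  exact sub_eq_zero.1 key

namespace IsStructureSolution

variable {ε : ℝ} {k β s : ℝ → ℂ} (h : IsStructureSolution ε k β s)
include h

theorem hasDerivAt_holForm (ζ : ℂ) {v : ℝ} (hv : v ∈ Set.Ioo (-ε) ε) :
    HasDerivAt (fun v => holForm (k v) (β v) (s v) ζ)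
      (frameForm quarterSqrtTwo Complex.I 0
        (-2 * Complex.I * β v * (starRingEnd ℂ) (k v)
          + k v * (2 * Complex.I * (starRingEnd ℂ) (β v)))
        (ζ⁻¹ * (-2 * Complex.I * β v)) (ζ⁻¹ * (Complex.I * k v * (starRingEnd ℂ) (s v)))
        (4 * Complex.I * (starRingEnd ℂ) (k v) * β v
          - 12 * Complex.I * (starRingEnd ℂ) (β v) * k v)) v := by
  have hK := (h.hk v hv).complex_conj
  have hκ := (h.hk v hv).fun_mul hK
  refine HasDerivAt.frameForm (hκ.congr_deriv ?_) ((h.hk v hv).const_mul _)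
    ((h.hβ v hv).const_mul _) (h.hs v hv)
  simp [map_ofNat]

theorem hasDerivAt_antiForm (ζ : ℂ) {v : ℝ} (hv : v ∈ Set.Ioo (-ε) ε) :
    HasDerivAt (fun v => antiForm (k v) (β v) (s v) ζ)
      (frameForm quarterSqrtTwo (-Complex.I) 0
        (-2 * Complex.I * β v * (starRingEnd ℂ) (k v)
          + k v * (2 * Complex.I * (starRingEnd ℂ) (β v)))
        (ζ * (2 * Complex.I * (starRingEnd ℂ) (β v)))
        (ζ * (-Complex.I * (starRingEnd ℂ) (k v) * s v))
        (12 * Complex.I * (starRingEnd ℂ) (k v) * β v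
          - 4 * Complex.I * (starRingEnd ℂ) (β v) * k v)) v := by
  have hK := (h.hk v hv).complex_conj
  have hb := (h.hβ v hv).complex_conj
  have hσ := (h.hs v hv).complex_conj
  have hκ := (h.hk v hv).fun_mul hK
  refine HasDerivAt.frameForm (hκ.congr_deriv ?_) ((hK.const_mul _).congr_deriv ?_)
    ((hb.const_mul _).congr_deriv ?_) (hσ.congr_deriv ?_)
  · simp [map_ofNat]
  · simp [map_ofNat]
  · simp
  · simp [map_ofNat]; ring

theorem continuousOn_antiForm (ζ : ℂ) :
    ContinuousOn (fun v => antiForm (k v) (β v) (s v) ζ) (Set.Ioo (-ε) ε) :=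
  fun _ hv => (h.hasDerivAt_antiForm ζ hv).continuousAt.continuousWithinAt

theorem continuousOn_holForm (ζ : ℂ) :
    ContinuousOn (fun v => holForm (k v) (β v) (s v) ζ) (Set.Ioo (-ε) ε) :=
  fun _ hv => (h.hasDerivAt_holForm ζ hv).continuousAt.continuousWithinAt

theorem continuousOn_uForm (ζ : ℂ) :
    ContinuousOn (fun v => uForm (k v) (β v) (s v) ζ) (Set.Ioo (-ε) ε) :=
  (h.continuousOn_holForm ζ).add (h.continuousOn_antiForm ζ)

theorem continuousOn_wForm (ζ : ℂ) :
    ContinuousOn (fun v => wForm (k v) (β v) (s v) ζ) (Set.Ioo (-ε) ε) :=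
  ((h.continuousOn_holForm ζ).sub (h.continuousOn_antiForm ζ)).const_smul Complex.I

/-- The Lax equation, that is, zero curvature of a form whose coefficients depend on `v` only.
`frameForm_bracket` is applied to `ζ⁻¹k`, `ζ⁻¹β` and `ζk̄`, `ζβ̄`: the powers of `ζ` cancel in the
products of barred and unbarred terms, so flatness holds for all `ζ` at once. -/
theorem hasDerivAt_uForm {ζ : ℂ} (hζ : ζ ≠ 0) {v : ℝ} (hv : v ∈ Set.Ioo (-ε) ε) :
    HasDerivAt (fun v => uForm (k v) (β v) (s v) ζ)
      (uForm (k v) (β v) (s v) ζ * wForm (k v) (β v) (s v) ζ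
        - wForm (k v) (β v) (s v) ζ * uForm (k v) (β v) (s v) ζ) v := by
  refine ((h.hasDerivAt_holForm ζ hv).add (h.hasDerivAt_antiForm ζ hv)).congr_deriv ?_
  have hb := frameForm_bracket (q := quarterSqrtTwo) (i := Complex.I) (k := ζ⁻¹ * k v)
    (K := ζ * (starRingEnd ℂ) (k v)) (β := ζ⁻¹ * β v) (b := ζ * (starRingEnd ℂ) (β v)) (s := s v)
    (σ := (starRingEnd ℂ) (s v)) quarterSqrtTwo_sq Complex.I_sq
  have hz : ζ⁻¹ * ζ = 1 := inv_mul_cancel₀ hζ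
  have e1 : ζ⁻¹ * k v * (ζ * (starRingEnd ℂ) (k v)) = k v * (starRingEnd ℂ) (k v) := by
    linear_combination (k v * (starRingEnd ℂ) (k v)) * hz
  have e2 : -2 * Complex.I * (ζ⁻¹ * β v) * (ζ * (starRingEnd ℂ) (k v))
        + ζ⁻¹ * k v * (2 * Complex.I * (ζ * (starRingEnd ℂ) (β v)))
      = -2 * Complex.I * β v * (starRingEnd ℂ) (k v)
        + k v * (2 * Complex.I * (starRingEnd ℂ) (β v)) := by
    linear_combination (-2 * Complex.I * β v * (starRingEnd ℂ) (k v)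
        + k v * (2 * Complex.I * (starRingEnd ℂ) (β v))) * hz
  have e3 : ∀ a b : ℂ, a * Complex.I * (ζ * (starRingEnd ℂ) (k v)) * (ζ⁻¹ * β v)
        - b * Complex.I * (ζ * (starRingEnd ℂ) (β v)) * (ζ⁻¹ * k v)
      = a * Complex.I * (starRingEnd ℂ) (k v) * β v
        - b * Complex.I * (starRingEnd ℂ) (β v) * k v := fun a b => by
    linear_combination (a * Complex.I * (starRingEnd ℂ) (k v) * β v
        - b * Complex.I * (starRingEnd ℂ) (β v) * k v) * hz
  rw [e1, e2, e3, e3] at hb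
  have e4 : -2 * Complex.I * (ζ⁻¹ * β v) = ζ⁻¹ * (-2 * Complex.I * β v) := by ring
  have e5 : Complex.I * (ζ⁻¹ * k v) * (starRingEnd ℂ) (s v)
      = ζ⁻¹ * (Complex.I * k v * (starRingEnd ℂ) (s v)) := by ring
  have e6 : 2 * Complex.I * (ζ * (starRingEnd ℂ) (β v))
      = ζ * (2 * Complex.I * (starRingEnd ℂ) (β v)) := by ring
  have e7 : -Complex.I * (ζ * (starRingEnd ℂ) (k v)) * s v
      = ζ * (-Complex.I * (starRingEnd ℂ) (k v) * s v) := by ring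
  rw [e4, e5, e6, e7] at hb
  rw [← hb]
  change (-2 * Complex.I) • (holForm (k v) (β v) (s v) ζ * antiForm (k v) (β v) (s v) ζ
    - antiForm (k v) (β v) (s v) ζ * holForm (k v) (β v) (s v) ζ) = _
  rw [uForm, wForm, mul_smul_comm, smul_mul_assoc, ← smul_sub]
  generalize holForm (k v) (β v) (s v) ζ = A
  generalize antiForm (k v) (β v) (s v) ζ = B
  have : (A + B) * (A - B) - (A - B) * (A + B) = (-2 : ℂ) • (A * B - B * A) := by
    simp only [add_mul, mul_sub, sub_mul, mul_add]
    module
  rw [this, smul_smul]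
  congr 1
  ring

/-! ### The real frame -/

theorem real_frame {ζ : ℂ} (hζ : ‖ζ‖ = 1) {V : ℝ → Matrix (Fin 5) (Fin 5) ℂ}
    (hV0 : V 0 = 1)
    (hV : ∀ v ∈ Set.Ioo (-ε) ε,
      HasDerivAt V ((2 * Complex.I) • antiForm (k v) (β v) (s v) ζ * V v) v)
    {F : ℝ → Matrix (Fin 5) (Fin 5) ℂ}
    (hF : ∀ v, F v = NormedSpace.exp (((v : ℂ) * Complex.I) • uForm (k 0) (β 0) (s 0) ζ)
      * lorentzAdjoint (V v)) {v : ℝ} (hv : v ∈ Set.Ioo (-ε) ε) :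
    uForm (k 0) (β 0) (s 0) ζ * F v = F v * uForm (k v) (β v) (s v) ζ ∧
      HasDerivAt F (F v * wForm (k v) (β v) (s v) ζ) v ∧ (F v).map (starRingEnd ℂ) = F v := by
  have hζ0 : ζ ≠ 0 := fun h0 => by simp [h0] at hζ
  set D := uForm (k 0) (β 0) (s 0) ζ with hD
  set U : ℝ → Matrix (Fin 5) (Fin 5) ℂ := fun v => uForm (k v) (β v) (s v) ζ with hU
  set W : ℝ → Matrix (Fin 5) (Fin 5) ℂ := fun v => wForm (k v) (β v) (s v) ζ with hW
  have hF0 : F 0 = 1 := by rw [hF, hV0, lorentzAdjoint_one]; simp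
  have hFd : ∀ w ∈ Set.Ioo (-ε) ε, HasDerivAt F
      (Complex.I • (D * F w) - Complex.I • (F w * U w) + F w * W w) w := fun w hw => by
    have h1 := hasDerivAt_matrix_exp_ofReal (Complex.I • D) w
    simp only [smul_smul] at h1
    have h2 := h1.fun_mul (hV w hw).lorentzAdjoint
    rw [funext hF]
    refine h2.congr_deriv ?_
    rw [lorentzAdjoint_mul, lorentzAdjoint_smul, lorentzAdjoint_antiForm]
    simp only [hU, hW, uForm, wForm]
    simp only [smul_mul_assoc, mul_assoc, mul_smul_comm, mul_add, mul_sub, smul_neg, mul_neg]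
    module
  -- By the Lax equation this difference satisfies a homogeneous linear ODE, and it vanishes at `0`,
  -- where `F = 1` and `U = D`.
  have hP : ∀ w ∈ Set.Ioo (-ε) ε, D * F w - F w * U w = 0 := fun w hw => by
    refine linear_ode_eq_zero (ε := ε) (M₁ := fun _ => Complex.I • D)
      (M₂ := fun w => W w - Complex.I • U w) (P := fun w => D * F w - F w * U w)
      continuousOn_const
      ((h.continuousOn_wForm ζ).sub ((h.continuousOn_uForm ζ).const_smul Complex.I))
      (fun x hx => ?_) ?_ hw
    · refine (((hFd x hx).const_mul D).sub
        ((hFd x hx).mul (h.hasDerivAt_uForm hζ0 hx))).congr_deriv ?_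
      change D * (Complex.I • (D * F x) - Complex.I • (F x * U x) + F x * W x)
        - ((Complex.I • (D * F x) - Complex.I • (F x * U x) + F x * W x) * U x
          + F x * (U x * W x - W x * U x)) = _
      simp only [mul_add, mul_sub, add_mul, sub_mul, smul_mul_assoc, mul_smul_comm, mul_assoc,
        smul_sub]
      module
    · simp [hF0, hU, hD]
  have hFW : ∀ w ∈ Set.Ioo (-ε) ε, HasDerivAt F (F w * W w) w := fun w hw => by
    refine (hFd w hw).congr_deriv ?_
    rw [← smul_sub, hP w hw, smul_zero, zero_add]
  refine ⟨sub_eq_zero.1 (hP v hv), hFW v hv, ?_⟩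
  -- Since `W` is real, the conjugate of `F` solves the same initial value problem `F' = F W`, `F(0)
  -- = 1`.
  refine sub_eq_zero.1 (linear_ode_eq_zero (ε := ε) (M₁ := fun _ => 0) (M₂ := W)
    (P := fun w => (F w).map (starRingEnd ℂ) - F w) continuousOn_const (h.continuousOn_wForm ζ)
    (fun w hw => ?_) ?_ hv)
  · refine ((hFW w hw).matrix_map_conj.sub (hFW w hw)).congr_deriv ?_
    rw [Matrix.map_mul, wForm_map_conj _ _ _ hζ, sub_mul, zero_mul, zero_add]
  · ext i j
    by_cases hij : i = j <;> simp [hF0, hij]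

theorem plus_twisted {ζ : ℂ} {V V' : ℝ → Matrix (Fin 5) (Fin 5) ℂ} (hV0 : V 0 = 1) (hV'0 : V' 0 = 1)
    (hV : ∀ v ∈ Set.Ioo (-ε) ε,
      HasDerivAt V ((2 * Complex.I) • antiForm (k v) (β v) (s v) ζ * V v) v)
    (hV' : ∀ v ∈ Set.Ioo (-ε) ε,
      HasDerivAt V' ((2 * Complex.I) • antiForm (k v) (β v) (s v) (-ζ) * V' v) v)
    {v : ℝ} (hv : v ∈ Set.Ioo (-ε) ε) : V' v = twist (V v) := by
  refine sub_eq_zero.1 (linear_ode_eq_zero (ε := ε)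
    (M₁ := fun w => (2 * Complex.I) • antiForm (k w) (β w) (s w) (-ζ)) (M₂ := fun _ => 0)
    (P := fun w => V' w - twist (V w)) ((h.continuousOn_antiForm (-ζ)).const_smul (2 * Complex.I))
    continuousOn_const (fun w hw => ?_) ?_ hv)
  · have h1 : HasDerivAt (fun w => twist (V w))
        (twist ((2 * Complex.I) • antiForm (k w) (β w) (s w) ζ * V w)) w :=
      ((hV w hw).const_mul _).mul_const _
    refine ((hV' w hw).sub h1).congr_deriv ?_
    have h2 : twist ((2 * Complex.I) • antiForm (k w) (β w) (s w) ζ)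
        = (2 * Complex.I) • antiForm (k w) (β w) (s w) (-ζ) := by
      rw [← twist_antiForm, twist, twist, mul_smul_comm, smul_mul_assoc]
    rw [twist_mul, h2, mul_sub, mul_zero, add_zero]
  · ext i j
    simp only [hV0, hV'0, Matrix.sub_apply, twist_apply]
    fin_cases i <;> fin_cases j <;> simp

end IsStructureSolution
end

/-! ### From frames to Willmore surfaces -/

/-- The `du`-part of the Maurer–Cartan form, as a real matrix. -/
def realU (k β s : ℂ) : Matrix (Fin 5) (Fin 5) ℝ :=
  !![0, 0, √2 / 2 * (1 - s.re - 2 * (k.re ^ 2 + k.im ^ 2)), √2 / 2 * s.im, 2 * √2 * β.re;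
     0, 0, √2 / 2 * (1 + s.re + 2 * (k.re ^ 2 + k.im ^ 2)), -(√2 / 2 * s.im), -(2 * √2 * β.re);
     √2 / 2 * (1 - s.re - 2 * (k.re ^ 2 + k.im ^ 2)),
       -(√2 / 2 * (1 + s.re + 2 * (k.re ^ 2 + k.im ^ 2))), 0, 0, -(2 * k.re);
     √2 / 2 * s.im, √2 / 2 * s.im, 0, 0, 2 * k.im;
     2 * √2 * β.re, 2 * √2 * β.re, 2 * k.re, -(2 * k.im), 0]

/-- The `dv`-part of the Maurer–Cartan form, as a real matrix. -/
def realW (k β s : ℂ) : Matrix (Fin 5) (Fin 5) ℝ :=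
  !![0, 0, √2 / 2 * s.im, √2 / 2 * (1 + s.re - 2 * (k.re ^ 2 + k.im ^ 2)), -(2 * √2 * β.im);
     0, 0, -(√2 / 2 * s.im), √2 / 2 * (1 - s.re + 2 * (k.re ^ 2 + k.im ^ 2)), 2 * √2 * β.im;
     √2 / 2 * s.im, √2 / 2 * s.im, 0, 0, 2 * k.im;
     √2 / 2 * (1 + s.re - 2 * (k.re ^ 2 + k.im ^ 2)),
       -(√2 / 2 * (1 - s.re + 2 * (k.re ^ 2 + k.im ^ 2))), 0, 0, 2 * k.re;
     -(2 * √2 * β.im), -(2 * √2 * β.im), -(2 * k.im), -(2 * k.re), 0]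

theorem col_sub_col_realU (k β s : ℂ) :
    (√2)⁻¹ • ((realU k β s).col 0 - (realU k β s).col 1) = Pi.single 2 1 := by
  have hs2 : √2 * √2 = 2 := Real.mul_self_sqrt (by norm_num)
  have hs0 : √2 ≠ 0 := by positivity
  ext i
  fin_cases i <;> simp [realU]
  field_simp; linarith

theorem col_sub_col_realW (k β s : ℂ) :
    (√2)⁻¹ • ((realW k β s).col 0 - (realW k β s).col 1) = Pi.single 3 1 := by
  have hs2 : √2 * √2 = 2 := Real.mul_self_sqrt (by norm_num)
  have hs0 : √2 ≠ 0 := by positivity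
  ext i
  fin_cases i <;> simp [realW]
  field_simp; linarith

theorem mul_conj_phase (k : ℂ) {ζ : ℂ} (hζ : ‖ζ‖ = 1) :
    k * (starRingEnd ℂ) k = (((ζ⁻¹ * k).re ^ 2 + (ζ⁻¹ * k).im ^ 2 : ℝ) : ℂ) := by
  have h : (((ζ⁻¹ * k).re ^ 2 + (ζ⁻¹ * k).im ^ 2 : ℝ) : ℂ)
      = (ζ⁻¹ * k) * (starRingEnd ℂ) (ζ⁻¹ * k) := by
    rw [Complex.mul_conj, Complex.normSq_apply]; push_cast; ring
  have hz : ζ⁻¹ * (starRingEnd ℂ) ζ⁻¹ = 1 := by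
    rw [Complex.mul_conj, Complex.normSq_inv, Complex.normSq_eq_norm_sq, hζ]; norm_num
  rw [h, map_mul]
  linear_combination (-(k * (starRingEnd ℂ) k)) * hz

theorem uForm_eq_map (k β s : ℂ) {ζ : ℂ} (hζ : ‖ζ‖ = 1) :
    uForm k β s ζ = (realU (ζ⁻¹ * k) (ζ⁻¹ * β) s).map (fun x : ℝ => (x : ℂ)) := by
  rw [uForm, ← holForm_map_conj k β s hζ, holForm, mul_conj_phase k hζ]
  generalize ζ⁻¹ * k = k'
  generalize ζ⁻¹ * β = β'
  have hq : quarterSqrtTwo = ((√2 / 4 : ℝ) : ℂ) := by simp [quarterSqrtTwo]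
  have h4 : √2 = 4 * (√2 / 4) := by ring
  rw [hq, realU, h4]
  simp only [show 4 * (√2 / 4) / 4 = √2 / 4 by ring]
  generalize √2 / 4 = q
  generalize k'.re ^ 2 + k'.im ^ 2 = r
  ext i j
  fin_cases i <;> fin_cases j <;> apply Complex.ext <;> simp [frameForm] <;> ring

theorem wForm_eq_map (k β s : ℂ) {ζ : ℂ} (hζ : ‖ζ‖ = 1) :
    wForm k β s ζ = (realW (ζ⁻¹ * k) (ζ⁻¹ * β) s).map (fun x : ℝ => (x : ℂ)) := by
  rw [wForm, ← holForm_map_conj k β s hζ, holForm, mul_conj_phase k hζ]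
  generalize ζ⁻¹ * k = k'
  generalize ζ⁻¹ * β = β'
  have hq : quarterSqrtTwo = ((√2 / 4 : ℝ) : ℂ) := by simp [quarterSqrtTwo]
  have h4 : √2 = 4 * (√2 / 4) := by ring
  rw [hq, realW, h4]
  simp only [show 4 * (√2 / 4) / 4 = √2 / 4 by ring]
  generalize √2 / 4 = q
  generalize k'.re ^ 2 + k'.im ^ 2 = r
  ext i j
  fin_cases i <;> fin_cases j <;> apply Complex.ext <;> simp [frameForm] <;> ring

/-- The associated family acts by rotating `k` and `β` and keeping `s`. Each member can thus be
treated like the member at `1`. -/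
theorem IsStructureSolution.phase {ε : ℝ} {k β s : ℝ → ℂ} (h : IsStructureSolution ε k β s)
    {ζ : ℂ} (hζ : ‖ζ‖ = 1) :
    IsStructureSolution ε (fun v => ζ⁻¹ * k v) (fun v => ζ⁻¹ * β v) s where
  hk v hv := ((h.hk v hv).const_mul _).congr_deriv (by ring)
  hβ v hv := ((h.hβ v hv).const_mul _).congr_deriv (by ring)
  hs v hv := (h.hs v hv).congr_deriv (by
    have hz : ζ⁻¹ * (starRingEnd ℂ) ζ⁻¹ = 1 := by
      rw [Complex.mul_conj, Complex.normSq_inv, Complex.normSq_eq_norm_sq, hζ]; norm_num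
    rw [map_mul, map_mul]
    linear_combination (-(4 * Complex.I * (starRingEnd ℂ) (k v) * β v
      - 12 * Complex.I * (starRingEnd ℂ) (β v) * k v)) * hz)

theorem HasLineDerivAt.mulVec {F : ℂ → Matrix (Fin 5) (Fin 5) ℝ} {M : Matrix (Fin 5) (Fin 5) ℝ}
    {c : ℂ → Fin 5 → ℝ} {c' : Fin 5 → ℝ} {z e : ℂ}
    (hF : ∀ j, HasLineDerivAt ℝ (fun w => (F w).col j) (F z *ᵥ M.col j) z e)
    (hc : HasLineDerivAt ℝ c c' z e) :
    HasLineDerivAt ℝ (fun w => F w *ᵥ c w) (F z *ᵥ (M *ᵥ c z + c')) z e := by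
  have h1 : ∀ (A : Matrix (Fin 5) (Fin 5) ℝ) (x : Fin 5 → ℝ), A *ᵥ x = ∑ j, x j • A.col j := by
    intro A x
    ext i
    simp [Matrix.mulVec, dotProduct, mul_comm]
  unfold HasLineDerivAt at *
  have h2 := HasDerivAt.fun_sum (u := Finset.univ) fun j _ =>
    (hasDerivAt_pi.1 hc j).fun_smul (hF j)
  simp only [zero_smul, add_zero] at h2
  simp only [h1 (F _)]
  refine h2.congr_deriv ?_
  rw [Finset.sum_add_distrib]
  simp only [← h1, ← mulVec_smul]
  rw [← Matrix.mulVec_sum, ← h1, ← mulVec_add]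

/-- The light-like vector field of a frame. -/
def frameLift (F : ℂ → Matrix (Fin 5) (Fin 5) ℝ) (z : ℂ) : Fin 5 → ℝ :=
  (√2)⁻¹ • ((F z).col 0 - (F z).col 1)

/-- The surface in `S³` of a frame. -/
def frameSurface (F : ℂ → Matrix (Fin 5) (Fin 5) ℝ) (z : ℂ) : EuclideanSpace ℝ (Fin 4) :=
  WithLp.toLp 2 fun i => frameLift F z i.succ / frameLift F z 0

/-- The first row of `F z` is time-like with positive time component, so `F₀₁ < F₀₀`. -/
theorem frameLift_pos {F : ℂ → Matrix (Fin 5) (Fin 5) ℝ} {z : ℂ} (hF : F z ∈ SOPlus) :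
    0 < frameLift F z 0 := by
  have h := sum_sq_first_row hF.1
  have h2 : (F z 0 1) ^ 2 < F z 0 0 ^ 2 := by
    nlinarith [sq_nonneg (F z 0 2), sq_nonneg (F z 0 3), sq_nonneg (F z 0 4)]
  have h3 := (abs_lt.1 (abs_lt_of_sq_lt_sq h2 hF.2.2.le)).2
  simp only [frameLift, Pi.smul_apply, Pi.sub_apply, Matrix.col_apply, smul_eq_mul]
  have : 0 < F z 0 0 - F z 0 1 := by linarith
  positivity

theorem frameLift_eq_smul {F : ℂ → Matrix (Fin 5) (Fin 5) ℝ} {z : ℂ} (hF : F z ∈ SOPlus) :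
    frameLift F z = frameLift F z 0 • lightVector (frameSurface F z) := by
  have h := (frameLift_pos hF).ne'
  ext i
  fin_cases i <;> simp [lightVector, frameSurface, mul_div_cancel₀ _ h]

theorem norm_frameSurface {F : ℂ → Matrix (Fin 5) (Fin 5) ℝ} {z : ℂ} (hF : F z ∈ SOPlus) :
    ‖frameSurface F z‖ = 1 := by
  have h0 := frameLift_pos hF
  have h1 : lorentzInner (frameLift F z) (frameLift F z) = 0 := by
    have e00 := lorentzInner_col hF.1 0 0
    have e01 := lorentzInner_col hF.1 0 1
    have e11 := lorentzInner_col hF.1 1 1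
    simp only [lorentzInner_eq, Matrix.col_apply, lorentzMetric] at e00 e01 e11
    simp at e00 e01 e11
    simp only [lorentzInner_eq, frameLift, Pi.smul_apply, Pi.sub_apply, Matrix.col_apply,
      smul_eq_mul]
    linear_combination (√2)⁻¹ ^ 2 * (e00 - 2 * e01 + e11)
  have h2 : lorentzInner (frameLift F z) (frameLift F z) = frameLift F z 0 ^ 2 *
      lorentzInner (lightVector (frameSurface F z)) (lightVector (frameSurface F z)) := by
    conv_lhs => rw [frameLift_eq_smul hF]
    simp only [lorentzInner_eq, Pi.smul_apply, smul_eq_mul]; ring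
  rw [h1, lorentzInner_lightVector] at h2
  have h3 : ‖frameSurface F z‖ ^ 2 = 1 := by
    have := (mul_eq_zero.1 h2.symm).resolve_left (by positivity)
    linarith
  nlinarith [norm_nonneg (frameSurface F z)]

theorem lightVector_equivariant {F : ℂ → Matrix (Fin 5) (Fin 5) ℝ} {z w : ℂ} (hz : F z ∈ SOPlus)
    (hw : F w ∈ SOPlus) {R : Matrix (Fin 5) (Fin 5) ℝ} (h : F w = R * F z) :
    ∃ ρ : ℝ, 0 < ρ ∧
      R *ᵥ lightVector (frameSurface F z) = ρ • lightVector (frameSurface F w) := by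
  have h1 : frameLift F w = R *ᵥ frameLift F z := by
    have hcol : ∀ j, (R * F z).col j = R *ᵥ (F z).col j := fun j => by
      rw [← Matrix.mulVec_single_one, ← Matrix.mulVec_single_one, mulVec_mulVec]
    rw [frameLift, h, hcol, hcol, ← mulVec_sub, ← mulVec_smul, frameLift]
  rw [frameLift_eq_smul hz, frameLift_eq_smul hw, mulVec_smul] at h1
  have h0 := frameLift_pos hz
  refine ⟨(frameLift F z 0)⁻¹ * frameLift F w 0, mul_pos (inv_pos.2 h0) (frameLift_pos hw), ?_⟩
  rw [mul_smul, h1, smul_smul, inv_mul_cancel₀ h0.ne', one_smul]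

section

variable {S : Set ℂ} {ε : ℝ} {k β s : ℝ → ℂ} {F : ℂ → Matrix (Fin 5) (Fin 5) ℝ}

/-- The forms are shaped so that the null lift has derivatives equal to columns 2 and 3 of `F`.
These are orthonormal, so `y` is conformal and the lift is canonical. -/
theorem willmore_of_frame (hS : IsOpen S) (hSε : ∀ z ∈ S, z.im ∈ Set.Ioo (-ε) ε)
    (h : IsStructureSolution ε k β s)
    (hFs : ∀ i j, ContDiffOn ℝ ∞ (fun z => F z i j) S) (hFG : ∀ z ∈ S, F z ∈ SOPlus)
    (hu : ∀ z ∈ S, ∀ j, HasLineDerivAt ℝ (fun w => (F w).col j)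
      (F z *ᵥ (realU (k z.im) (β z.im) (s z.im)).col j) z 1)
    (hv : ∀ z ∈ S, ∀ j, HasLineDerivAt ℝ (fun w => (F w).col j)
      (F z *ᵥ (realW (k z.im) (β z.im) (s z.im)).col j) z Complex.I) :
    IsWillmoreSurface S (frameSurface F) ∧
      ∀ z ∈ S, IsGaussFrame (frameSurface F) z (F z) := by
  have hcols : ∀ j, ContDiffOn ℝ ∞ (fun z => (F z).col j) S := fun j =>
    contDiffOn_pi.2 fun i => hFs i j
  have hs2 : √2 * √2 = 2 := Real.mul_self_sqrt (by norm_num)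
  have hs0 : √2 ≠ 0 := by positivity
  have hLs : ContDiffOn ℝ ∞ (frameLift F) S := ((hcols 0).sub (hcols 1)).const_smul _
  have hys : ContDiffOn ℝ ∞ (frameSurface F) S := by
    rw [contDiffOn_euclidean]
    exact fun i => (contDiffOn_pi.1 hLs i.succ).div (contDiffOn_pi.1 hLs 0)
      fun z hz => (frameLift_pos (hFG z hz)).ne'
  have hLu : ∀ z ∈ S, lineDeriv ℝ (frameLift F) z 1 = (F z).col 2 := fun z hz => by
    have h1 := ((hu z hz 0).sub (hu z hz 1)).const_smul ((√2)⁻¹)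
    refine (HasDerivAt.deriv (f := fun t : ℝ => frameLift F (z + t • 1)) h1).trans ?_
    rw [← mulVec_sub, ← mulVec_smul, col_sub_col_realU, Matrix.mulVec_single_one]
  have hLv : ∀ z ∈ S, lineDeriv ℝ (frameLift F) z Complex.I = (F z).col 3 := fun z hz => by
    have h1 := ((hv z hz 0).sub (hv z hz 1)).const_smul ((√2)⁻¹)
    refine (HasDerivAt.deriv (f := fun t : ℝ => frameLift F (z + t • Complex.I)) h1).trans ?_
    rw [← mulVec_sub, ← mulVec_smul, col_sub_col_realW, Matrix.mulVec_single_one]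
  have hnorm : ∀ z ∈ S, ‖frameSurface F z‖ = 1 := fun z hz => norm_frameSurface (hFG z hz)
  have hmet : ∀ z ∈ S, ∀ e₁ e₂ : ℂ,
      lorentzInner (lineDeriv ℝ (frameLift F) z e₁) (lineDeriv ℝ (frameLift F) z e₂)
        = frameLift F z 0 ^ 2 * inner ℝ (lineDeriv ℝ (frameSurface F) z e₁)
            (lineDeriv ℝ (frameSurface F) z e₂) := fun z hz e₁ e₂ =>
    lorentzInner_deriv_lift hS hnorm hz (hasLineDerivAt_of_contDiffOn hS hys hz e₁)
      (hasLineDerivAt_of_contDiffOn hS hys hz e₂)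
      (hasLineDerivAt_of_contDiffOn hS (contDiffOn_pi.1 hLs 0) hz e₁)
      (hasLineDerivAt_of_contDiffOn hS (contDiffOn_pi.1 hLs 0) hz e₂)
      fun w hw => frameLift_eq_smul (hFG w hw)
  have hunit : ∀ z ∈ S, ∀ (e : ℂ) (j : Fin 5), lorentzMetric ℝ j j = 1 →
      lineDeriv ℝ (frameLift F) z e = (F z).col j →
      frameLift F z 0 * ‖lineDeriv ℝ (frameSurface F) z e‖ = 1 := fun z hz e j hj he => by
    have h1 := hmet z hz e e
    rw [he, lorentzInner_col (hFG z hz).1, hj, real_inner_self_eq_norm_sq, ← mul_pow] at h1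
    have h2 : 0 ≤ frameLift F z 0 * ‖lineDeriv ℝ (frameSurface F) z e‖ :=
      mul_nonneg (frameLift_pos (hFG z hz)).le (norm_nonneg _)
    nlinarith
  have hyu : ∀ z ∈ S, frameLift F z 0 * ‖partialU (frameSurface F) z‖ = 1 := fun z hz =>
    hunit z hz 1 2 (by simp [lorentzMetric]) (hLu z hz)
  have hyv : ∀ z ∈ S, frameLift F z 0 * ‖partialV (frameSurface F) z‖ = 1 := fun z hz =>
    hunit z hz Complex.I 3 (by simp [lorentzMetric]) (hLv z hz)
  have hconf : IsConformalImmersion S (frameSurface F) :=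
    { smooth := hys
      mem_sphere := hnorm
      immersed := fun z hz h0 => by
        have := hyu z hz
        rw [h0, norm_zero, mul_zero] at this
        exact zero_ne_one this
      norm_eq := fun z hz =>
        mul_left_cancel₀ (frameLift_pos (hFG z hz)).ne' ((hyu z hz).trans (hyv z hz).symm)
      orthogonal := fun z hz => by
        have h1 := hmet z hz 1 Complex.I
        rw [hLu z hz, hLv z hz, lorentzInner_col (hFG z hz).1] at h1
        have h2 : (0 : ℝ) = frameLift F z 0 ^ 2
            * inner ℝ (partialU (frameSurface F) z) (partialV (frameSurface F) z) := by
          simpa [lorentzMetric, partialU, partialV] using h1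
        exact (mul_eq_zero.1 h2.symm).resolve_left
          (pow_ne_zero 2 (frameLift_pos (hFG z hz)).ne') }
  have hcl : ∀ z ∈ S, canonicalLift (frameSurface F) z = frameLift F z := fun z hz => by
    rw [frameLift_eq_smul (hFG z hz), canonicalLift]
    congr 1
    exact (eq_inv_of_mul_eq_one_left (hyu z hz)).symm
  have hclu : ∀ z ∈ S, partialU (canonicalLift (frameSurface F)) z = (F z).col 2 := fun z hz => by
    rw [partialU, lineDeriv_congr_on hS hcl hz]; exact hLu z hz
  have hclv : ∀ z ∈ S, partialV (canonicalLift (frameSurface F)) z = (F z).col 3 := fun z hz => by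
    rw [partialV, lineDeriv_congr_on hS hcl hz]; exact hLv z hz
  have hgauss : ∀ z ∈ S, IsGaussFrame (frameSurface F) z (F z) := fun z hz => by
    refine ⟨hFG z hz, ?_, (hclu z hz).symm, (hclv z hz).symm, ?_⟩
    · rw [hcl z hz, frameLift, smul_smul, mul_inv_cancel₀ hs0, one_smul]
    -- The normal components of `Y_uu` and `Y_vv` are `2 Re k` and `-2 Re k`; they cancel, so `ψ` is
    -- orthogonal to the Laplacian.
    · have h1 : planeLaplacian (canonicalLift (frameSurface F)) z
          = F z *ᵥ ((realU (k z.im) (β z.im) (s z.im)).col 2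
            + (realW (k z.im) (β z.im) (s z.im)).col 3) := by
        rw [planeLaplacian, partialU, partialV, lineDeriv_congr_on hS hclu hz,
          lineDeriv_congr_on hS hclv hz, (hu z hz 2).lineDeriv, (hv z hz 3).lineDeriv, mulVec_add]
      rw [h1, ← Matrix.mulVec_single_one, lorentzInner_mulVec (hFG z hz).1]
      simp [lorentzInner_eq, realU, realW]
  refine ⟨⟨hconf, F, hgauss, hcols 4, fun z hz => ⟨?_, ?_⟩⟩, hgauss⟩
  · rw [lorentzInner_col (hFG z hz).1]; simp [lorentzMetric]
  have hψu : ∀ w ∈ S, partialU (fun z => (F z).col 4) w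
      = F w *ᵥ (realU (k w.im) (β w.im) (s w.im)).col 4 := fun w hw => (hu w hw 4).lineDeriv
  have hψv : ∀ w ∈ S, partialV (fun z => (F z).col 4) w
      = F w *ᵥ (realW (k w.im) (β w.im) (s w.im)).col 4 := fun w hw => (hv w hw 4).lineDeriv
  have hcu : HasLineDerivAt ℝ (fun w : ℂ => (realU (k w.im) (β w.im) (s w.im)).col 4) 0 z 1 := by
    unfold HasLineDerivAt
    simpa using hasDerivAt_const (0 : ℝ) ((realU (k z.im) (β z.im) (s z.im)).col 4)
  -- The structure equations for `k` and `β` enter here; harmonicity does not need the one for `s`,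
  -- which serves flatness.
  have hcv : HasLineDerivAt ℝ (fun w : ℂ => (realW (k w.im) (β w.im) (s w.im)).col 4)
      ![-(2 * √2 * (Complex.I * k z.im * (starRingEnd ℂ) (s z.im)).im),
        2 * √2 * (Complex.I * k z.im * (starRingEnd ℂ) (s z.im)).im,
        2 * (-2 * Complex.I * β z.im).im, 2 * (-2 * Complex.I * β z.im).re, 0] z Complex.I := by
    have hre : ∀ {f : ℝ → ℂ} {f' : ℂ} {t : ℝ}, HasDerivAt f f' t →
        HasDerivAt (fun t => (f t).re) f'.re t := fun hf =>
      Complex.reCLM.hasFDerivAt.comp_hasDerivAt _ hf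
    have him : ∀ {f : ℝ → ℂ} {f' : ℂ} {t : ℝ}, HasDerivAt f f' t →
        HasDerivAt (fun t => (f t).im) f'.im t := fun hf =>
      Complex.imCLM.hasFDerivAt.comp_hasDerivAt _ hf
    have hadd : HasDerivAt (fun t : ℝ => z.im + t) 1 0 := (hasDerivAt_id _).const_add _
    have hshift : ∀ {f : ℝ → ℝ} {f' : ℝ}, HasDerivAt f f' z.im →
        HasDerivAt (fun t : ℝ => f (z.im + t)) f' 0 := fun {f f'} hf => by
      have h1 : HasDerivAt f f' (z.im + 0) := by simpa using hf
      exact (h1.comp (0 : ℝ) hadd).congr_deriv (by simp)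
    have hk := h.hk z.im (hSε z hz)
    have hβ := h.hβ z.im (hSε z hz)
    have e : ∀ t : ℝ, (z + t • Complex.I).im = z.im + t := fun t => by simp
    unfold HasLineDerivAt
    simp only [e]
    refine hasDerivAt_pi.2 fun i => ?_
    fin_cases i
    · exact ((hshift (him hβ)).const_mul (2 * √2)).fun_neg
    · exact (hshift (him hβ)).const_mul (2 * √2)
    · exact (hshift (him hk)).const_mul 2
    · exact (hshift (hre hk)).const_mul 2
    · exact hasDerivAt_const _ _
  have huu : partialU (partialU fun z => (F z).col 4) z = F z *ᵥ
      (realU (k z.im) (β z.im) (s z.im) *ᵥ (realU (k z.im) (β z.im) (s z.im)).col 4 + 0) := by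
    rw [partialU, lineDeriv_congr_on hS hψu hz]
    exact (HasLineDerivAt.mulVec (hu z hz) hcu).lineDeriv
  have hvv := (HasLineDerivAt.mulVec (hv z hz) hcv).lineDeriv
  rw [← lineDeriv_congr_on hS hψv hz] at hvv
  rw [planeLaplacian, huu]
  rw [partialV, hvv]
  rw [hψu z hz, hψv z hz, lorentzInner_mulVec (hFG z hz).1, lorentzInner_mulVec (hFG z hz).1,
    show (fun z => (F z).col 4) z = F z *ᵥ Pi.single 4 1 from (Matrix.mulVec_single_one (F z) 4).symm,
    ← mulVec_smul, ← mulVec_add, ← mulVec_add]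
  convert mulVec_zero (F z) using 2
  generalize k z.im = k
  generalize β z.im = β
  generalize s z.im = s
  have hs2' : √2 ^ 2 = 2 := by rw [sq, hs2]
  ext i
  fin_cases i <;>
    simp [realU, realW, lorentzInner_eq, dotProduct, Fin.sum_univ_five] <;>
    ring_nf <;> (try simp only [hs2']) <;> ring

end

/-! ### Existence of the extended frame -/

theorem mem_strip_coe {a b : ℝ} {z : ℂ} :
    z ∈ strip (a : EReal) (b : EReal) ↔ z.im ∈ Set.Ioo a b := by
  simp [strip]

theorem twist_lorentzAdjoint {R : Type*} [CommRing R] (A : Matrix (Fin 5) (Fin 5) R) :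
    twist (lorentzAdjoint A) = lorentzAdjoint (twist A) := by
  ext i j
  simp only [twist_apply, lorentzAdjoint_apply]
  ring

theorem twist_smul {R : Type*} [CommRing R] (a : R) (A : Matrix (Fin 5) (Fin 5) R) :
    twist (a • A) = a • twist A := by
  rw [twist, twist, mul_smul_comm, smul_mul_assoc]

theorem map_re_map_ofReal {A : Matrix (Fin 5) (Fin 5) ℂ} (h : A.map (starRingEnd ℂ) = A) :
    (A.map Complex.re).map (fun x : ℝ => (x : ℂ)) = A := by
  ext i j
  have hij := congrFun (congrFun h i) j
  exact Complex.conj_eq_iff_re.1 hij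

theorem contDiff_matrix_exp_entry {c : ℂ → ℂ} (hc : ContDiff ℝ ∞ c)
    (D : Matrix (Fin 5) (Fin 5) ℂ) (i j : Fin 5) :
    ContDiff ℝ ∞ fun z => NormedSpace.exp (c z • D) i j := by
  have h1 : ContDiff ℂ ∞ fun u : ℂ => NormedSpace.exp (u • D) i j := by
    have h2 : Differentiable ℂ fun u : ℂ => NormedSpace.exp (u • D) i j := fun t =>
      (hasDerivAt_matrix_exp_entry D t i j).differentiableAt
    exact h2.contDiff
  exact (h1.restrict_scalars ℝ).comp hc

theorem contDiffOn_mul_entry {S : Set ℂ} {A B : ℂ → Matrix (Fin 5) (Fin 5) ℂ}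
    (hA : ∀ i j, ContDiffOn ℝ ∞ (fun z => A z i j) S)
    (hB : ∀ i j, ContDiffOn ℝ ∞ (fun z => B z i j) S) (i j : Fin 5) :
    ContDiffOn ℝ ∞ (fun z => (A z * B z) i j) S := by
  simp only [Matrix.mul_apply]
  exact ContDiffOn.sum fun l _ => (hA i l).mul (hB l j)

theorem continuousOn_holForm_loop (k β s : ℂ) :
    ContinuousOn (fun ζ => holForm k β s ζ) (Metric.sphere 0 1) := by
  have h0 : ∀ ζ ∈ Metric.sphere (0 : ℂ) 1, ζ ≠ 0 := fun ζ hζ h0 => by simp [h0] at hζ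
  have hinv : ContinuousOn (fun ζ : ℂ => ζ⁻¹) (Metric.sphere 0 1) := continuousOn_id.inv₀ h0
  simp only [holForm, fun ζ : ℂ => frameForm_eq_sum quarterSqrtTwo Complex.I 1
    (k * (starRingEnd ℂ) k) (ζ⁻¹ * k) (ζ⁻¹ * β) s]
  exact ((continuousOn_const.add ((hinv.mul continuousOn_const).smul continuousOn_const)).add
    ((hinv.mul continuousOn_const).smul continuousOn_const)).add continuousOn_const

theorem continuousOn_antiForm_loop (k β s : ℂ) :
    ContinuousOn (fun ζ => antiForm k β s ζ) (Metric.sphere 0 1) := by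
  simp only [antiForm, fun ζ : ℂ => frameForm_eq_sum quarterSqrtTwo (-Complex.I) 1
    (k * (starRingEnd ℂ) k) (ζ * (starRingEnd ℂ) k) (ζ * (starRingEnd ℂ) β) ((starRingEnd ℂ) s)]
  exact ((continuousOn_const.add ((continuousOn_id.mul continuousOn_const).smul
    continuousOn_const)).add ((continuousOn_id.mul continuousOn_const).smul
    continuousOn_const)).add continuousOn_const

theorem continuousOn_uForm_loop (k β s : ℂ) :
    ContinuousOn (fun ζ => uForm k β s ζ) (Metric.sphere 0 1) :=
  (continuousOn_holForm_loop k β s).add (continuousOn_antiForm_loop k β s)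

section
open scoped Matrix.Norms.Operator

theorem hasLineDerivAt_col_of_map {Fc : ℂ → Matrix (Fin 5) (Fin 5) ℂ}
    {M : Matrix (Fin 5) (Fin 5) ℝ} {z e : ℂ}
    (hFz : ((Fc z).map Complex.re).map (fun x : ℝ => (x : ℂ)) = Fc z)
    (h : HasDerivAt (fun t : ℝ => Fc (z + t • e)) (Fc z * M.map (fun x : ℝ => (x : ℂ))) 0)
    (j : Fin 5) :
    HasLineDerivAt ℝ (fun w => ((Fc w).map Complex.re).col j)
      ((Fc z).map Complex.re *ᵥ M.col j) z e := by
  refine hasDerivAt_pi.2 fun i => ?_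
  have h1 := Complex.reCLM.hasFDerivAt.comp_hasDerivAt (0 : ℝ) ((hasDerivAt_matrix_iff.1 h) i j)
  refine h1.congr_deriv ?_
  rw [← hFz, ← map_ofReal_mul]
  rfl

/-- With `A(v) = exp(ivD) V(v)⁻¹` real by `real_frame`, the frame is `exp(uD) A(v)`. As `exp(zD) =
exp(uD) exp(ivD)`, this is an Iwasawa factorization, and real translations act by left
multiplication with `exp(tD)`. -/
theorem exists_extended_frame (k₀ β₀ s₀ : ℂ) {D : ℂ → Matrix (Fin 5) (Fin 5) ℂ}
    (hD : ∀ ζ : ℂ, ‖ζ‖ = 1 → D ζ = uForm k₀ β₀ s₀ ζ) :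
    ∃ ε : ℝ, 0 < ε ∧ ∃ k β s : ℝ → ℂ, k 0 = k₀ ∧ β 0 = β₀ ∧ s 0 = s₀ ∧
      IsStructureSolution ε k β s ∧ ∃ F : ℂ → ℂ → Matrix (Fin 5) (Fin 5) ℝ,
        IsExtendedFrame D (strip ((-ε : ℝ) : EReal) (ε : EReal)) F ∧
        ∀ ζ : ℂ, ‖ζ‖ = 1 → ∀ z ∈ strip ((-ε : ℝ) : EReal) (ε : EReal),
          (∀ j, HasLineDerivAt ℝ (fun w => (F w ζ).col j)
            (F z ζ *ᵥ (realU (ζ⁻¹ * k z.im) (ζ⁻¹ * β z.im) (s z.im)).col j) z 1) ∧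
          (∀ j, HasLineDerivAt ℝ (fun w => (F w ζ).col j)
            (F z ζ *ᵥ (realW (ζ⁻¹ * k z.im) (ζ⁻¹ * β z.im) (s z.im)).col j) z Complex.I) ∧
          ∀ t : ℝ, (F (z + t) ζ).map (fun x : ℝ => (x : ℂ))
            = NormedSpace.exp ((t : ℂ) • D ζ) * (F z ζ).map (fun x : ℝ => (x : ℂ)) := by
  obtain ⟨ε, hε, k, β, s, V, rfl, rfl, rfl, hkβs, hVdisk, hV⟩ := exists_plus_frame k₀ β₀ s₀
  have hsol : IsStructureSolution ε k β s :=
    ⟨fun v hv => (hkβs v hv).1, fun v hv => (hkβs v hv).2.1, fun v hv => (hkβs v hv).2.2⟩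
  set U : ℂ → Matrix (Fin 5) (Fin 5) ℂ := uForm (k 0) (β 0) (s 0) with hU
  set A : ℝ → ℂ → Matrix (Fin 5) (Fin 5) ℂ := fun v ζ =>
    NormedSpace.exp (((v : ℂ) * Complex.I) • U ζ) * lorentzAdjoint (V v ζ) with hA
  set Fc : ℂ → ℂ → Matrix (Fin 5) (Fin 5) ℂ := fun z ζ =>
    NormedSpace.exp ((z.re : ℂ) • U ζ) * A z.im ζ with hFc
  have hFcz : ∀ {z : ℂ} (ζ : ℂ) {a b : ℝ}, z.re = a → z.im = b →
      Fc z ζ = NormedSpace.exp ((a : ℂ) • U ζ) * A b ζ := by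
    rintro z ζ _ _ rfl rfl; rfl
  have hV' : ∀ ζ : ℂ, ‖ζ‖ ≤ 1 → ∀ v ∈ Set.Ioo (-ε) ε,
      HasDerivAt (fun v => V v ζ) ((2 * Complex.I) • antiForm (k v) (β v) (s v) ζ * V v ζ) v :=
    fun ζ hζ v hv => hasDerivAt_matrix_iff.2 fun i j => (hV ζ hζ).2.2 v hv i j
  have hVorth : ∀ ζ : ℂ, ‖ζ‖ ≤ 1 → ∀ v ∈ Set.Ioo (-ε) ε, lorentzAdjoint (V v ζ) * V v ζ = 1 :=
    fun ζ hζ v hv => plus_orthogonal (V := fun v => V v ζ) (hV ζ hζ).1 (hV' ζ hζ) hv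
  have hVtw : ∀ ζ : ℂ, ‖ζ‖ = 1 → ∀ v ∈ Set.Ioo (-ε) ε, V v (-ζ) = twist (V v ζ) :=
    fun ζ hζ v hv => by
      have hζ' : ‖-ζ‖ ≤ 1 := by rw [norm_neg]; exact hζ.le
      exact hsol.plus_twisted (V := fun v => V v ζ) (V' := fun v => V v (-ζ)) (hV ζ hζ.le).1
        (hV _ hζ').1 (hV' ζ hζ.le) (hV' _ hζ') hv
  have hreal : ∀ ζ : ℂ, ‖ζ‖ = 1 → ∀ v ∈ Set.Ioo (-ε) ε,
      U ζ * A v ζ = A v ζ * uForm (k v) (β v) (s v) ζ ∧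
      HasDerivAt (fun v => A v ζ) (A v ζ * wForm (k v) (β v) (s v) ζ) v ∧
      (A v ζ).map (starRingEnd ℂ) = A v ζ := fun ζ hζ v hv =>
    hsol.real_frame hζ (V := fun v => V v ζ) (hV ζ hζ.le).1 (hV' ζ hζ.le) (F := fun v => A v ζ)
      (fun _ => rfl) hv
  have hmem : ∀ {z : ℂ}, z ∈ strip ((-ε : ℝ) : EReal) (ε : EReal) → z.im ∈ Set.Ioo (-ε) ε :=
    fun hz => mem_strip_coe.1 hz
  have hFconj : ∀ ζ : ℂ, ‖ζ‖ = 1 → ∀ z ∈ strip ((-ε : ℝ) : EReal) (ε : EReal),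
      (Fc z ζ).map (starRingEnd ℂ) = Fc z ζ := fun ζ hζ z hz => by
    have h1 : ((z.re : ℂ) • U ζ).map (starRingEnd ℂ) = (z.re : ℂ) • U ζ := by
      conv_rhs => rw [hU, ← uForm_map_conj _ _ _ hζ]
      ext i j
      simp [hU]
    simp only [hFc]
    rw [Matrix.map_mul, matrix_exp_map_conj, h1, (hreal ζ hζ _ (hmem hz)).2.2]
  have hFmap : ∀ ζ : ℂ, ‖ζ‖ = 1 → ∀ z ∈ strip ((-ε : ℝ) : EReal) (ε : EReal),
      ((Fc z ζ).map Complex.re).map (fun x : ℝ => (x : ℂ)) = Fc z ζ := fun ζ hζ z hz =>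
    map_re_map_ofReal (hFconj ζ hζ z hz)
  have h0mem : (0 : ℂ) ∈ strip ((-ε : ℝ) : EReal) (ε : EReal) := mem_strip_coe.2 (by simp [hε])
  have hF0 : ∀ ζ : ℂ, ‖ζ‖ = 1 → Fc 0 ζ = 1 := fun ζ hζ => by
    simp [hFc, hA, (hV ζ hζ.le).1, lorentzAdjoint_one]
  have hF0' : ∀ ζ : ℂ, ‖ζ‖ = 1 → (Fc 0 ζ).map Complex.re = 1 := fun ζ hζ => by
    rw [hF0 ζ hζ]; exact Matrix.map_one _ Complex.zero_re Complex.one_re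
  have hVsm : ∀ ζ : ℂ, ‖ζ‖ = 1 → ∀ i j,
      ContDiffOn ℝ ∞ (fun z : ℂ => V z.im ζ i j) (strip ((-ε : ℝ) : EReal) (ε : EReal)) :=
    fun ζ hζ i j => ((hV ζ hζ.le).2.1 i j).comp Complex.imCLM.contDiff.contDiffOn
      fun z hz => hmem hz
  have hFsm : ∀ ζ : ℂ, ‖ζ‖ = 1 → ∀ i j, ContDiffOn ℝ ∞ (fun z => ((Fc z ζ).map Complex.re) i j)
      (strip ((-ε : ℝ) : EReal) (ε : EReal)) := fun ζ hζ i j => by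
    refine Complex.reCLM.contDiff.comp_contDiffOn (contDiffOn_mul_entry (fun i j => ?_)
      (contDiffOn_mul_entry (fun i j => ?_) fun i j => ?_) i j)
    · exact (contDiff_matrix_exp_entry (Complex.ofRealCLM.contDiff.comp Complex.reCLM.contDiff)
        _ i j).contDiffOn
    · exact (contDiff_matrix_exp_entry ((Complex.ofRealCLM.contDiff.comp
        Complex.imCLM.contDiff).mul contDiff_const) _ i j).contDiffOn
    · simp only [lorentzAdjoint_apply]
      exact contDiffOn_const.mul (hVsm ζ hζ j i)
  have hexporth : ∀ (ζ a : ℂ), (NormedSpace.exp (a • U ζ))ᵀ * lorentzMetric ℂ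
      * NormedSpace.exp (a • U ζ) = lorentzMetric ℂ := fun ζ a =>
    orthogonal_of_lorentzAdjoint_mul_self (orthogonal_exp (by
      rw [lorentzAdjoint_smul, hU, lorentzAdjoint_uForm, smul_neg]))
  have hForth : ∀ ζ : ℂ, ‖ζ‖ = 1 → ∀ z ∈ strip ((-ε : ℝ) : EReal) (ε : EReal),
      ((Fc z ζ).map Complex.re)ᵀ * lorentzMetric ℝ * (Fc z ζ).map Complex.re
        = lorentzMetric ℝ := fun ζ hζ z hz => by
    have h1 : (Fc z ζ)ᵀ * lorentzMetric ℂ * Fc z ζ = lorentzMetric ℂ :=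
      orthogonal_mul (hexporth ζ _) (orthogonal_mul (hexporth ζ _) (lorentzAdjoint_orthogonal
        (orthogonal_of_lorentzAdjoint_mul_self (hVorth ζ hζ.le _ (hmem hz)))))
    have hT : ((Fc z ζ).map Complex.re)ᵀ.map (fun x : ℝ => (x : ℂ)) = (Fc z ζ)ᵀ :=
      congrArg Matrix.transpose (hFmap ζ hζ z hz)
    refine map_ofReal_injective ?_
    rw [map_ofReal_mul, map_ofReal_mul, hT, hFmap ζ hζ z hz, lorentzMetric_map, h1]
  have hSpre : IsPreconnected (strip ((-ε : ℝ) : EReal) (ε : EReal)) := by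
    have : strip ((-ε : ℝ) : EReal) (ε : EReal) = Complex.im ⁻¹' Set.Ioo (-ε) ε := by
      ext z; exact mem_strip_coe
    rw [this]
    exact ((convex_Ioo (-ε) ε).linear_preimage Complex.imLm).isPreconnected
  have hFG : ∀ ζ : ℂ, ‖ζ‖ = 1 → ∀ z ∈ strip ((-ε : ℝ) : EReal) (ε : EReal),
      (Fc z ζ).map Complex.re ∈ SOPlus := fun ζ hζ z hz =>
    mem_SOPlus_of_isPreconnected hSpre (continuousOn_pi.2 fun i => continuousOn_pi.2 fun j =>
      (hFsm ζ hζ i j).continuousOn) (hForth ζ hζ) h0mem (hF0' ζ hζ) hz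
  have hfactor : ∀ ζ : ℂ, ‖ζ‖ = 1 → ∀ z ∈ strip ((-ε : ℝ) : EReal) (ε : EReal),
      NormedSpace.exp (z • U ζ) = Fc z ζ * V z.im ζ := fun ζ hζ z hz => by
    simp only [hFc, hA]
    rw [mul_assoc, mul_assoc, hVorth ζ hζ.le _ (hmem hz), mul_one, ← matrix_exp_add_smul,
      Complex.re_add_im]
  refine ⟨ε, hε, k, β, s, rfl, rfl, rfl, hsol, fun z ζ => (Fc z ζ).map Complex.re,
    ⟨fun ζ hζ => ⟨hF0' ζ hζ, hFsm ζ hζ⟩, fun z hz => ⟨fun i j => ?_, fun ζ hζ =>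
      ⟨hFG ζ hζ z hz, ?_⟩⟩, fun z => V z.im, fun z hz => ⟨hVdisk _, fun ζ hζ => ⟨?_, ?_⟩,
      fun ζ hζ => hVtw ζ hζ _ (hmem hz)⟩, fun z hz ζ hζ => ?_⟩,
    fun ζ hζ z hz => ⟨hasLineDerivAt_col_of_map (Fc := fun z => Fc z ζ) (hFmap ζ hζ z hz) ?_,
      hasLineDerivAt_col_of_map (Fc := fun z => Fc z ζ) (hFmap ζ hζ z hz) ?_, fun t => ?_⟩⟩
  · have hexp : ∀ a : ℂ, ContinuousOn (fun ζ => NormedSpace.exp (a • U ζ)) (Metric.sphere 0 1) :=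
      fun a => continuous_matrix_exp.comp_continuousOn
        ((continuousOn_uForm_loop (k 0) (β 0) (s 0)).const_smul a)
    have hVc : ContinuousOn (fun ζ => lorentzAdjoint (V z.im ζ)) (Metric.sphere 0 1) := by
      refine continuousOn_pi.2 fun i => continuousOn_pi.2 fun j => ?_
      simp only [lorentzAdjoint_apply]
      refine continuousOn_const.mul ((hVdisk z.im j i).continuousOn.mono ?_)
      rw [closure_ball _ one_ne_zero]
      exact Metric.sphere_subset_closedBall
    have hc : ContinuousOn (fun ζ => Fc z ζ) (Metric.sphere 0 1) :=
      (hexp _).mul ((hexp _).mul hVc)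
    exact Complex.continuous_re.comp_continuousOn
      ((continuous_apply_apply i j).comp_continuousOn hc)
  · have h1 : Fc z (-ζ) = twist (Fc z ζ) := by
      simp only [hFc, hA]
      rw [twist_mul, twist_mul, twist_exp, twist_exp, twist_smul, twist_smul, hU, twist_uForm,
        twist_lorentzAdjoint, hVtw ζ hζ _ (hmem hz)]
    beta_reduce
    rw [h1]
    ext i j
    simp only [Matrix.map_apply, twist_apply]
    fin_cases i <;> fin_cases j <;> simp
  · exact orthogonal_of_lorentzAdjoint_mul_self (hVorth ζ hζ _ (hmem hz))
  · exact det_eq_one_of_isPreconnected (F := fun v => V v ζ) isPreconnected_Ioo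
      (fun v hv => (hV' ζ hζ v hv).continuousAt.continuousWithinAt)
      (fun v hv => orthogonal_of_lorentzAdjoint_mul_self (hVorth ζ hζ v hv))
      (x₀ := 0) (by simp [hε]) (hV ζ hζ).1 (hmem hz)
  · rw [hD ζ hζ, hFmap ζ hζ z hz]; exact hfactor ζ hζ z hz
  · rw [← uForm_eq_map _ _ _ hζ]
    have h1 : HasDerivAt (fun t : ℝ => NormedSpace.exp (((z.re + t : ℝ) : ℂ) • U ζ))
        (U ζ * NormedSpace.exp ((z.re : ℂ) • U ζ)) 0 := by
      have h2 := hasDerivAt_matrix_exp_ofReal (U ζ) (z.re + 0)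
      have h3 := h2.comp_const_add z.re (0 : ℝ)
      exact h3.congr_deriv (by rw [add_zero])
    have h2 := h1.mul_const (A z.im ζ)
    have e : ∀ t : ℝ, Fc (z + t • 1) ζ
        = NormedSpace.exp (((z.re + t : ℝ) : ℂ) • U ζ) * A z.im ζ := fun t =>
      hFcz ζ (by simp) (by simp)
    simp only [e]
    refine h2.congr_deriv ?_
    -- `D` is moved past the exponential and then through `A` by `D A = A U`, which turns the left
    -- derivative into the right form `F U`.
    rw [matrix_exp_commute, mul_assoc, (hreal ζ hζ _ (hmem hz)).1, ← mul_assoc]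
  · rw [← wForm_eq_map _ _ _ hζ]
    have h1 : HasDerivAt (fun t : ℝ => A (z.im + t) ζ)
        (A z.im ζ * wForm (k z.im) (β z.im) (s z.im) ζ) 0 := by
      have h2 : HasDerivAt (fun v => A v ζ) (A z.im ζ * wForm (k z.im) (β z.im) (s z.im) ζ)
        (z.im + 0) := by rw [add_zero]; exact (hreal ζ hζ _ (hmem hz)).2.1
      exact h2.comp_const_add z.im (0 : ℝ)
    have h2 := h1.const_mul (NormedSpace.exp ((z.re : ℂ) • U ζ))
    have e : ∀ t : ℝ, Fc (z + t • Complex.I) ζ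
        = NormedSpace.exp ((z.re : ℂ) • U ζ) * A (z.im + t) ζ := fun t =>
      hFcz ζ (by simp) (by simp)
    simp only [e]
    exact h2.congr_deriv (mul_assoc ..).symm
  · rw [hFmap ζ hζ z hz, hFmap ζ hζ _ (add_ofReal_mem_strip hz t), hD ζ hζ]
    have e1 : (((z + t : ℂ).re : ℝ) : ℂ) = t + z.re := by simp [add_comm]
    have e2 : (z + t : ℂ).im = z.im := by simp
    rw [hFcz ζ rfl rfl, e1, e2, matrix_exp_add_smul, mul_assoc]

end

/-! ### Production of a family -/

/-- The one-parameter group of the member at `ζ` is the frame itself on the real axis, `F(t, ζ) =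
exp(tD(ζ))`. -/
theorem exists_producesFamily (k₀ β₀ s₀ : ℂ) {D : ℂ → Matrix (Fin 5) (Fin 5) ℂ}
    (hD : ∀ ζ : ℂ, ‖ζ‖ = 1 → D ζ = uForm k₀ β₀ s₀ ζ) :
    ∃ a b : EReal, a < 0 ∧ 0 < b ∧ ∃ y : ℂ → ℂ → EuclideanSpace ℝ (Fin 4),
      ProducesFamily D (strip a b) y := by
  obtain ⟨ε, hε, k, β, s, -, -, -, hsol, F, hF, hder⟩ := exists_extended_frame k₀ β₀ s₀ hD
  refine ⟨((-ε : ℝ) : EReal), (ε : EReal), EReal.coe_neg'.2 (neg_lt_zero.2 hε), EReal.coe_pos.2 hε,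
    fun ζ => frameSurface fun z => F z ζ, F, hF, fun ζ hζ => ?_⟩
  have hG : ∀ z ∈ strip ((-ε : ℝ) : EReal) (ε : EReal), F z ζ ∈ SOPlus := fun z hz =>
    ((hF.2.1 z hz).2 ζ hζ).1
  obtain ⟨hW, hE⟩ := willmore_of_frame (F := fun z => F z ζ) (isOpen_strip _ _)
    (fun z hz => mem_strip_coe.1 hz) (hsol.phase hζ) (hF.1 ζ hζ).2 hG
    (fun z hz => (hder ζ hζ z hz).1) fun z hz => (hder ζ hζ z hz).2.1
  refine ⟨hW, ?_, fun z hz => ⟨F z ζ, hE z hz, 1, ⟨one_mem_SOPlus, one_mulVec _⟩,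
    (mul_one _).symm⟩⟩
  have h0 : (0 : ℂ) ∈ strip ((-ε : ℝ) : EReal) (ε : EReal) := mem_strip_coe.2 (by simp [hε])
  have hr : ∀ t : ℝ, (t : ℂ) ∈ strip ((-ε : ℝ) : EReal) (ε : EReal) := fun t => by
    simpa using add_ofReal_mem_strip h0 t
  have hexp : ∀ t : ℝ, (F t ζ).map (fun x : ℝ => (x : ℂ)) = NormedSpace.exp ((t : ℂ) • D ζ) :=
    fun t => by
      have h1 := (hder ζ hζ 0 h0).2.2 t
      rwa [zero_add, (hF.1 ζ hζ).1, map_ofReal_one, mul_one] at h1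
  have htr : ∀ z ∈ strip ((-ε : ℝ) : EReal) (ε : EReal), ∀ t : ℝ, F (z + t) ζ = F t ζ * F z ζ :=
    fun z hz t => map_ofReal_injective (by
      rw [(hder ζ hζ z hz).2.2 t, map_ofReal_mul, hexp])
  refine ⟨fun t => F t ζ, ?_, by simpa using (hF.1 ζ hζ).1, fun s t => ?_, fun t => hG _ (hr t),
    fun z hz t => lightVector_equivariant (F := fun z => F z ζ) (hG z hz)
      (hG _ (add_ofReal_mem_strip hz t)) (htr z hz t)⟩
  · refine continuous_pi fun i => continuous_pi fun j => ?_
    exact ((hF.1 ζ hζ).2 i j).continuousOn.comp_continuous Complex.continuous_ofReal hr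
  · have h1 := htr t (hr t) s
    rwa [← Complex.ofReal_add, add_comm] at h1

/-! ### The period criterion -/

theorem mulVec_eq_of_hasLineDerivAt {N : Matrix (Fin 5) (Fin 5) ℝ} {f : ℂ → Fin 5 → ℝ}
    {f' : Fin 5 → ℝ} {z e : ℂ} (hf : HasLineDerivAt ℝ f f' z e)
    (h : ∀ᶠ t : ℝ in nhds 0, N *ᵥ f (z + t • e) = f (z + t • e)) : N *ᵥ f' = f' := by
  have h1 : HasDerivAt (fun t : ℝ => N *ᵥ f (z + t • e)) (N *ᵥ f') 0 := hf.const_mulVec N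
  exact (h1.congr_of_eventuallyEq (h.mono fun t ht => ht.symm)).unique hf

/-- A linear map fixing the normals fixes their derivatives. At `0`, `ψ`, `ψ_u`, `ψ_v` span `e₂, e₃,
e₄` because `(x, y) ≠ 0`, and one more `u`-derivative produces `e₁`. Orthogonality and `N₀₀ > 0`
then settle `e₀`. -/
theorem eq_one_of_fixes_frame {N : Matrix (Fin 5) (Fin 5) ℝ} (hN : N ∈ SOPlus) {S : Set ℂ}
    (hS : IsOpen S) (hr : ∀ r : ℝ, (r : ℂ) ∈ S) {x y c : ℝ} (hxy : x ^ 2 + y ^ 2 = 1)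
    {F : ℂ → Matrix (Fin 5) (Fin 5) ℝ} (hF0 : F 0 = 1)
    (hu : ∀ (r : ℝ) (j), HasLineDerivAt ℝ (fun w => (F w).col j)
      (F r *ᵥ (realPotential x y c).col j) r 1)
    (hv : ∀ r : ℝ, HasLineDerivAt ℝ (fun w => (F w).col 4)
      (F r *ᵥ ![0, 0, √2 * y, √2 * x, 0]) r Complex.I)
    (h4 : ∀ z ∈ S, N *ᵥ (F z).col 4 = (F z).col 4) : N = 1 := by
  have hs2 : √2 * √2 = 2 := Real.mul_self_sqrt (by norm_num)
  have hs0 : √2 ≠ 0 := by positivity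
  have hnear : ∀ (r : ℝ) (e : ℂ), ∀ᶠ t : ℝ in nhds 0, (r : ℂ) + t • e ∈ S := fun r e => by
    have hc : Continuous fun t : ℝ => (r : ℂ) + t • e := by fun_prop
    refine hc.continuousAt.eventually_mem (hS.mem_nhds ?_)
    simpa using hr r
  have hA1 : ∀ r : ℝ, N *ᵥ (F r *ᵥ (realPotential x y c).col 4)
      = F r *ᵥ (realPotential x y c).col 4 := fun r =>
    mulVec_eq_of_hasLineDerivAt (hu r 4) ((hnear r 1).mono fun t ht => h4 _ ht)
  have hA2 : ∀ r : ℝ, N *ᵥ (F r *ᵥ ![0, 0, √2 * y, √2 * x, 0])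
      = F r *ᵥ ![0, 0, √2 * y, √2 * x, 0] := fun r =>
    mulVec_eq_of_hasLineDerivAt (hv r) ((hnear r Complex.I).mono fun t ht => h4 _ ht)
  have e2 : (Pi.single 2 1 : Fin 5 → ℝ) = (-x / √2) • (realPotential x y c).col 4
      + (y / √2) • ![0, 0, √2 * y, √2 * x, 0] := by
    ext i
    fin_cases i <;> simp [realPotential] <;> field_simp
    · linarith
    · ring
  have e3 : (Pi.single 3 1 : Fin 5 → ℝ) = (y / √2) • (realPotential x y c).col 4
      + (x / √2) • ![0, 0, √2 * y, √2 * x, 0] := by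
    ext i
    fin_cases i <;> simp [realPotential] <;> field_simp
    · ring
    · linarith
  -- The form is constant along the real axis, so the same combination of `ψ_u` and `ψ_v` gives
  -- column 2 at every real point. This allows differentiating it in `u`.
  have hA3 : ∀ r : ℝ, N *ᵥ (F r).col 2 = (F r).col 2 := fun r => by
    rw [← Matrix.mulVec_single_one (F r) 2, e2]
    simp only [mulVec_add, mulVec_smul, hA1 r, hA2 r]
  have hB1 : N *ᵥ Pi.single 2 1 = Pi.single 2 1 := by
    have := hA3 0
    rwa [Complex.ofReal_zero, hF0, ← Matrix.mulVec_single_one, one_mulVec] at this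
  have hB2 : N *ᵥ Pi.single 3 1 = Pi.single 3 1 := by
    have h1 := hA1 0
    have h2 := hA2 0
    rw [Complex.ofReal_zero, hF0, one_mulVec] at h1 h2
    rw [e3, mulVec_add, mulVec_smul, mulVec_smul, h1, h2]
  have hB3 : N *ᵥ Pi.single 4 1 = Pi.single 4 1 := by
    have := h4 0 (by simpa using hr 0)
    rwa [hF0, ← Matrix.mulVec_single_one, one_mulVec] at this
  have hB4 : N *ᵥ Pi.single 1 1 = Pi.single 1 1 := by
    have h1 := mulVec_eq_of_hasLineDerivAt (N := N) (hu 0 2) (Filter.Eventually.of_forall fun t => by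
      have e : ((0 : ℝ) : ℂ) + t • (1 : ℂ) = (t : ℝ) := by simp
      rw [e]; exact hA3 t)
    rw [Complex.ofReal_zero, hF0, one_mulVec] at h1
    have e1 : (Pi.single 1 1 : Fin 5 → ℝ) = (√2)⁻¹ • (realPotential x y c).col 2
        - x • Pi.single 4 1 := by
      ext i
      fin_cases i <;> simp [realPotential]
    rw [e1, mulVec_sub, mulVec_smul, mulVec_smul, h1, hB3]
  rw [Matrix.mulVec_single_one] at hB1 hB2 hB3 hB4
  have c1 : ∀ i, N i 1 = (Pi.single 1 1 : Fin 5 → ℝ) i := fun i => congrFun hB4 i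
  have c2 : ∀ i, N i 2 = (Pi.single 2 1 : Fin 5 → ℝ) i := fun i => congrFun hB1 i
  have c3 : ∀ i, N i 3 = (Pi.single 3 1 : Fin 5 → ℝ) i := fun i => congrFun hB2 i
  have c4 : ∀ i, N i 4 = (Pi.single 4 1 : Fin 5 → ℝ) i := fun i => congrFun hB3 i
  have e := fun j => lorentzInner_col hN.1 0 j
  simp only [lorentzInner_eq, Matrix.col_apply] at e
  have d1 : N 1 0 = 0 := by simpa [c1, lorentzMetric] using e 1
  have d2 : N 2 0 = 0 := by simpa [c2, lorentzMetric] using e 2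
  have d3 : N 3 0 = 0 := by simpa [c3, lorentzMetric] using e 3
  have d4 : N 4 0 = 0 := by simpa [c4, lorentzMetric] using e 4
  have d0 : N 0 0 = 1 := by
    have := e 0
    simp [d1, d2, d3, d4, lorentzMetric] at this
    nlinarith [hN.2.2]
  ext i j
  fin_cases j
  · fin_cases i <;> simp [d0, d1, d2, d3, d4]
  · fin_cases i <;> simp [c1]
  · fin_cases i <;> simp [c2]
  · fin_cases i <;> simp [c3]
  · fin_cases i <;> simp [c4]

theorem isPreconnected_strip (a b : EReal) : IsPreconnected (strip a b) := by
  have h : Convex ℝ {t : ℝ | a < t ∧ (t : EReal) < b} := by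
    refine Set.OrdConnected.convex ⟨fun s hs t ht r hr => ⟨hs.1.trans_le ?_, lt_of_le_of_lt ?_ ht.2⟩⟩
    · exact EReal.coe_le_coe_iff.2 hr.1
    · exact EReal.coe_le_coe_iff.2 hr.2
  exact (h.linear_preimage Complex.imLm).isPreconnected

theorem strip_inter_strip (a b a' b' : EReal) :
    strip a b ∩ strip a' b' = strip (max a a') (min b b') := by
  ext z
  simp only [strip, Set.mem_inter_iff, Set.mem_ofPred_eq, max_lt_iff, lt_min_iff]
  tauto

theorem ofReal_mem_strip {a b : EReal} (ha : a < 0) (hb : 0 < b) (r : ℝ) :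
    (r : ℂ) ∈ strip a b := by
  simpa [strip] using ⟨ha, hb⟩

/-- The normal vectors of two extended frames of the same potential agree. -/
theorem extendedFrame_normal_unique {D : ℂ → Matrix (Fin 5) (Fin 5) ℂ} {a b a' b' : EReal}
    (ha : a < 0) (hb : 0 < b) (ha' : a' < 0) (hb' : 0 < b')
    {F F' : ℂ → ℂ → Matrix (Fin 5) (Fin 5) ℝ} (hF : IsExtendedFrame D (strip a b) F)
    (hF' : IsExtendedFrame D (strip a' b') F') {ζ : ℂ} (hζ : ‖ζ‖ = 1) {z : ℂ}
    (hz : z ∈ strip a b) (hz' : z ∈ strip a' b') : (F z ζ).col 4 = (F' z ζ).col 4 := by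
  obtain ⟨hF0, hFl, V, hV, hFV⟩ := hF
  obtain ⟨hF0', hFl', V', hV', hFV'⟩ := hF'
  have hsign : ∀ w ∈ strip a b ∩ strip a' b', ∃ ε : ℝ, (ε = 1 ∨ ε = -1) ∧
      (F w ζ).col 4 = ε • (F' w ζ).col 4 := fun w hw => by
    obtain ⟨ε, hε, h⟩ := iwasawa_col_unique (hFl w hw.1) (hFl' w hw.2) (hV w hw.1) (hV' w hw.2)
      fun ζ hζ => (hFV w hw.1 ζ hζ).symm.trans (hFV' w hw.2 ζ hζ)
    exact ⟨ε, hε, h ζ hζ⟩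
  have hunit : ∀ w ∈ strip a' b', lorentzInner ((F' w ζ).col 4) ((F' w ζ).col 4) = 1 :=
    fun w hw => by rw [lorentzInner_col ((hFl' w hw).2 ζ hζ).1.1]; simp [lorentzMetric]
  have hval : ∀ w ∈ strip a b ∩ strip a' b', ∀ ε : ℝ, (F w ζ).col 4 = ε • (F' w ζ).col 4 →
      lorentzInner ((F w ζ).col 4) ((F' w ζ).col 4) = ε := fun w hw ε h => by
    have h1 := hunit w hw.2
    rw [h]
    simp only [lorentzInner_eq, Pi.smul_apply, smul_eq_mul] at h1 ⊢
    linear_combination ε * h1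
  have hpre : IsPreconnected (strip a b ∩ strip a' b') := by
    rw [strip_inter_strip]; exact isPreconnected_strip _ _
  have hcont : ContinuousOn (fun w => lorentzInner ((F w ζ).col 4) ((F' w ζ).col 4))
      (strip a b ∩ strip a' b') := by
    have h1 := fun i => ((hF0 ζ hζ).2 i 4).continuousOn.mono
      (Set.inter_subset_left (t := strip a' b'))
    have h2 := fun i => ((hF0' ζ hζ).2 i 4).continuousOn.mono
      (Set.inter_subset_right (s := strip a b))
    simp only [lorentzInner_eq, Matrix.col_apply]
    exact (((((h1 0).mul (h2 0)).neg.add ((h1 1).mul (h2 1))).add ((h1 2).mul (h2 2))).add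
      ((h1 3).mul (h2 3))).add ((h1 4).mul (h2 4))
  have h0 : (0 : ℂ) ∈ strip a b ∩ strip a' b' := by
    simpa using And.intro (ofReal_mem_strip ha hb 0) (ofReal_mem_strip ha' hb' 0)
  -- The sign equals the pairing of the two unit normals. It is continuous on a connected strip and
  -- equals `1` at the origin, where both frames are the identity.
  have hone := hpre.eq_of_sq_eq (g := fun _ => 1) hcont continuousOn_const
    (fun w hw => by
      obtain ⟨ε, hε, h⟩ := hsign w hw
      simp only [Pi.pow_apply, hval w hw ε h, one_pow]
      rcases hε with rfl | rfl <;> norm_num)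
    (fun _ => one_ne_zero) h0 (by
      refine hval 0 h0 1 ?_
      rw [(hF0 ζ hζ).1, (hF0' ζ hζ).1, one_smul]) ⟨hz, hz'⟩
  obtain ⟨ε, -, h⟩ := hsign z ⟨hz, hz'⟩
  have h1 := hval z ⟨hz, hz'⟩ ε h
  simp only at hone
  rw [h, ← h1, hone, one_smul]

/-- The normal vector of the Gauss frame moves with the symmetries of the surface. -/
theorem frame_normal_equivariant {S : Set ℂ} (hS : IsOpen S) {y : ℂ → EuclideanSpace ℝ (Fin 4)}
    (hy : IsConformalImmersion S y) {F : ℂ → Matrix (Fin 5) (Fin 5) ℝ}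
    (hF : ∀ z ∈ S, ∃ E, IsGaussFrame y z E ∧ ∃ k ∈ KGroup, F z = E * k) {a : ℂ}
    (ha : ∀ z ∈ S, z + a ∈ S) {R : Matrix (Fin 5) (Fin 5) ℝ} (hR : R ∈ SOPlus)
    (h : ∀ z ∈ S, ∃ ρ : ℝ, 0 < ρ ∧ R *ᵥ lightVector (y z) = ρ • lightVector (y (z + a))) {z : ℂ}
    (hz : z ∈ S) : (F (z + a)).col 4 = R *ᵥ (F z).col 4 := by
  obtain ⟨E, hE, k, hk, hFk⟩ := hF z hz
  obtain ⟨E', hE', k', hk', hFk'⟩ := hF _ (ha z hz)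
  have h1 := IsGaussFrame.unique hS hy (ha z hz) hE' (hE.moebius hS hy ha hR h hz)
  have hcol : ∀ (A B : Matrix (Fin 5) (Fin 5) ℝ), B *ᵥ Pi.single 4 1 = Pi.single 4 1 →
      (A * B).col 4 = A.col 4 := fun A B hB => by
    rw [← Matrix.mulVec_single_one, ← mulVec_mulVec, hB, Matrix.mulVec_single_one]
  rw [hFk, hFk', hcol _ _ hk.2, hcol _ _ hk'.2, h1, ← Matrix.mulVec_single_one, ← mulVec_mulVec,
    Matrix.mulVec_single_one]

/-! ### The cylinder potential as a Maurer–Cartan form, and its monodromy. -/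

theorem realU_eq_realPotential {w : ℂ} (hw : w.re ^ 2 + w.im ^ 2 = 1) (c : ℝ) :
    realU (w / ((√2 : ℝ) : ℂ)) 0 (2 * c * Complex.I) = realPotential w.re w.im c := by
  have hs2 : √2 ^ 2 = 2 := Real.sq_sqrt (by norm_num)
  have hs0 : √2 ≠ 0 := by positivity
  have h1 : (w / ((√2 : ℝ) : ℂ)).re = w.re / √2 := by simp
  have h2 : (w / ((√2 : ℝ) : ℂ)).im = w.im / √2 := by simp
  have h3 : (w.re / √2) ^ 2 + (w.im / √2) ^ 2 = 1 / 2 := by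
    rw [div_pow, div_pow, hs2]; linarith
  have h4 : ∀ r : ℝ, 2 * (r / √2) = √2 * r := fun r => by
    field_simp; rw [hs2, mul_comm]
  have h5 : (2 * c * Complex.I : ℂ).re = 0 := by simp
  have h6 : (2 * c * Complex.I : ℂ).im = 2 * c := by simp
  rw [realU, h1, h2, h3, h4, h4, h5, h6]
  ext i j
  fin_cases i <;> fin_cases j <;> simp [realPotential] <;> ring

theorem realW_col_four {w : ℂ} (c : ℝ) :
    (realW (w / ((√2 : ℝ) : ℂ)) 0 (2 * c * Complex.I)).col 4
      = ![0, 0, √2 * w.im, √2 * w.re, 0] := by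
  have hs2 : √2 ^ 2 = 2 := Real.sq_sqrt (by norm_num)
  have hs0 : √2 ≠ 0 := by positivity
  ext i
  fin_cases i <;> simp [realW] <;> field_simp <;> rw [hs2, mul_comm]

theorem cylinderPotential_eq_uForm (θ c : ℝ) {ζ : ℂ} (hζ : ‖ζ‖ = 1) :
    cylinderPotential θ c ζ
      = uForm (Complex.exp (Complex.I * θ) / ((√2 : ℝ) : ℂ)) 0 (2 * c * Complex.I) ζ := by
  rw [cylinderPotential_eq_map θ c hζ, uForm_eq_map _ _ _ hζ, mul_zero, ← mul_div_assoc,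
    realU_eq_realPotential (normSq_phase θ hζ)]

/-- The given frame `F` is known only modulo `K`, so it is compared with the constructed frame `F'`
through the normals alone. These agree on the common strip; they move by `R(p)` for the surface and
by `F'(p) = exp(pD)` for the constructed frame. -/
theorem hasRealPeriod_iff_exp_eq_one {θ c : ℝ} {a b : EReal} (ha : a < 0) (hb : 0 < b)
    {y : ℂ → ℂ → EuclideanSpace ℝ (Fin 4)}
    (h : ProducesFamily (cylinderPotential θ c) (strip a b) y) {ζ : ℂ} (hζ : ‖ζ‖ = 1) (p : ℝ) :
    HasRealPeriod (strip a b) (y ζ) p ↔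
      NormedSpace.exp ((p : ℂ) • cylinderPotential θ c ζ) = 1 := by
  obtain ⟨F, hF, hfam⟩ := h
  obtain ⟨⟨hconf, -⟩, ⟨R, -, -, -, hRG, hR⟩, hgauss⟩ := hfam ζ hζ
  obtain ⟨ε, hε, k, β, s, hk0, hβ0, hs0, -, F', hF', hder⟩ :=
    exists_extended_frame (Complex.exp (Complex.I * θ) / ((√2 : ℝ) : ℂ)) 0 (2 * c * Complex.I)
      (D := cylinderPotential θ c) fun ζ hζ => cylinderPotential_eq_uForm θ c hζ
  have hε₁ : ((-ε : ℝ) : EReal) < 0 := EReal.coe_neg'.2 (neg_lt_zero.2 hε)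
  have hε₂ : (0 : EReal) < (ε : EReal) := EReal.coe_pos.2 hε
  have hr' : ∀ r : ℝ, (r : ℂ) ∈ strip ((-ε : ℝ) : EReal) (ε : EReal) := ofReal_mem_strip hε₁ hε₂
  have h0' : (0 : ℂ) ∈ strip ((-ε : ℝ) : EReal) (ε : EReal) := by simpa using hr' 0
  have h0 : (0 : ℂ) ∈ strip a b := by simpa using ofReal_mem_strip ha hb 0
  have hF'0 := (hF'.1 ζ hζ).1
  have hexp : (F' p ζ).map (fun x : ℝ => (x : ℂ))
      = NormedSpace.exp ((p : ℂ) • cylinderPotential θ c ζ) := by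
    have h1 := (hder ζ hζ 0 h0').2.2 p
    rwa [zero_add, hF'0, map_ofReal_one, mul_one] at h1
  have htr : ∀ z ∈ strip ((-ε : ℝ) : EReal) (ε : EReal), F' (z + p) ζ = F' p ζ * F' z ζ :=
    fun z hz => map_ofReal_injective (by rw [(hder ζ hζ z hz).2.2 p, map_ofReal_mul, hexp])
  have hF'G : F' p ζ ∈ SOPlus := ((hF'.2.1 _ (hr' p)).2 ζ hζ).1
  -- This is `R(p)⁻¹ exp(pD)`, which fixes every normal over the common strip.
  have hone : lorentzAdjoint (R p) * F' p ζ = 1 := by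
    refine eq_one_of_fixes_frame (F := fun z => F' z ζ) (c := c)
      (mul_mem_SOPlus (lorentzAdjoint_mem_SOPlus (hRG p)) hF'G)
      ((isOpen_strip a b).inter (isOpen_strip ((-ε : ℝ) : EReal) (ε : EReal)))
      (fun r => ⟨ofReal_mem_strip ha hb r, hr' r⟩) (normSq_phase θ hζ) hF'0 (fun r j => ?_)
      (fun r => ?_) fun z hz => ?_
    · have h1 := (hder ζ hζ r (hr' r)).1 j
      rwa [Complex.ofReal_im, hk0, hβ0, hs0, mul_zero, ← mul_div_assoc,
        realU_eq_realPotential (normSq_phase θ hζ)] at h1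
    · have h1 := (hder ζ hζ r (hr' r)).2.1 4
      rwa [Complex.ofReal_im, hk0, hβ0, hs0, mul_zero, ← mul_div_assoc, realW_col_four] at h1
    · have h1 := frame_normal_equivariant (isOpen_strip a b) hconf hgauss
        (fun z hz => add_ofReal_mem_strip hz p) (hRG p) (fun z hz => hR z hz p) hz.1
      rw [extendedFrame_normal_unique ha hb hε₁ hε₂ hF hF' hζ hz.1 hz.2,
        extendedFrame_normal_unique ha hb hε₁ hε₂ hF hF' hζ (add_ofReal_mem_strip hz.1 p)
          (add_ofReal_mem_strip hz.2 p), htr z hz.2] at h1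
      have h2 : (F' p ζ * F' z ζ).col 4 = F' p ζ *ᵥ (F' z ζ).col 4 := by
        rw [← Matrix.mulVec_single_one, ← mulVec_mulVec, Matrix.mulVec_single_one]
      rw [← mulVec_mulVec, ← h2, h1, mulVec_mulVec, lorentzAdjoint_mul_self (hRG p).1, one_mulVec]
  have hRF : R p = F' p ζ := by
    have h1 := congrArg (R p * ·) hone
    simpa only [← mul_assoc, self_mul_lorentzAdjoint (hRG p).1, one_mul, mul_one] using h1.symm
  obtain ⟨E, hE, -⟩ := hgauss 0 h0
  rw [hasRealPeriod_iff (isOpen_strip a b) hconf (fun z hz => add_ofReal_mem_strip hz p) (hRG p)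
    (fun z hz => hR z hz p) h0 hE, hRF, ← hexp, ← map_ofReal_one]
  exact ⟨fun h => by rw [h], fun h => map_ofReal_injective h⟩

/-! ### Eigenvalues and periods -/

theorem phase_one (θ : ℝ) : ((1 : ℂ)⁻¹ * Complex.exp (Complex.I * θ)).re = Real.cos θ ∧
    ((1 : ℂ)⁻¹ * Complex.exp (Complex.I * θ)).im = Real.sin θ := by
  rw [inv_one, one_mul, mul_comm, Complex.exp_ofReal_mul_I_re, Complex.exp_ofReal_mul_I_im]
  exact ⟨rfl, rfl⟩

theorem cylinderPotential_one (θ c : ℝ) : cylinderPotential θ c 1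
    = (realPotential (Real.cos θ) (Real.sin θ) c).map (fun x : ℝ => (x : ℂ)) := by
  rw [cylinderPotential_eq_map θ c norm_one, (phase_one θ).1, (phase_one θ).2]

theorem radicand_nonneg (θ c : ℝ) :
    0 ≤ 1 + 2 * c * Real.sin θ * Real.cos θ - Real.sin θ ^ 2 + c ^ 2 := by
  have h : 1 + 2 * c * Real.sin θ * Real.cos θ - Real.sin θ ^ 2 + c ^ 2
      = (Real.cos θ + c * Real.sin θ) ^ 2 + (c * Real.cos θ) ^ 2 := by
    linear_combination (-1 - c ^ 2) * Real.sin_sq_add_cos_sq θ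
  rw [h]; positivity

theorem cylinderPotential_one_roots {θ c r : ℝ}
    (hr : r ^ 2 = 1 + 2 * c * Real.sin θ * Real.cos θ - Real.sin θ ^ 2 + c ^ 2) {w₁ w₂ : ℂ}
    (h₁ : w₁ ^ 2 = ((-2 + 2 * r : ℝ) : ℂ)) (h₂ : w₂ ^ 2 = ((-2 - 2 * r : ℝ) : ℂ)) :
    (cylinderPotential θ c 1).charpoly.roots = {0, w₁, -w₁, w₂, -w₂} := by
  rw [cylinderPotential_one]
  refine charpoly_roots_of_det (det_scalar_sub_realPotential (Real.cos_sq_add_sin_sq θ)) ?_ ?_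
  · rw [h₁, h₂]; push_cast; ring
  · rw [h₁, h₂]
    have h : (-2 + 2 * r) * (-2 - 2 * r)
        = 4 * Real.sin θ ^ 2 - 8 * c * Real.cos θ * Real.sin θ - 4 * c ^ 2 := by
      linear_combination (-4) * hr
    exact_mod_cast h

theorem exp_cylinderPotential_eq_one_iff_of_sin {θ c : ℝ} (hθ : Real.sin θ = 1) {p : ℝ}
    (hp : 0 < p) : NormedSpace.exp ((p : ℂ) • cylinderPotential θ c 1) = 1 ↔
      ∃ m l : ℕ, 0 < m ∧ 0 < l ∧ c = ((m : ℝ) ^ 2 - l ^ 2) / (m ^ 2 + l ^ 2) ∧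
        p = Real.pi * √((m : ℝ) ^ 2 + l ^ 2) := by
  have hcos : Real.cos θ = 0 := by
    have := Real.sin_sq_add_cos_sq θ
    rw [hθ] at this
    exact pow_eq_zero_iff two_ne_zero |>.1 (by linarith)
  rw [cylinderPotential_one, hθ, hcos]
  refine matrix_exp_eq_one_iff (fun t => ?_) (fun h => ?_)
    (fun h p hp => matrix_exp_realPotential_ne_one h hp) hp
  · rw [det_scalar_sub_realPotential (by norm_num)]; push_cast; ring
  · rw [h]; exact realPotential_cube

/-- For `c = 0` the parameter is `g = x`; the bounds on `x` exclude the degenerate values `0` and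
`±1`. -/
theorem exp_cylinderPotential_eq_one_iff_of_phase {θ x y : ℝ} (hxy : x ^ 2 + y ^ 2 = 1)
    (hx0 : 0 < x) (hx1 : x < 1) {ζ : ℂ} (hζ : ‖ζ‖ = 1)
    (hphase : ζ⁻¹ * Complex.exp (Complex.I * θ) = x + y * Complex.I) {p : ℝ} (hp : 0 < p) :
    NormedSpace.exp ((p : ℂ) • cylinderPotential θ 0 ζ) = 1 ↔
      ∃ m l : ℕ, 0 < m ∧ 0 < l ∧ x = ((m : ℝ) ^ 2 - l ^ 2) / (m ^ 2 + l ^ 2) ∧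
        p = Real.pi * √((m : ℝ) ^ 2 + l ^ 2) := by
  have e : cylinderPotential θ 0 ζ = (realPotential x y 0).map (fun x : ℝ => (x : ℂ)) := by
    rw [cylinderPotential_eq_map θ 0 hζ, hphase]; simp
  rw [e]
  refine matrix_exp_eq_one_iff (fun t => ?_) (fun h => absurd h hx0.ne') (fun h => ?_) hp
  · rw [det_scalar_sub_realPotential hxy]
    have hxy' : (x : ℂ) ^ 2 + (y : ℂ) ^ 2 = 1 := by exact_mod_cast hxy
    push_cast
    linear_combination 4 * t * hxy'
  · rcases h with rfl | rfl <;> linarith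

theorem exists_member_with_period {θ : ℝ} {a b : EReal} (ha : a < 0) (hb : 0 < b)
    {y : ℂ → ℂ → EuclideanSpace ℝ (Fin 4)}
    (h : ProducesFamily (cylinderPotential θ 0) (strip a b) y) {m : ℕ} (hm : 2 ≤ m) :
    ∃ ζ : ℂ, ‖ζ‖ = 1 ∧ IsLeast {q : ℝ | 0 < q ∧ HasRealPeriod (strip a b) (y ζ) q}
      (Real.pi * √((m : ℝ) ^ 2 + 1)) := by
  have hm2 : (2 : ℝ) ≤ m := by exact_mod_cast hm
  have hpos : (0 : ℝ) < (m : ℝ) ^ 2 + 1 := by positivity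
  -- `u + iv` is the rational point of the circle attached to the coprime pair `(m, 1)`, and `ζ` is
  -- chosen to have this phase. The bound `m ≥ 2` makes `u` positive.
  obtain ⟨u, hu⟩ : ∃ u : ℝ, u = ((m : ℝ) ^ 2 - 1) / (m ^ 2 + 1) := ⟨_, rfl⟩
  obtain ⟨v, hv⟩ : ∃ v : ℝ, v = 2 * m / ((m : ℝ) ^ 2 + 1) := ⟨_, rfl⟩
  have huv : u ^ 2 + v ^ 2 = 1 := by
    rw [hu, hv]; field_simp; ring
  have hu0 : 0 < u := by rw [hu]; exact div_pos (by nlinarith) hpos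
  have hu1 : u < 1 := by rw [hu, div_lt_one hpos]; linarith
  have hw : ‖(u + v * Complex.I : ℂ)‖ = 1 := by
    rw [Complex.norm_add_mul_I, huv, Real.sqrt_one]
  have hw0 : (u + v * Complex.I : ℂ) ≠ 0 := fun h0 => by simp [h0] at hw
  have he : ‖Complex.exp (Complex.I * θ)‖ = 1 := by
    rw [mul_comm, Complex.norm_exp_ofReal_mul_I]
  have hζ : ‖Complex.exp (Complex.I * θ) / (u + v * Complex.I)‖ = 1 := by
    rw [norm_div, he, hw, div_one]
  have hphase : (Complex.exp (Complex.I * θ) / (u + v * Complex.I))⁻¹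
      * Complex.exp (Complex.I * θ) = u + v * Complex.I := by
    have := Complex.exp_ne_zero (Complex.I * θ)
    field_simp
  refine ⟨_, hζ, ?_⟩
  have hset : {q : ℝ | 0 < q ∧ HasRealPeriod (strip a b)
        (y (Complex.exp (Complex.I * θ) / (u + v * Complex.I))) q}
      = {q : ℝ | 0 < q ∧ ∃ m l : ℕ, 0 < m ∧ 0 < l ∧
        u = ((m : ℝ) ^ 2 - l ^ 2) / (m ^ 2 + l ^ 2) ∧
          q = Real.pi * √((m : ℝ) ^ 2 + l ^ 2)} := by
    ext q
    refine and_congr_right fun hq => ?_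
    rw [hasRealPeriod_iff_exp_eq_one ha hb h hζ,
      exp_cylinderPotential_eq_one_iff_of_phase huv hu0 hu1 hζ hphase hq]
  rw [hset]
  simpa using isLeast_period_of_coprime (g := u) (m := m) (l := 1) (by omega) one_pos
    (Nat.coprime_one_right m) (by simpa using hu)

end

/-! ### Assembly of the proposition. -/

theorem mainTheorem12 (θ c : ℝ) :
    -- the explicit form of the potential
    (∀ ζ : ℂ, ‖ζ‖ = 1 →
      cylinderPotential θ c ζ =
        !![0, 0, 0, ((√2 : ℝ) : ℂ) * c, 0;
           0, 0, ((√2 : ℝ) : ℂ), -(((√2 : ℝ) : ℂ) * c), 0;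
           0, -((√2 : ℝ) : ℂ), 0, 0,
             -((ζ⁻¹ * Complex.exp (Complex.I * θ) + ζ * Complex.exp (-(Complex.I * θ))) / ((√2 : ℝ) : ℂ));
           ((√2 : ℝ) : ℂ) * c, ((√2 : ℝ) : ℂ) * c, 0, 0,
             -(Complex.I * (ζ⁻¹ * Complex.exp (Complex.I * θ)
                - ζ * Complex.exp (-(Complex.I * θ))) / ((√2 : ℝ) : ℂ));
           0, 0, (ζ⁻¹ * Complex.exp (Complex.I * θ) + ζ * Complex.exp (-(Complex.I * θ))) / ((√2 : ℝ) : ℂ),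
             Complex.I * (ζ⁻¹ * Complex.exp (Complex.I * θ)
                - ζ * Complex.exp (-(Complex.I * θ))) / ((√2 : ℝ) : ℂ), 0]) ∧
    -- the eigenvalues of `D(1)`, with multiplicity; the inner radicand is nonnegative
    (0 ≤ 1 + 2 * c * Real.sin θ * Real.cos θ - Real.sin θ ^ 2 + c ^ 2 ∧
      ∀ w₁ w₂ : ℂ,
        w₁ ^ 2 = ((-2 + 2 * √(1 + 2 * c * Real.sin θ * Real.cos θ - Real.sin θ ^ 2 + c ^ 2) : ℝ)
          : ℂ) →
        w₂ ^ 2 = ((-2 - 2 * √(1 + 2 * c * Real.sin θ * Real.cos θ - Real.sin θ ^ 2 + c ^ 2) : ℝ)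
          : ℂ) →
        (cylinderPotential θ c 1).charpoly.roots = {0, w₁, -w₁, w₂, -w₂}) ∧
    -- the potential produces a family of TE Willmore surfaces on some strip around the real axis
    (∃ a b : EReal, a < 0 ∧ 0 < b ∧ ∃ y : ℂ → ℂ → EuclideanSpace ℝ (Fin 4),
      ProducesFamily (cylinderPotential θ c) (strip a b) y) ∧
    -- (1): real periods for `sin θ = 1`
    (Real.sin θ = 1 →
      (∀ a b : EReal, a < 0 → 0 < b → ∀ y : ℂ → ℂ → EuclideanSpace ℝ (Fin 4),
        ProducesFamily (cylinderPotential θ c) (strip a b) y →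
        ((∃ p : ℝ, 0 < p ∧ HasRealPeriod (strip a b) (y 1) p) ↔
          ∃ m l : ℕ, 0 < m ∧ 0 < l ∧ c = ((m : ℝ) ^ 2 - l ^ 2) / (m ^ 2 + l ^ 2)) ∧
        (∀ p : ℝ, 0 < p →
          (HasRealPeriod (strip a b) (y 1) p ↔
            ∃ m l : ℕ, 0 < m ∧ 0 < l ∧ c = ((m : ℝ) ^ 2 - l ^ 2) / (m ^ 2 + l ^ 2) ∧
              p = Real.pi * √((m : ℝ) ^ 2 + l ^ 2))) ∧
        (∀ m l : ℕ, 0 < m → 0 < l → Nat.Coprime m l →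
          c = ((m : ℝ) ^ 2 - l ^ 2) / (m ^ 2 + l ^ 2) →
          IsLeast {p : ℝ | 0 < p ∧ HasRealPeriod (strip a b) (y 1) p}
            (Real.pi * √((m : ℝ) ^ 2 + l ^ 2)))) ∧
      (c = 1 ∨ c = -1 → ∀ p : ℝ, p ≠ 0 →
        NormedSpace.exp ((p : ℂ) • cylinderPotential θ c 1) ≠ 1)) ∧
    -- (2): the associated family for `c = 0`
    (c = 0 →
      (∀ w₁ w₂ : ℂ,
        w₁ ^ 2 = ((-2 + 2 * Real.cos θ : ℝ) : ℂ) → w₂ ^ 2 = ((-2 - 2 * Real.cos θ : ℝ) : ℂ) →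
        (cylinderPotential θ c 1).charpoly.roots = {0, w₁, -w₁, w₂, -w₂}) ∧
      ∀ a b : EReal, a < 0 → 0 < b → ∀ y : ℂ → ℂ → EuclideanSpace ℝ (Fin 4),
        ProducesFamily (cylinderPotential θ c) (strip a b) y →
        {p : ℝ | ∃ ζ : ℂ, ‖ζ‖ = 1 ∧
          IsLeast {q : ℝ | 0 < q ∧ HasRealPeriod (strip a b) (y ζ) q} p}.Infinite) := by
  refine ⟨fun ζ _ => cylinderPotential_eq θ c ζ, ⟨radicand_nonneg θ c, fun w₁ w₂ h₁ h₂ =>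
    cylinderPotential_one_roots (Real.sq_sqrt (radicand_nonneg θ c)) h₁ h₂⟩,
    exists_producesFamily _ _ _ fun ζ hζ => cylinderPotential_eq_uForm θ c hζ,
    fun hθ => ⟨fun a b ha hb y hy => ?_, fun hc p hp => ?_⟩, ?_⟩
  · have key : ∀ p : ℝ, 0 < p → (HasRealPeriod (strip a b) (y 1) p ↔
        ∃ m l : ℕ, 0 < m ∧ 0 < l ∧ c = ((m : ℝ) ^ 2 - l ^ 2) / (m ^ 2 + l ^ 2) ∧
          p = Real.pi * √((m : ℝ) ^ 2 + l ^ 2)) := fun p hp => by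
      rw [hasRealPeriod_iff_exp_eq_one ha hb hy norm_one,
        exp_cylinderPotential_eq_one_iff_of_sin hθ hp]
    refine ⟨⟨?_, ?_⟩, key, fun m l hm hl hml hc => ?_⟩
    · rintro ⟨p, hp, h⟩
      obtain ⟨m, l, hm, hl, hc, -⟩ := (key p hp).1 h
      exact ⟨m, l, hm, hl, hc⟩
    · rintro ⟨m, l, hm, hl, hc⟩
      have hm' : (0 : ℝ) < m := by exact_mod_cast hm
      have hp : 0 < Real.pi * √((m : ℝ) ^ 2 + l ^ 2) := by have := Real.pi_pos; positivity
      exact ⟨_, hp, (key _ hp).2 ⟨m, l, hm, hl, hc, rfl⟩⟩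
    · have hset : {p : ℝ | 0 < p ∧ HasRealPeriod (strip a b) (y 1) p}
          = {p : ℝ | 0 < p ∧ ∃ m l : ℕ, 0 < m ∧ 0 < l ∧
            c = ((m : ℝ) ^ 2 - l ^ 2) / (m ^ 2 + l ^ 2) ∧
              p = Real.pi * √((m : ℝ) ^ 2 + l ^ 2)} := by
        ext p
        exact and_congr_right fun hp => key p hp
      rw [hset]
      exact isLeast_period_of_coprime hm hl hml hc
  · have hcos : Real.cos θ = 0 := by
      have := Real.sin_sq_add_cos_sq θ
      rw [hθ] at this
      exact pow_eq_zero_iff two_ne_zero |>.1 (by linarith)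
    rw [cylinderPotential_one, hθ, hcos]
    exact matrix_exp_realPotential_ne_one hc hp
  · rintro rfl
    -- Only `r²` is prescribed there, so `cos θ` may replace the square root whatever its sign.
    refine ⟨fun w₁ w₂ h₁ h₂ => cylinderPotential_one_roots (r := Real.cos θ) ?_ h₁ h₂,
      fun a b ha hb y hy => ?_⟩
    · linear_combination Real.sin_sq_add_cos_sq θ
    -- The shift by `2` respects the bound `m ≥ 2`; distinct `m` give distinct least periods `π√(m²
    -- + 1)`.
    · refine Set.infinite_of_injective_forall_mem
        (f := fun n : ℕ => Real.pi * √(((n + 2 : ℕ) : ℝ) ^ 2 + 1)) (fun n n' h => ?_)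
        fun n => exists_member_with_period ha hb hy (by omega)
      have h1 := mul_left_cancel₀ Real.pi_ne_zero h
      rw [Real.sqrt_inj (by positivity) (by positivity)] at h1
      have h2 : ((n + 2 : ℕ) : ℝ) = ((n' + 2 : ℕ) : ℝ) :=
        (pow_left_inj₀ (by positivity) (by positivity) two_ne_zero).1 (by linarith)
      have h3 : n + 2 = n' + 2 := by exact_mod_cast h2
      omega
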